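/- \textbf{Conventions.} All complexes are finite abstract simplicial complexes with vertices in $\mathbb N$; generators are the maximal simplexes; $|K|$ is the geometric realization. For a nonempty simplex $A\in K$ and a vertex $a\notin K$, the stellar subdivision of $K$ in $A$ at $a$ replaces the star $A\star \mathrm{lk}(A,K)$ by $a\star\partial A\star \mathrm{lk}(A,K)$; a weld is the inverse of a subdivision. Two complexes are stellar equivalent if they are related by finitely many subdivisions, welds and relabellings of vertices. A stellar $d$-ball ($d$-sphere) is a complex stellar equivalent to the $d$-simplex (to the boundary of the $(d+1)$-simplex). A stellar $n$-manifold is a complex in which the link of every vertex is a stellar $(n-1)$-ball or a stellar $(n-1)$-sphere. An equivalence relation $\simeq$ on the vertices of a complex $S$ is regular if (i) no generator of $S$ has two distinct equivalent vertices, and (ii) for each generator $g$ there is at most one generator $p\ne g$ such that every vertex of $g$ is equal or equivalent to some vertex of $p$ (then $g$ and $p$ are called equivalent). $S/\!\simeq$ denotes the quotient of $|S|$ in which equivalent generators are identified, linearly, each vertex with the vertex equivalent to it; for a vertex $a\notin S$, $a\star(S/\!\simeq)$ denotes the quotient of the cone $|a\star S|$ by the same identifications of points of $|S|$ (points outside $|S|$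 are not identified with other points). We say that $M$ is triangulated by $a\star(S/\!\simeq)$ if there is a homeomorphism $a\star(S/\!\simeq)\to|M|$ whose composite with the projection $|a\star S|\to a\star(S/\!\simeq)$ is piecewise linear. \textbf{Theorem.} Let $n>2$ and let $M$ be a stellar $n$-manifold with $|M|$ connected. Then: (1) there are a stellar $(n-1)$-sphere $S$, a vertex $a\notin S$ and a regular equivalence relation $\simeq$ on the vertices of $S$ such that $M$ is triangulated by $a\star(S/\!\simeq)$; moreover they can be chosen so that in $S/\!\simeq$ simplexes of $S$ of every dimension with equivalent vertices are identified; (2) for every stellar $(n-1)$-sphere $S$, vertex $a\notin S$ and regular equivalence relation $\simeq$ on the vertices of $S$ such that $M$ is triangulated by $a\star(S/\!\simeq)$, and for all base points $x\in|M|$ and $y\in S/\!\simeq$, $$\pi_1(|M|,x)\;\cong\;\pi_1(S/\!\simeq,\,y).$$ -/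

import Mathlib

/-- A finite abstract simplicial complex with vertices in `ℕ`. The empty simplex is counted as a
face of every complex, so that joins, and links of maximal simplexes, need no special cases. -/
@[ext]
structure StellarComplex where
  faces : Finset (Finset ℕ)
  empty_mem : ∅ ∈ faces
  down_closed : ∀ σ ∈ faces, ∀ τ, τ ⊆ σ → τ ∈ faces

namespace StellarComplex

/-- `v` is a vertex of `K`. -/
def IsVertex (K : StellarComplex) (v : ℕ) : Prop := {v} ∈ K.faces

/-- The generators of `K`: its maximal simplexes. -/
def IsGenerator (K : StellarComplex) (g : Finset ℕ) : Prop :=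
  g ∈ K.faces ∧ ∀ σ ∈ K.faces, g ⊆ σ → σ = g

/-- The full simplex on the vertex set `A`. -/
def simplex (A : Finset ℕ) : StellarComplex where
  faces := A.powerset
  empty_mem := by simp
  down_closed := fun σ hσ τ hτ => by
    simp only [Finset.mem_powerset] at hσ ⊢
    exact hτ.trans hσ

/-- The boundary `∂A` of a simplex `A`: its proper faces (the empty simplex being always a face). -/
def boundary (A : Finset ℕ) : StellarComplex where
  faces := A.powerset.filter fun σ => σ = ∅ ∨ σ ≠ A
  empty_mem := by simp
  down_closed := fun σ hσ τ hτ => by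
    simp only [Finset.mem_filter, Finset.mem_powerset] at hσ ⊢
    refine ⟨hτ.trans hσ.1, ?_⟩
    rcases hσ.2 with h | h
    · exact Or.inl (Finset.subset_empty.mp (h ▸ hτ))
    · exact Or.inr fun e => h (Finset.Subset.antisymm hσ.1 (e ▸ hτ))

/-- The join `K ⋆ L` (used for complexes without common vertices). -/
def join (K L : StellarComplex) : StellarComplex where
  faces := Finset.image₂ (fun σ τ => σ ∪ τ) K.faces L.faces
  empty_mem := Finset.mem_image₂.mpr ⟨∅, K.empty_mem, ∅, L.empty_mem, by simp⟩
  down_closed := fun σ hσ τ hτ => by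
    obtain ⟨α, hα, β, hβ, rfl⟩ := Finset.mem_image₂.mp hσ
    refine Finset.mem_image₂.mpr ⟨α ∩ τ, K.down_closed α hα _ Finset.inter_subset_left,
      β ∩ τ, L.down_closed β hβ _ Finset.inter_subset_left, ?_⟩
    rw [← Finset.union_inter_distrib_right]
    exact Finset.inter_eq_right.mpr hτ

/-- The union of two complexes. -/
def union (K L : StellarComplex) : StellarComplex where
  faces := K.faces ∪ L.faces
  empty_mem := Finset.mem_union_left _ K.empty_mem
  down_closed := fun σ hσ τ hτ => by
    rcases Finset.mem_union.mp hσ with h | h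
    · exact Finset.mem_union_left _ (K.down_closed σ h τ hτ)
    · exact Finset.mem_union_right _ (L.down_closed σ h τ hτ)

/-- The link `lk(A, K)` of a simplex `A` of `K`. -/
def link (A : Finset ℕ) (K : StellarComplex) : StellarComplex where
  faces := K.faces.filter fun B => B = ∅ ∨ (Disjoint A B ∧ A ∪ B ∈ K.faces)
  empty_mem := by simp [K.empty_mem]
  down_closed := fun σ hσ τ hτ => by
    simp only [Finset.mem_filter] at hσ ⊢
    refine ⟨K.down_closed σ hσ.1 τ hτ, ?_⟩
    rcases hσ.2 with h | h
    · exact Or.inl (Finset.subset_empty.mp (h ▸ hτ))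
    · exact Or.inr ⟨h.1.mono_right hτ,
        K.down_closed _ h.2 _ (Finset.union_subset_union_right hτ)⟩

/-- The complex of the simplexes of `K` that do not contain `A`. -/
def avoiding (A : Finset ℕ) (K : StellarComplex) : StellarComplex where
  faces := K.faces.filter fun σ => σ = ∅ ∨ ¬ A ⊆ σ
  empty_mem := by simp [K.empty_mem]
  down_closed := fun σ hσ τ hτ => by
    simp only [Finset.mem_filter] at hσ ⊢
    refine ⟨K.down_closed σ hσ.1 τ hτ, ?_⟩
    rcases hσ.2 with h | h
    · exact Or.inl (Finset.subset_empty.mp (h ▸ hτ))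
    · exact Or.inr fun e => h (e.trans hτ)

/-- Starring of `K` at `a` in the simplex `A`: the star `A ⋆ lk(A, K)` is replaced by
`a ⋆ ∂A ⋆ lk(A, K)`. -/
def starring (K : StellarComplex) (A : Finset ℕ) (a : ℕ) : StellarComplex :=
  ((simplex {a}).join ((boundary A).join (link A K))).union (avoiding A K)

/-- Change of the enumeration of the vertices. -/
def relabel (K : StellarComplex) (e : Equiv.Perm ℕ) : StellarComplex where
  faces := K.faces.image fun σ => σ.map e.toEmbedding
  empty_mem := Finset.mem_image.mpr ⟨∅, K.empty_mem, by simp⟩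
  down_closed := fun σ hσ τ hτ => by
    obtain ⟨α, hα, rfl⟩ := Finset.mem_image.mp hσ
    obtain ⟨β, hβ, rfl⟩ := Finset.subset_map_iff.mp hτ
    exact Finset.mem_image.mpr ⟨β, K.down_closed α hα β hβ, rfl⟩

/-- The elementary stellar moves: a stellar subdivision in a nonempty simplex of `K` at a new
vertex, or a change of enumeration. Welds are the inverses of subdivisions. -/
inductive StellarMove : StellarComplex → StellarComplex → Prop
  | subdivision (K : StellarComplex) (A : Finset ℕ) (a : ℕ) (hA : A ∈ K.faces)
      (hne : A.Nonempty) (ha : ¬ K.IsVertex a) : StellarMove K (K.starring A a)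
  | relabel (K : StellarComplex) (e : Equiv.Perm ℕ) : StellarMove K (K.relabel e)

/-- Stellar equivalence: a finite sequence of subdivisions, welds and changes of enumeration. -/
def StellarEquiv : StellarComplex → StellarComplex → Prop := Relation.EqvGen StellarMove

/-- Stellar `d`-balls. -/
def IsStellarBall (d : ℕ) (K : StellarComplex) : Prop :=
  StellarEquiv K (simplex (Finset.range (d + 1)))

/-- Stellar `d`-spheres. -/
def IsStellarSphere (d : ℕ) (K : StellarComplex) : Prop :=
  StellarEquiv K (boundary (Finset.range (d + 2)))

/-- Stellar `n`-manifolds, `n ≥ 1`: the link of every vertex is a stellar `(n-1)`-ball or a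
stellar `(n-1)`-sphere. -/
def IsStellarManifold (n : ℕ) (M : StellarComplex) : Prop :=
  ∀ v, M.IsVertex v →
    IsStellarBall (n - 1) (link {v} M) ∨ IsStellarSphere (n - 1) (link {v} M)

/-- The geometric realization, in barycentric coordinates. -/
def realization (K : StellarComplex) : Set (ℕ → ℝ) :=
  {x | (∀ i, 0 ≤ x i) ∧ ∃ σ ∈ K.faces, (∀ i, i ∉ σ → x i = 0) ∧ ∑ i ∈ σ, x i = 1}

/-- Every vertex of `σ` is equal or equivalent to some vertex of `τ`. -/
def Subordinate (r : Setoid ℕ) (σ τ : Finset ℕ) : Prop := ∀ u ∈ σ, ∃ v ∈ τ, r u v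

/-- Regular equivalence relations on the vertices of `S`. Only the restriction of `r` to the
vertices of `S` matters here and below. -/
structure IsRegular (S : StellarComplex) (r : Setoid ℕ) : Prop where
  inj : ∀ g, S.IsGenerator g → ∀ u ∈ g, ∀ v ∈ g, r u v → u = v
  unique : ∀ g, S.IsGenerator g → ∀ p q, S.IsGenerator p → S.IsGenerator q → p ≠ g → q ≠ g →
    Subordinate r g p → Subordinate r g q → p = q

/-- The points `x` of the simplex `σ` and `y` of the simplex `τ` have the same barycentric
coordinates with respect to equivalent vertices. -/
def Corresponding (S : StellarComplex) (r : Setoid ℕ) (σ τ : Finset ℕ) (x y : ℕ → ℝ) : Prop :=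
  x ∈ S.realization ∧ y ∈ S.realization ∧ (∀ i, i ∉ σ → x i = 0) ∧ (∀ i, i ∉ τ → y i = 0) ∧
    Subordinate r σ τ ∧ ∀ u ∈ σ, ∀ v ∈ τ, r u v → x u = y v

/-- The gluing of points which identifies equivalent generators of `S` with each other, vertices
going to equivalent vertices. A point outside the realization of `S` is glued to itself only. -/
def gluing (S : StellarComplex) (r : Setoid ℕ) : Setoid (ℕ → ℝ) :=
  Relation.EqvGen.setoid fun x y =>
    ∃ g p, S.IsGenerator g ∧ S.IsGenerator p ∧ Corresponding S r g p x y

/-- The space `S/≃`. -/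
abbrev GluedSpace (S : StellarComplex) (r : Setoid ℕ) : Type :=
  Quotient ((gluing S r).comap (Subtype.val : S.realization → (ℕ → ℝ)))

/-- The cone `a ⋆ S`. -/
def cone (a : ℕ) (S : StellarComplex) : StellarComplex := (simplex {a}).join S

/-- The space `a ⋆ (S/≃)`: the ball `a ⋆ S` with equivalent generators of `S` identified, while
the generators of `a ⋆ S` stay distinct. -/
abbrev GluedCone (a : ℕ) (S : StellarComplex) (r : Setoid ℕ) : Type :=
  Quotient ((gluing S r).comap (Subtype.val : (cone a S).realization → (ℕ → ℝ)))

/-- Piecewise linear maps on a compact polyhedron `X`: continuous maps that are given at each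
point by one of finitely many affine maps. -/
def IsPL {X : Set (ℕ → ℝ)} (f : X → (ℕ → ℝ)) : Prop :=
  Continuous f ∧ ∃ F : Set ((ℕ → ℝ) →ᵃ[ℝ] (ℕ → ℝ)), F.Finite ∧ ∀ x : X, ∃ A ∈ F, f x = A x

/-- `M` is triangulated by `a ⋆ (S/≃)`: there is a homeomorphism of `a ⋆ (S/≃)` onto the
realization of `M` that is piecewise linear on `a ⋆ S`. -/
def IsTriangulatedBy (M : StellarComplex) (a : ℕ) (S : StellarComplex) (r : Setoid ℕ) : Prop :=
  ∃ h : GluedCone a S r ≃ₜ M.realization,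
    IsPL fun x : (cone a S).realization => (h (Quotient.mk _ x) : ℕ → ℝ)

end StellarComplex

/-! Part (1) cuts `M` open into a ball. The combinatorial input is `IsNormalPseudomanifold`: the
complex is pure, a face of codimension one lies in at most two facets, and any two facets containing
a simplex `σ` (possibly empty) are joined by a chain of facets containing `σ`, consecutive ones
sharing a face of codimension one. Simplexes and their boundaries have this property, and it passes
through stellar moves in both directions, so the vertex links of `M` have it; since `|M|` is
connected, `M` has it too.

Starting from one facet, copies of further facets of `M` are attached one at a time to a ball `B`
along a facet `F` of its boundary sphere `S`. Attaching `v ⋆ F` replaces `S` by its starring in `F`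
at `v`, again a stellar sphere, and changes the cone over `S` by a bistellar move, which is a
piecewise linear homeomorphism. Thus `B` stays parametrized by `a ⋆ S` (`IsUnfolding.glue`). Chains
at `σ = ∅` allow the process to continue until every facet of `M` has exactly one copy. The vertex
map `φ : B → M` then induces a surjection of realizations. Two points with the same image are
related by a chain of facets around the carrier of that image, and each step crosses either a face
interior to `B`, where the lifted point does not move, or a pair of equivalent generators of `S`. So
the fibres are exactly the gluing classes (`IsUnfolding.isTriangulatedBy`). As only the image in `M`
matters, corresponding points of simplexes of every dimension are identified.

Part (2): in `a ⋆ (S/≃)` the apex is the centre of an embedded `n`-cell, and the complement of the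
apex deforms onto `S/≃` along the segments of the cone. A map of a square into a cell of dimension
greater than two can be perturbed off the centre (`exists_pushOff`). Applied to loops this gives
surjectivity of the map on `π₁` induced by the inclusion of `S/≃`; applied to homotopies of loops it
gives injectivity. -/

namespace StellarComplex

/-! ### Normal pseudomanifolds and the faces of a starring -/

open Finset

/-- The simplexes of dimension `d`. -/
def IsFacet (d : ℕ) (K : StellarComplex) (g : Finset ℕ) : Prop := g ∈ K.faces ∧ g.card = d + 1

/-- Two `d`-simplexes containing `σ` that are equal or share a face of dimension `d - 1`. -/
def Adjacent (d : ℕ) (K : StellarComplex) (σ g h : Finset ℕ) : Prop :=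
  IsFacet d K g ∧ IsFacet d K h ∧ σ ⊆ g ∧ σ ⊆ h ∧ d ≤ (g ∩ h).card

/-- Normal pseudomanifolds of dimension `d`, possibly with boundary. -/
structure IsNormalPseudomanifold (d : ℕ) (K : StellarComplex) : Prop where
  card_le : ∀ σ ∈ K.faces, σ.card ≤ d + 1
  exists_facet : ∀ σ ∈ K.faces, ∃ g, IsFacet d K g ∧ σ ⊆ g
  at_most_two : ∀ f : Finset ℕ, f.card = d → ∀ g₁ g₂ g₃, IsFacet d K g₁ → IsFacet d K g₂ →
    IsFacet d K g₃ → f ⊆ g₁ → f ⊆ g₂ → f ⊆ g₃ → g₁ = g₂ ∨ g₁ = g₃ ∨ g₂ = g₃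
  chain : ∀ σ g h, IsFacet d K g → IsFacet d K h → σ ⊆ g → σ ⊆ h →
    Relation.ReflTransGen (Adjacent d K σ) g h

theorem isVertex_of_mem {K : StellarComplex} {σ : Finset ℕ} (hσ : σ ∈ K.faces) {v : ℕ}
    (hv : v ∈ σ) : K.IsVertex v :=
  K.down_closed σ hσ _ (singleton_subset_iff.mpr hv)

/-- Splitting `σ.erase a` into its parts inside and outside `A` recovers the factors in `∂A` and in
the link, so the join collapses to two conditions. Nonemptiness of `A` disposes of the exceptional
clauses for the empty simplex. -/
theorem mem_starring {K : StellarComplex} {A : Finset ℕ} {a : ℕ} (hA : A ∈ K.faces)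
    (hne : A.Nonempty) (ha : ¬ K.IsVertex a) {σ : Finset ℕ} :
    σ ∈ (K.starring A a).faces ↔
      ¬ A ⊆ σ ∧ (σ ∈ K.faces ∨ a ∈ σ ∧ A ∪ σ.erase a ∈ K.faces) := by
  have haA : a ∉ A := fun h => ha (isVertex_of_mem hA h)
  simp only [starring, union, join, simplex, boundary, link, avoiding, mem_union, mem_image₂,
    mem_filter, mem_powerset]
  constructor
  · rintro (⟨α, hα, _, ⟨β, ⟨hβ, hβ'⟩, γ, ⟨hγ, hγ'⟩, rfl⟩, rfl⟩ | ⟨h1, h2⟩)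
    · have hdis : Disjoint A γ := by
        rcases hγ' with rfl | h
        · simp
        · exact h.1
      have hAγ : A ∪ γ ∈ K.faces := by
        rcases hγ' with rfl | h
        · simpa using hA
        · exact h.2
      have hnot : ¬ A ⊆ α ∪ (β ∪ γ) := by
        intro h
        have hAβ : A ⊆ β := by
          intro x hx
          have := h hx
          have h3 := disjoint_left.mp hdis hx
          have h4 : x ≠ a := fun e => haA (e ▸ hx)
          have h5 : x ∉ α := fun h => h4 (by simpa using hα h)
          simp only [mem_union] at this
          tauto
        rcases hβ' with rfl | hb
        · exact hne.ne_empty (subset_empty.mp hAβ)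
        · exact hb (Subset.antisymm hβ hAβ)
      refine ⟨hnot, ?_⟩
      by_cases haσ : a ∈ α ∪ (β ∪ γ)
      · refine Or.inr ⟨haσ, K.down_closed _ hAγ _ ?_⟩
        intro x hx
        have := @hα x
        have := @hβ x
        simp only [mem_union, mem_erase, mem_singleton] at *
        tauto
      · refine Or.inl (K.down_closed _ hAγ _ ?_)
        intro x hx
        have := @hα x
        have := @hβ x
        have : x ≠ a := fun e => haσ (e ▸ hx)
        simp only [mem_union, mem_singleton] at *
        tauto
    · rcases h2 with rfl | h2
      · exact ⟨fun h => hne.ne_empty (subset_empty.mp h), Or.inl h1⟩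
      · exact ⟨h2, Or.inl h1⟩
  · rintro ⟨h1, h2 | ⟨h2, h3⟩⟩
    · exact Or.inr ⟨h2, Or.inr h1⟩
    · refine Or.inl ⟨{a}, Subset.rfl, _, ⟨σ ∩ A, ⟨inter_subset_right, Or.inr fun h => h1 ?_⟩,
        σ.erase a \ A, ⟨K.down_closed _ h3 _ ?_, Or.inr ⟨disjoint_sdiff, ?_⟩⟩, rfl⟩, ?_⟩
      · rw [← h]; exact inter_subset_left
      · intro x hx; simp only [mem_sdiff, mem_union] at *; tauto
      · simpa using h3
      · ext x
        simp only [mem_union, mem_singleton, mem_inter, mem_sdiff, mem_erase]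
        by_cases hx : x = a
        · subst hx; tauto
        · tauto

section Starring

variable {d : ℕ} {K : StellarComplex} {A : Finset ℕ} {a : ℕ}

/-- The `d`-simplexes of a starring that come from those containing `A`. -/
def replaceVertex (a : ℕ) (g : Finset ℕ) (u : ℕ) : Finset ℕ := insert a (g.erase u)

theorem card_replaceVertex {g : Finset ℕ} {u : ℕ} (hu : u ∈ g) (ha : a ∉ g) :
    (replaceVertex a g u).card = g.card := by
  rw [replaceVertex, card_insert_of_notMem (fun h => ha (mem_of_mem_erase h)),
    card_erase_add_one hu]

theorem replaceVertex_mem_starring (hA : A ∈ K.faces) (hne : A.Nonempty) (ha : ¬ K.IsVertex a)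
    {g : Finset ℕ} (hg : g ∈ K.faces) (hAg : A ⊆ g) {u : ℕ} (hu : u ∈ A) :
    replaceVertex a g u ∈ (K.starring A a).faces := by
  have hag : a ∉ g := fun h => ha (isVertex_of_mem hg h)
  rw [mem_starring hA hne ha, replaceVertex]
  refine ⟨fun h => ?_, Or.inr ⟨mem_insert_self _ _, K.down_closed _ hg _ ?_⟩⟩
  · have := h hu
    simp only [mem_insert, mem_erase] at this
    rcases this with rfl | h
    · exact hag (hAg hu)
    · exact h.1 rfl
  · intro x hx
    have := @hAg x
    simp only [mem_union, mem_erase, mem_insert] at hx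
    tauto

theorem IsFacet.replaceVertex (hA : A ∈ K.faces) (hne : A.Nonempty) (ha : ¬ K.IsVertex a)
    {g : Finset ℕ} (hg : IsFacet d K g) (hAg : A ⊆ g) {u : ℕ} (hu : u ∈ A) :
    IsFacet d (K.starring A a) (replaceVertex a g u) :=
  ⟨replaceVertex_mem_starring hA hne ha hg.1 hAg hu, by
    rw [card_replaceVertex (hAg hu) fun h => ha (isVertex_of_mem hg.1 h), hg.2]⟩

/-- A facet `g` through `a` misses some `u ∈ A`. Then `insert u (g.erase a)` has `d + 1` elements
and lies in the face `A ∪ g.erase a` of `K`, which has no more; so the two agree and form the old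
facet below `g`. -/
theorem isFacet_starring (hA : A ∈ K.faces) (hne : A.Nonempty) (ha : ¬ K.IsVertex a)
    (hK : ∀ σ ∈ K.faces, σ.card ≤ d + 1) {g : Finset ℕ} :
    IsFacet d (K.starring A a) g ↔ (IsFacet d K g ∧ ¬ A ⊆ g) ∨
      ∃ h u, IsFacet d K h ∧ A ⊆ h ∧ u ∈ A ∧ g = replaceVertex a h u := by
  constructor
  · rintro ⟨hg, hc⟩
    obtain ⟨h1, h2 | ⟨h2, h3⟩⟩ := (mem_starring hA hne ha).mp hg
    · exact Or.inl ⟨⟨h2, hc⟩, h1⟩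
    · right
      have haA : a ∉ A := fun h => ha (isVertex_of_mem hA h)
      obtain ⟨u, huA, hug⟩ := not_subset.mp h1
      have hle := hK _ h3
      have hsub : insert u (g.erase a) ⊆ A ∪ g.erase a :=
        insert_subset (mem_union_left _ huA) subset_union_right
      have hci : (insert u (g.erase a)).card = d + 1 := by
        rw [card_insert_of_notMem (fun h => hug (mem_of_mem_erase h)), card_erase_of_mem h2]
        omega
      have heq := eq_of_subset_of_card_le hsub (by omega)
      refine ⟨_, u, ⟨h3, by rw [← heq, hci]⟩, subset_union_left, huA, ?_⟩
      rw [← heq, StellarComplex.replaceVertex, erase_insert (fun h => hug (mem_of_mem_erase h)),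
        insert_erase h2]
  · rintro (⟨h1, h2⟩ | ⟨h, u, h1, h2, h3, rfl⟩)
    · exact ⟨(mem_starring hA hne ha).mpr ⟨h2, Or.inl h1.1⟩, h1.2⟩
    · exact h1.replaceVertex hA hne ha h2 h3

end Starring

end StellarComplex

namespace StellarComplex

open Finset

/-! ### Invariance of normal pseudomanifolds under subdivisions and welds -/

section Starring

variable {d : ℕ} {K : StellarComplex} {A : Finset ℕ} {a : ℕ}

/-- The two ways in which new facets become neighbours: the same vertex is replaced in two adjacent
facets, or two vertices are replaced in one facet. In the second case at most two vertices are lost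
and `a` is gained. -/
theorem card_inter_replaceVertex {g h : Finset ℕ} {u w : ℕ} (hg : g.card = d + 1)
    (hagh : a ∉ g ∩ h) (hu : u ∈ g ∩ h) (hc : d ≤ (g ∩ h).card) (hgh : u = w ∨ g = h)
    (hw : w ∈ g) : d ≤ (replaceVertex a g u ∩ replaceVertex a h w).card := by
  rcases hgh with rfl | rfl
  · have : insert a ((g ∩ h).erase u) ⊆ replaceVertex a g u ∩ replaceVertex a h u := by
      intro x hx
      simp only [replaceVertex, mem_insert, mem_erase, mem_inter] at *
      tauto
    refine le_trans ?_ (card_le_card this)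
    rw [card_insert_of_notMem (fun h => hagh (mem_of_mem_erase h)), card_erase_add_one hu]
    exact hc
  · have : insert a ((g.erase u).erase w) ⊆ replaceVertex a g u ∩ replaceVertex a g w := by
      intro x hx
      simp only [replaceVertex, mem_insert, mem_erase, mem_inter] at *
      tauto
    refine le_trans ?_ (card_le_card this)
    have h1 := card_le_card_sdiff_add_card (s := g) (t := {u, w})
    have h2 : g \ {u, w} = (g.erase u).erase w := by
      ext x; simp only [mem_sdiff, mem_insert, mem_singleton, mem_erase]; tauto
    have h3 : ({u, w} : Finset ℕ).card ≤ 2 := card_le_two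
    rw [card_insert_of_notMem, ← h2]
    · omega
    · simp only [mem_inter, mem_erase] at *; tauto

/-- Each facet of the starring lies over a facet of `K`. Facets over the same one are pairwise
adjacent, and adjacent facets of `K` have adjacent facets over them, so chains lift. -/
theorem IsNormalPseudomanifold.starring (hK : IsNormalPseudomanifold d K) (hA : A ∈ K.faces)
    (hne : A.Nonempty) (ha : ¬ K.IsVertex a) : IsNormalPseudomanifold d (K.starring A a) := by
  have hag : ∀ {g}, IsFacet d K g → a ∉ g := fun hg h => ha (isVertex_of_mem hg.1 h)
  have haA : a ∉ A := fun h => ha (isVertex_of_mem hA h)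
  have hF := @isFacet_starring d K A a hA hne ha hK.card_le
  have hpure : ∀ σ ∈ (K.starring A a).faces, ∃ g, IsFacet d (K.starring A a) g ∧ σ ⊆ g := by
    intro σ hσ
    obtain ⟨h1, h2⟩ := (mem_starring hA hne ha).mp hσ
    obtain ⟨u, huA, huσ⟩ := not_subset.mp h1
    have key : ∀ g, IsFacet d K g → A ⊆ g → σ.erase a ⊆ g →
        ∃ g, IsFacet d (K.starring A a) g ∧ σ ⊆ g := by
      intro g hg hAg hσg
      refine ⟨_, hg.replaceVertex hA hne ha hAg huA, fun x hx => ?_⟩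
      by_cases hxa : x = a
      · simp [replaceVertex, hxa]
      · have : x ≠ u := fun e => huσ (e ▸ hx)
        simp [replaceVertex, hxa, this, hσg (mem_erase.mpr ⟨hxa, hx⟩)]
    rcases h2 with h2 | ⟨h2, h3⟩
    · obtain ⟨g, hg, hσg⟩ := hK.exists_facet _ h2
      by_cases hAg : A ⊆ g
      · exact key g hg hAg ((erase_subset _ _).trans hσg)
      · exact ⟨g, hF.mpr (Or.inl ⟨hg, hAg⟩), hσg⟩
    · obtain ⟨g, hg, hσg⟩ := hK.exists_facet _ h3
      exact key g hg (subset_union_left.trans hσg) (subset_union_right.trans hσg)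
  refine ⟨fun σ hσ => ?_, hpure, ?_, ?_⟩
  · obtain ⟨g, hg, hσg⟩ := hpure σ hσ
    exact hg.2 ▸ card_le_card hσg
  · intro f hf g₁ g₂ g₃ h₁ h₂ h₃ hf₁ hf₂ hf₃
    -- If `a ∉ f`, the facet `g` is determined by the facet `h ⊇ f` below it, so the bound for `f`
    -- in `K` applies. If `a ∈ f`, then `h` contains `A ∪ f.erase a` and `g` is fixed by `h` and the
    -- omitted vertex of `A \ f`.
    have hproj : ∀ g, IsFacet d (K.starring A a) g → f ⊆ g → ∃ h, IsFacet d K h ∧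
        ((a ∉ f ∧ f ⊆ h ∧ ((¬ A ⊆ h ∧ g = h) ∨ (A ⊆ h ∧ g = insert a f))) ∨
          (a ∈ f ∧ ∃ u ∈ A \ f, A ∪ f.erase a ⊆ h ∧ g = replaceVertex a h u)) := by
      intro g hg hfg
      rcases hF.mp hg with ⟨h1, h2⟩ | ⟨h, u, h1, h2, h3, rfl⟩
      · exact ⟨g, h1, Or.inl ⟨fun h => hag h1 (hfg h), hfg, Or.inl ⟨h2, rfl⟩⟩⟩
      · refine ⟨h, h1, ?_⟩
        have huf : u ∉ f := fun hu => by
          have := hfg hu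
          simp only [replaceVertex, mem_insert, mem_erase] at this
          rcases this with rfl | this
          · exact haA h3
          · exact this.1 rfl
        by_cases haf : a ∈ f
        · refine Or.inr ⟨haf, u, mem_sdiff.mpr ⟨h3, huf⟩, union_subset h2 fun x hx => ?_, rfl⟩
          have := hfg (mem_of_mem_erase hx)
          simp only [replaceVertex, mem_insert, mem_erase] at this hx
          tauto
        · have hfe : f ⊆ h.erase u := fun x hx => by
            have h4 := hfg hx
            have : x ≠ a := fun e => haf (e ▸ hx)
            simp only [replaceVertex, mem_insert, mem_erase] at h4 ⊢
            tauto
          have := eq_of_subset_of_card_le hfe (by rw [card_erase_of_mem (h2 h3), h1.2]; omega)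
          exact Or.inl ⟨haf, hfe.trans (erase_subset _ _), Or.inr ⟨h2, by rw [this]; rfl⟩⟩
    obtain ⟨k₁, hk₁, e₁⟩ := hproj g₁ h₁ hf₁
    obtain ⟨k₂, hk₂, e₂⟩ := hproj g₂ h₂ hf₂
    obtain ⟨k₃, hk₃, e₃⟩ := hproj g₃ h₃ hf₃
    by_cases haf : a ∈ f
    · simp only [haf, not_true_eq_false, false_and, true_and, false_or] at e₁ e₂ e₃
      obtain ⟨u₁, hu₁, hs₁, rfl⟩ := e₁
      obtain ⟨u₂, hu₂, hs₂, rfl⟩ := e₂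
      obtain ⟨u₃, hu₃, hs₃, rfl⟩ := e₃
      have hfe : (f.erase a).card + 1 = d := by rw [card_erase_add_one haf, hf]
      have hsd : A \ f = A \ f.erase a := by
        ext x
        have : x ∈ A → x ≠ a := fun h e => haA (e ▸ h)
        simp only [mem_sdiff, mem_erase]; tauto
      have hun : (A ∪ f.erase a).card = (A \ f).card + (f.erase a).card := by
        rw [hsd, card_sdiff_add_card]
      -- With one vertex in `A \ f`, the face `A ∪ f.erase a` has codimension one in `K`. Otherwise
      -- counting forces two vertices in `A \ f`; then `A ∪ f.erase a` is itself the facet below,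
      -- and the omitted vertex has two possible values.
      by_cases h1 : (A \ f).card = 1
      · obtain ⟨u, hu⟩ := card_eq_one.mp h1
        rw [hu, mem_singleton] at hu₁ hu₂ hu₃
        rw [hu₁, hu₂, hu₃]
        rcases hK.at_most_two (A ∪ f.erase a) (by omega) k₁ k₂ k₃ hk₁ hk₂ hk₃ hs₁ hs₂ hs₃ with
          h | h | h <;> simp [h]
      · have h0 : 0 < (A \ f).card := card_pos.mpr ⟨_, hu₁⟩
        have hle := card_le_card hs₁
        rw [hk₁.2] at hle
        have hall : ∀ k, IsFacet d K k → A ∪ f.erase a ⊆ k → k = A ∪ f.erase a := fun k hk hs =>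
          (eq_of_subset_of_card_le hs (by rw [hk.2]; omega)).symm
        rw [hall k₁ hk₁ hs₁, hall k₂ hk₂ hs₂, hall k₃ hk₃ hs₃]
        obtain ⟨u, w, -, huw⟩ := card_eq_two.mp (show (A \ f).card = 2 by omega)
        rw [huw, mem_insert, mem_singleton] at hu₁ hu₂ hu₃
        rcases hu₁ with rfl | rfl <;> rcases hu₂ with rfl | rfl <;> rcases hu₃ with rfl | rfl <;>
          simp
    · simp only [haf, not_false_eq_true, true_and, false_and, or_false] at e₁ e₂ e₃
      rcases hK.at_most_two f hf k₁ k₂ k₃ hk₁ hk₂ hk₃ e₁.1 e₂.1 e₃.1 with h | h | h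
      · left; subst h; rcases e₁.2 with e | e <;> rcases e₂.2 with e' | e' <;> simp_all
      · right; left; subst h; rcases e₁.2 with e | e <;> rcases e₃.2 with e' | e' <;> simp_all
      · right; right; subst h; rcases e₂.2 with e | e <;> rcases e₃.2 with e' | e' <;> simp_all
  · intro σ g h hg hh hσg hσh
    /- `Lift k l`: the simplex `l` of the starring lies over the simplex `k` and contains `σ`. -/
    let Lift : Finset ℕ → Finset ℕ → Prop := fun k l => IsFacet d K k ∧ σ ⊆ l ∧
      ((¬ A ⊆ k ∧ l = k) ∨ (A ⊆ k ∧ ∃ u ∈ A, l = replaceVertex a k u))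
    -- The face of `K` whose star lies below the star of `σ`: a facet through `a` comes from a facet
    -- containing `A`.
    let τ : Finset ℕ := if a ∈ σ then A ∪ σ.erase a else σ
    have hproj : ∀ l, IsFacet d (K.starring A a) l → σ ⊆ l → ∃ k, Lift k l := by
      intro l hl hσl
      rcases hF.mp hl with ⟨h1, h2⟩ | ⟨h, u, h1, h2, h3, rfl⟩
      · exact ⟨l, h1, hσl, Or.inl ⟨h2, rfl⟩⟩
      · exact ⟨h, h1, hσl, Or.inr ⟨h2, u, h3, rfl⟩⟩
    have hLF : ∀ {k l}, Lift k l → IsFacet d (K.starring A a) l := by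
      rintro k l ⟨h1, -, ⟨h2, rfl⟩ | ⟨h2, u, h3, rfl⟩⟩
      · exact hF.mpr (Or.inl ⟨h1, h2⟩)
      · exact h1.replaceVertex hA hne ha h2 h3
    have hLσ : ∀ {k l}, Lift k l → τ ⊆ k := by
      rintro k l ⟨h1, h0, ⟨h2, rfl⟩ | ⟨h2, u, h3, rfl⟩⟩
      · have : a ∉ σ := fun h => hag h1 (h0 h)
        simp only [τ, this, if_false, h0]
      · have h5 : σ.erase a ⊆ k := fun x hx => by
          have := h0 (mem_of_mem_erase hx)
          simp only [replaceVertex, mem_insert, mem_erase] at this hx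
          tauto
        by_cases haσ : a ∈ σ
        · simp only [τ, haσ, if_true]
          exact union_subset h2 h5
        · simp only [τ, haσ, if_false]
          rwa [erase_eq_of_notMem haσ] at h5
    have hnot : ¬ A ⊆ σ := fun h => ((mem_starring hA hne ha).mp hg.1).1 (h.trans hσg)
    -- Omitting a vertex of `A` outside `σ` keeps the lifted facets in the star of `σ`.
    obtain ⟨u₀, hu₀, hu₀σ⟩ := not_subset.mp hnot
    have hlift : ∀ k, IsFacet d K k → τ ⊆ k → A ⊆ k → ∀ u ∈ A, u ∉ σ →
        Lift k (replaceVertex a k u) := by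
      intro k hk hτ hAk u hu huσ
      refine ⟨hk, fun x hx => ?_, Or.inr ⟨hAk, u, hu, rfl⟩⟩
      have hxu : x ≠ u := fun e => huσ (e ▸ hx)
      by_cases hxa : x = a
      · simp [replaceVertex, hxa]
      · have : x ∈ k := by
          by_cases haσ : a ∈ σ
          · simp only [τ, haσ, if_true] at hτ
            exact hτ (mem_union_right _ (mem_erase.mpr ⟨hxa, hx⟩))
          · simp only [τ, haσ, if_false] at hτ
            exact hτ hx
        simp [replaceVertex, hxu, this]
    have hσnot : ∀ {k u}, A ⊆ k → IsFacet d K k → u ∈ A → σ ⊆ replaceVertex a k u → u ∉ σ := by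
      intro k u hAk hk hu h hσ
      have := h hσ
      simp only [replaceVertex, mem_insert, mem_erase] at this
      rcases this with rfl | this
      · exact haA hu
      · exact this.1 rfl
    have hsame : ∀ k l l', Lift k l → Lift k l' → Adjacent d (K.starring A a) σ l l' := by
      intro k l l' hl hl'
      refine ⟨hLF hl, hLF hl', hl.2.1, hl'.2.1, ?_⟩
      obtain ⟨hk, -, ⟨h2, rfl⟩ | ⟨h2, u, h3, rfl⟩⟩ := hl <;>
        obtain ⟨-, -, ⟨h2', rfl⟩ | ⟨h2', u', h3', rfl⟩⟩ := hl'
      · rw [inter_self, hk.2]; omega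
      · exact absurd h2' h2
      · exact absurd h2 h2'
      · exact card_inter_replaceVertex hk.2 (by simpa using hag hk) (by simpa using h2 h3)
          (by rw [inter_self, hk.2]; omega) (Or.inr rfl) (h2 h3')
    have hstep : ∀ k k', Adjacent d K τ k k' → ∃ l l', Lift k l ∧ Lift k' l' ∧
        Adjacent d (K.starring A a) σ l l' := by
      rintro k k' ⟨hk, hk', hτk, hτk', hc⟩
      suffices ∃ l l', Lift k l ∧ Lift k' l' ∧ d ≤ (l ∩ l').card by
        obtain ⟨l, l', h1, h2, h3⟩ := this
        exact ⟨l, l', h1, h2, hLF h1, hLF h2, h1.2.1, h2.2.1, h3⟩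
      -- Crossing out of the star of `A`: the omitted vertex is chosen outside `k'`, so nothing of
      -- `k ∩ k'` is lost.
      have half : ∀ k k', IsFacet d K k → IsFacet d K k' → τ ⊆ k → τ ⊆ k' →
          d ≤ (k ∩ k').card → A ⊆ k → ¬ A ⊆ k' →
          ∃ u ∈ A, Lift k (replaceVertex a k u) ∧ Lift k' k' ∧
            d ≤ (replaceVertex a k u ∩ k').card := by
        intro k k' hk hk' hτk hτk' hc hAk hAk'
        have haσ : a ∉ σ := fun h => hAk' (by
          simp only [τ, h, if_true] at hτk'; exact subset_union_left.trans hτk')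
        have hτσ : τ = σ := by simp [τ, haσ]
        obtain ⟨u, huA, huk'⟩ := not_subset.mp hAk'
        refine ⟨u, huA, hlift k hk hτk hAk u huA fun h => huk' (hτk' (hτσ ▸ h)),
          ⟨hk', hτσ ▸ hτk', Or.inl ⟨hAk', rfl⟩⟩, hc.trans (card_le_card fun x hx => ?_)⟩
        have hxu : x ≠ u := fun e => huk' (e ▸ (mem_inter.mp hx).2)
        simp only [replaceVertex, mem_inter, mem_insert, mem_erase] at hx ⊢
        tauto
      by_cases hAk : A ⊆ k <;> by_cases hAk' : A ⊆ k'
      · refine ⟨_, _, hlift k hk hτk hAk u₀ hu₀ hu₀σ, hlift k' hk' hτk' hAk' u₀ hu₀ hu₀σ,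
          card_inter_replaceVertex hk.2 (fun h => hag hk (mem_inter.mp h).1)
            (mem_inter.mpr ⟨hAk hu₀, hAk' hu₀⟩) hc (Or.inl rfl) (hAk hu₀)⟩
      · obtain ⟨u, -, h1, h2, h3⟩ := half k k' hk hk' hτk hτk' hc hAk hAk'
        exact ⟨_, _, h1, h2, h3⟩
      · obtain ⟨u, -, h1, h2, h3⟩ := half k' k hk' hk hτk' hτk (by rwa [inter_comm]) hAk' hAk
        exact ⟨_, _, h2, h1, by rwa [inter_comm]⟩
      · have haσ : a ∉ σ := fun h => hAk (by
          simp only [τ, h, if_true] at hτk; exact subset_union_left.trans hτk)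
        have hτσ : τ = σ := by simp [τ, haσ]
        exact ⟨k, k', ⟨hk, hτσ ▸ hτk, Or.inl ⟨hAk, rfl⟩⟩, ⟨hk', hτσ ▸ hτk', Or.inl ⟨hAk', rfl⟩⟩,
          hc⟩
    obtain ⟨k, hk⟩ := hproj g hg hσg
    obtain ⟨k', hk'⟩ := hproj h hh hσh
    have hall : ∀ k', Relation.ReflTransGen (Adjacent d K τ) k k' → ∀ l', Lift k' l' →
        Relation.ReflTransGen (Adjacent d (K.starring A a) σ) g l' := by
      intro k' hkk'
      induction hkk' with
      | refl => exact fun l' hl' => .single (hsame _ _ _ hk hl')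
      | tail _ hs ih =>
        intro l' hl'
        obtain ⟨m, m', h1, h2, h3⟩ := hstep _ _ hs
        exact ((ih m h1).tail h3).tail (hsame _ _ _ h2 hl')
    exact hall k' (hK.chain τ k k' hk.1 hk'.1 (hLσ hk) (hLσ hk')) h hk'

/-- Chains are now projected. A face `σ ⊇ A` of `K` no longer exists in the starring and is
represented by `up σ`, where a fixed vertex `u₀` of `A` gives way to `a`; a facet over `k` that
contains `up σ` forces `σ ⊆ k`. -/
theorem IsNormalPseudomanifold.of_starring (hK : IsNormalPseudomanifold d (K.starring A a))
    (hA : A ∈ K.faces) (hne : A.Nonempty) (ha : ¬ K.IsVertex a) :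
    IsNormalPseudomanifold d K := by
  have hagK : ∀ {σ}, σ ∈ K.faces → a ∉ σ := fun hg h => ha (isVertex_of_mem hg h)
  obtain ⟨u₀, hu₀⟩ := id hne
  have hcard : ∀ σ ∈ K.faces, σ.card ≤ d + 1 := by
    intro σ hσ
    by_cases hAσ : A ⊆ σ
    · rw [← card_replaceVertex (hAσ hu₀) (hagK hσ)]
      exact hK.card_le _ (replaceVertex_mem_starring hA hne ha hσ hAσ hu₀)
    · exact hK.card_le _ ((mem_starring hA hne ha).mpr ⟨hAσ, Or.inl hσ⟩)
  have hF := @isFacet_starring d K A a hA hne ha hcard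
  /- The face of the starring whose star lies over the star of a face of `K`. -/
  let up : Finset ℕ → Finset ℕ := fun σ => if A ⊆ σ then replaceVertex a σ u₀ else σ
  have hup : ∀ σ ∈ K.faces, up σ ∈ (K.starring A a).faces := by
    intro σ hσ
    by_cases hAσ : A ⊆ σ
    · simp only [up, hAσ, if_true]
      exact replaceVertex_mem_starring hA hne ha hσ hAσ hu₀
    · simp only [up, hAσ, if_false]
      exact (mem_starring hA hne ha).mpr ⟨hAσ, Or.inl hσ⟩
  let Lift : Finset ℕ → Finset ℕ → Prop := fun k l => IsFacet d K k ∧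
      ((¬ A ⊆ k ∧ l = k) ∨ (A ⊆ k ∧ ∃ u ∈ A, l = replaceVertex a k u))
  have hproj : ∀ l, IsFacet d (K.starring A a) l → ∃ k, Lift k l := by
    intro l hl
    rcases hF.mp hl with ⟨h1, h2⟩ | ⟨h, u, h1, h2, h3, rfl⟩
    · exact ⟨l, h1, Or.inl ⟨h2, rfl⟩⟩
    · exact ⟨h, h1, Or.inr ⟨h2, u, h3, rfl⟩⟩
  have hLF : ∀ {k l}, Lift k l → IsFacet d (K.starring A a) l := by
    rintro k l ⟨h1, ⟨h2, rfl⟩ | ⟨h2, u, h3, rfl⟩⟩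
    · exact hF.mpr (Or.inl ⟨h1, h2⟩)
    · exact h1.replaceVertex hA hne ha h2 h3
  have hdown : ∀ {k l σ}, σ ∈ K.faces → Lift k l → up σ ⊆ l → σ ⊆ k := by
    rintro k l σ hσ ⟨hk, h⟩ hs x hx
    have hxa : x ≠ a := fun e => hagK hσ (e ▸ hx)
    have hl : ∀ y ∈ l, y ≠ a → y ∈ k := by
      rcases h with ⟨-, rfl⟩ | ⟨-, u, -, rfl⟩
      · exact fun y hy _ => hy
      · intro y hy hya
        simp only [replaceVertex, mem_insert, mem_erase] at hy
        tauto
    by_cases hAσ : A ⊆ σ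
    · simp only [up, hAσ, if_true] at hs
      by_cases hxA : x ∈ A
      · rcases h with ⟨-, rfl⟩ | ⟨h, -⟩
        · exact absurd (hs (mem_insert_self _ _)) (hagK hk.1)
        · exact h hxA
      · exact hl x (hs (mem_insert_of_mem (mem_erase.mpr ⟨fun e => hxA (e ▸ hu₀), hx⟩))) hxa
    · simp only [up, hAσ, if_false] at hs
      exact hl x (hs hx) hxa
  have hadj : ∀ {k l k' l'}, Lift k l → Lift k' l' → d ≤ (l ∩ l').card →
      d ≤ (k ∩ k').card := by
    have half : ∀ {k k' u}, IsFacet d K k → IsFacet d K k' →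
        d ≤ (replaceVertex a k u ∩ k').card → d ≤ (k ∩ k').card := by
      intro k k' u hk hk' hc
      refine hc.trans (card_le_card fun x hx => ?_)
      have : x ≠ a := fun e => hagK hk'.1 (e ▸ (mem_inter.mp hx).2)
      simp only [replaceVertex, mem_inter, mem_insert, mem_erase] at hx ⊢
      tauto
    rintro k l k' l' ⟨hk, ⟨h2, rfl⟩ | ⟨h2, u, h3, rfl⟩⟩ ⟨hk', ⟨h2', rfl⟩ | ⟨h2', u', h3', rfl⟩⟩ hc
    · exact hc
    · rw [inter_comm] at hc ⊢
      exact half hk' hk hc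
    · exact half hk hk' hc
    -- The loss of the common vertex `a` is compensated by `u`, which belongs to `A` and hence to
    -- both facets below.
    · have h5 : (replaceVertex a k u ∩ replaceVertex a k' u').erase a ⊆ (k ∩ k').erase u := by
        intro x hx
        simp only [replaceVertex, mem_inter, mem_insert, mem_erase] at hx ⊢
        tauto
      have h6 := card_le_card h5
      have h7 : a ∈ replaceVertex a k u ∩ replaceVertex a k' u' := by simp [replaceVertex]
      rw [card_erase_of_mem h7, card_erase_of_mem (mem_inter.mpr ⟨h2 h3, h2' h3⟩)] at h6
      have h8 : 0 < (k ∩ k').card := card_pos.mpr ⟨u, mem_inter.mpr ⟨h2 h3, h2' h3⟩⟩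
      omega
  have hlift : ∀ {k σ}, IsFacet d K k → σ ⊆ k → ∃ l, Lift k l ∧ up σ ⊆ l := by
    intro k σ hk hσk
    by_cases hAk : A ⊆ k
    · by_cases hAσ : A ⊆ σ
      · refine ⟨_, ⟨hk, Or.inr ⟨hAk, u₀, hu₀, rfl⟩⟩, ?_⟩
        simp only [up, hAσ, if_true]
        exact insert_subset_insert _ (erase_subset_erase _ hσk)
      · obtain ⟨u, hu, huσ⟩ := not_subset.mp hAσ
        refine ⟨_, ⟨hk, Or.inr ⟨hAk, u, hu, rfl⟩⟩, ?_⟩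
        simp only [up, hAσ, if_false]
        intro x hx
        have : x ≠ u := fun e => huσ (e ▸ hx)
        simp [replaceVertex, this, hσk hx]
    · refine ⟨k, ⟨hk, Or.inl ⟨hAk, rfl⟩⟩, ?_⟩
      have hAσ : ¬ A ⊆ σ := fun h => hAk (h.trans hσk)
      simpa only [up, hAσ, if_false]
  -- The facet below `l` is read off from `l`: remove `a` and, if `a` was present, restore `A`.
  have huniq : ∀ {k k' l}, Lift k l → Lift k' l → k = k' := by
    have hdet : ∀ {k l}, Lift k l → k = l.erase a ∪ (if a ∈ l then A else ∅) := by
      rintro k l ⟨hk, ⟨h2, rfl⟩ | ⟨h2, u, h3, rfl⟩⟩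
      · simp [hagK hk.1]
      · have := hagK hk.1
        ext x
        have := @h2 x
        simp only [replaceVertex, mem_union, mem_erase, mem_insert, true_or, if_true]
        by_cases hxu : x = u
        · subst hxu; tauto
        · by_cases hxa : x = a
          · subst hxa; tauto
          · tauto
    intro k k' l h h'
    rw [hdet h, hdet h']
  refine ⟨hcard, fun σ hσ => ?_, ?_, ?_⟩
  · obtain ⟨l, hl, hσl⟩ := hK.exists_facet _ (hup σ hσ)
    obtain ⟨k, hk⟩ := hproj l hl
    exact ⟨k, hk.1, hdown hσ hk hσl⟩
  · intro f hf g₁ g₂ g₃ h₁ h₂ h₃ hf₁ hf₂ hf₃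
    have hfK : f ∈ K.faces := K.down_closed _ h₁.1 _ hf₁
    have hupf : (up f).card = d := by
      by_cases hAf : A ⊆ f
      · simp only [up, hAf, if_true]
        rw [card_replaceVertex (hAf hu₀) (hagK hfK), hf]
      · simpa only [up, hAf, if_false]
    obtain ⟨l₁, hl₁, hs₁⟩ := hlift h₁ hf₁
    obtain ⟨l₂, hl₂, hs₂⟩ := hlift h₂ hf₂
    obtain ⟨l₃, hl₃, hs₃⟩ := hlift h₃ hf₃
    rcases hK.at_most_two (up f) hupf l₁ l₂ l₃ (hLF hl₁) (hLF hl₂) (hLF hl₃) hs₁ hs₂ hs₃ with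
      h | h | h
    · exact Or.inl (huniq hl₁ (h ▸ hl₂))
    · exact Or.inr (Or.inl (huniq hl₁ (h ▸ hl₃)))
    · exact Or.inr (Or.inr (huniq hl₂ (h ▸ hl₃)))
  · intro σ g h hg hh hσg hσh
    have hσ : σ ∈ K.faces := K.down_closed _ hg.1 _ hσg
    obtain ⟨l, hl, hs⟩ := hlift hg hσg
    obtain ⟨l', hl', hs'⟩ := hlift hh hσh
    have hall : ∀ l', Relation.ReflTransGen (Adjacent d (K.starring A a) (up σ)) l l' →
        ∀ k', Lift k' l' → Relation.ReflTransGen (Adjacent d K σ) g k' := by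
      intro l' hll'
      induction hll' with
      | refl => exact fun k' hk' => huniq hl hk' ▸ .refl
      | tail _ hst ih =>
        intro k' hk'
        obtain ⟨m, hm⟩ := hproj _ hst.1
        exact (ih m hm).tail ⟨hm.1, hk'.1, hdown hσ hm hst.2.2.1, hdown hσ hk' hst.2.2.2.1,
          hadj hm hk' hst.2.2.2.2⟩
    exact hall l' (hK.chain _ l l' (hLF hl) (hLF hl') hs hs') h hl'

end Starring

/-! ### Relabellings, balls and spheres, and the passage from links to connected manifolds -/

theorem mem_relabel {K : StellarComplex} {e : Equiv.Perm ℕ} {σ : Finset ℕ} :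
    σ ∈ (K.relabel e).faces ↔ σ.map e.symm.toEmbedding ∈ K.faces := by
  simp only [relabel, mem_image]
  constructor
  · rintro ⟨τ, hτ, rfl⟩
    simpa [map_map] using hτ
  · intro h
    exact ⟨_, h, by simp [map_map]⟩

theorem relabel_relabel_symm (K : StellarComplex) (e : Equiv.Perm ℕ) :
    (K.relabel e).relabel e.symm = K := by
  ext σ
  simp [mem_relabel, map_map]

theorem IsNormalPseudomanifold.relabel {d : ℕ} {K : StellarComplex}
    (hK : IsNormalPseudomanifold d K) (e : Equiv.Perm ℕ) :
    IsNormalPseudomanifold d (K.relabel e) := by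
  have hF : ∀ {g}, IsFacet d (K.relabel e) g ↔ IsFacet d K (g.map e.symm.toEmbedding) := by
    intro g
    simp [IsFacet, mem_relabel]
  have hinv : ∀ g : Finset ℕ, (g.map e.toEmbedding).map e.symm.toEmbedding = g := by
    simp [map_map]
  have hinv' : ∀ g : Finset ℕ, (g.map e.symm.toEmbedding).map e.toEmbedding = g := by
    simp [map_map]
  refine ⟨fun σ hσ => ?_, fun σ hσ => ?_, ?_, ?_⟩
  · simpa using hK.card_le _ (mem_relabel.mp hσ)
  · obtain ⟨g, hg, hs⟩ := hK.exists_facet _ (mem_relabel.mp hσ)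
    refine ⟨g.map e.toEmbedding, hF.mpr (by rwa [hinv]), ?_⟩
    rw [← hinv' σ]
    exact map_subset_map.mpr hs
  · intro f hf g₁ g₂ g₃ h₁ h₂ h₃ hf₁ hf₂ hf₃
    have := hK.at_most_two (f.map e.symm.toEmbedding) (by simpa using hf) _ _ _ (hF.mp h₁)
      (hF.mp h₂) (hF.mp h₃) (map_subset_map.mpr hf₁) (map_subset_map.mpr hf₂)
      (map_subset_map.mpr hf₃)
    simpa only [map_inj] using this
  · intro σ g h hg hh hσg hσh
    have := hK.chain (σ.map e.symm.toEmbedding) _ _ (hF.mp hg) (hF.mp hh)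
      (map_subset_map.mpr hσg) (map_subset_map.mpr hσh)
    rw [← hinv' g, ← hinv' h]
    refine Relation.ReflTransGen.lift (fun k : Finset ℕ => k.map e.toEmbedding) ?_ _ _ this
    rintro k l ⟨h1, h2, h3, h4, h5⟩
    refine ⟨hF.mpr (by rwa [hinv]), hF.mpr (by rwa [hinv]), ?_, ?_, ?_⟩
    · rw [← hinv' σ]; exact map_subset_map.mpr h3
    · rw [← hinv' σ]; exact map_subset_map.mpr h4
    · rwa [← map_inter, card_map]

theorem StellarMove.isNormalPseudomanifold_iff {d : ℕ} {K L : StellarComplex}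
    (h : StellarMove K L) : IsNormalPseudomanifold d K ↔ IsNormalPseudomanifold d L := by
  cases h with
  | subdivision A a hA hne ha => exact ⟨fun h => h.starring hA hne ha, fun h => h.of_starring hA hne ha⟩
  | relabel e =>
    exact ⟨fun h => h.relabel e, fun h => by simpa [relabel_relabel_symm] using h.relabel e.symm⟩

theorem StellarEquiv.isNormalPseudomanifold_iff {d : ℕ} {K L : StellarComplex}
    (h : StellarEquiv K L) : IsNormalPseudomanifold d K ↔ IsNormalPseudomanifold d L := by
  induction h with
  | rel _ _ h => exact h.isNormalPseudomanifold_iff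
  | refl => rfl
  | symm _ _ _ ih => exact ih.symm
  | trans _ _ _ _ _ ih₁ ih₂ => exact ih₁.trans ih₂

theorem isNormalPseudomanifold_simplex {d : ℕ} {A : Finset ℕ} (hA : A.card = d + 1) :
    IsNormalPseudomanifold d (simplex A) := by
  have hF : ∀ {g}, IsFacet d (simplex A) g ↔ g = A := by
    intro g
    simp only [IsFacet, simplex, mem_powerset]
    exact ⟨fun h => eq_of_subset_of_card_le h.1 (by omega), by rintro rfl; exact ⟨Subset.rfl, hA⟩⟩
  refine ⟨fun σ hσ => hA ▸ card_le_card (mem_powerset.mp hσ),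
    fun σ hσ => ⟨A, hF.mpr rfl, mem_powerset.mp hσ⟩, ?_, ?_⟩
  · intro f hf g₁ g₂ g₃ h₁ h₂ h₃ _ _ _
    rw [hF] at h₁ h₂
    exact Or.inl (h₁.trans h₂.symm)
  · intro σ g h hg hh _ _
    rw [hF] at hg hh
    rw [hg, hh]

theorem mem_boundary {A σ : Finset ℕ} (hA : A.Nonempty) :
    σ ∈ (boundary A).faces ↔ σ ⊆ A ∧ σ ≠ A := by
  simp only [boundary, mem_filter, mem_powerset]
  refine ⟨fun h => ⟨h.1, ?_⟩, fun h => ⟨h.1, Or.inr h.2⟩⟩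
  rcases h.2 with rfl | h
  · exact hA.ne_empty.symm
  · exact h

theorem isNormalPseudomanifold_boundary {d : ℕ} {A : Finset ℕ} (hA : A.card = d + 2) :
    IsNormalPseudomanifold d (boundary A) := by
  have hne : A.Nonempty := card_pos.mp (by omega)
  have hF : ∀ {g}, IsFacet d (boundary A) g ↔ g ⊆ A ∧ g.card = d + 1 := by
    intro g
    rw [IsFacet, mem_boundary hne]
    exact ⟨fun h => ⟨h.1.1, h.2⟩, fun h => ⟨⟨h.1, fun e => by rw [e] at h; omega⟩, h.2⟩⟩
  refine ⟨fun σ hσ => ?_, fun σ hσ => ?_, ?_, ?_⟩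
  · rw [mem_boundary hne] at hσ
    have := card_lt_card (Finset.ssubset_iff_subset_ne.mpr hσ)
    omega
  · rw [mem_boundary hne] at hσ
    have := card_lt_card (Finset.ssubset_iff_subset_ne.mpr hσ)
    obtain ⟨g, h1, h2, h3⟩ := exists_subsuperset_card_eq hσ.1 (show σ.card ≤ d + 1 by omega)
      (by omega)
    exact ⟨g, hF.mpr ⟨h2, h3⟩, h1⟩
  · intro f hf g₁ g₂ g₃ h₁ h₂ h₃ hf₁ hf₂ hf₃
    have key : ∀ g, IsFacet d (boundary A) g → f ⊆ g → ∃ u ∈ A \ f, g = insert u f := by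
      intro g hg hfg
      rw [hF] at hg
      have h1 : (g \ f).card = 1 := by rw [card_sdiff_of_subset hfg]; omega
      obtain ⟨u, hu⟩ := card_eq_one.mp h1
      have h2 : u ∈ g \ f := hu ▸ mem_singleton_self u
      refine ⟨u, mem_sdiff.mpr ⟨hg.1 (mem_sdiff.mp h2).1, (mem_sdiff.mp h2).2⟩, ?_⟩
      rw [insert_eq, ← hu, sdiff_union_of_subset hfg]
    have h2 : (A \ f).card = 2 := by
      rw [card_sdiff_of_subset (hf₁.trans (hF.mp h₁).1)]; omega
    obtain ⟨p, q, -, hpq⟩ := card_eq_two.mp h2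
    obtain ⟨u₁, hu₁, rfl⟩ := key _ h₁ hf₁
    obtain ⟨u₂, hu₂, rfl⟩ := key _ h₂ hf₂
    obtain ⟨u₃, hu₃, rfl⟩ := key _ h₃ hf₃
    rw [hpq, mem_insert, mem_singleton] at hu₁ hu₂ hu₃
    rcases hu₁ with rfl | rfl <;> rcases hu₂ with rfl | rfl <;> rcases hu₃ with rfl | rfl <;> simp
  · intro σ g h hg hh hσg hσh
    -- Two subsets with `d + 1` elements of a set with `d + 2` elements share at least `d`.
    refine .single ⟨hg, hh, hσg, hσh, ?_⟩
    have h1 := card_union_add_card_inter g h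
    have h2 := card_le_card (union_subset (hF.mp hg).1 (hF.mp hh).1)
    have := hg.2
    have := hh.2
    omega

theorem IsStellarBall.isNormalPseudomanifold {d : ℕ} {K : StellarComplex}
    (h : IsStellarBall d K) : IsNormalPseudomanifold d K :=
  (StellarEquiv.isNormalPseudomanifold_iff h).mpr (isNormalPseudomanifold_simplex (by simp))

theorem IsStellarSphere.isNormalPseudomanifold {d : ℕ} {K : StellarComplex}
    (h : IsStellarSphere d K) : IsNormalPseudomanifold d K :=
  (StellarEquiv.isNormalPseudomanifold_iff h).mpr (isNormalPseudomanifold_boundary (by simp))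

theorem mem_link_singleton {K : StellarComplex} {v : ℕ} (hv : K.IsVertex v) {σ : Finset ℕ} :
    σ ∈ (link {v} K).faces ↔ v ∉ σ ∧ insert v σ ∈ K.faces := by
  simp only [link, mem_filter, disjoint_singleton_left, ← insert_eq]
  constructor
  · rintro ⟨h1, rfl | h⟩
    · exact ⟨by simp, hv⟩
    · exact h
  · exact fun h => ⟨K.down_closed _ h.2 _ (subset_insert _ _), Or.inr h⟩

/-- At a nonempty face every condition is local and is inherited from the link of one of its
vertices. Only chains at the empty face are global: there, connectedness of the realization rules
out a proper union of chain classes of facets. -/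
theorem isNormalPseudomanifold_of_link {d : ℕ} {K : StellarComplex}
    (hK : ∀ v, K.IsVertex v → IsNormalPseudomanifold d (link {v} K))
    (hc : ConnectedSpace K.realization) : IsNormalPseudomanifold (d + 1) K := by
  have hlk : ∀ {v}, K.IsVertex v → ∀ {g}, v ∈ g →
      (IsFacet (d + 1) K g ↔ IsFacet d (link {v} K) (g.erase v)) := by
    intro v hv g hvg
    rw [IsFacet, IsFacet, mem_link_singleton hv, insert_erase hvg]
    have := card_erase_add_one hvg
    constructor
    · exact fun h => ⟨⟨by simp, h.1⟩, by omega⟩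
    · exact fun h => ⟨h.1.2, by omega⟩
  have hins : ∀ {v}, K.IsVertex v → ∀ {g}, IsFacet d (link {v} K) g →
      IsFacet (d + 1) K (insert v g) := by
    intro v hv g hg
    have := ((mem_link_singleton hv).mp hg.1).1
    rw [hlk hv (mem_insert_self _ _), erase_insert this]
    exact hg
  have hstar : ∀ {v}, K.IsVertex v → ∀ {σ}, σ ∈ K.faces → v ∈ σ →
      σ.erase v ∈ (link {v} K).faces := by
    intro v hv σ hσ hvσ
    rw [mem_link_singleton hv, insert_erase hvσ]
    exact ⟨by simp, hσ⟩
  have hpure : ∀ σ ∈ K.faces, σ.Nonempty → ∃ g, IsFacet (d + 1) K g ∧ σ ⊆ g := by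
    rintro σ hσ ⟨v, hvσ⟩
    have hv := isVertex_of_mem hσ hvσ
    obtain ⟨g, hg, hs⟩ := (hK v hv).exists_facet _ (hstar hv hσ hvσ)
    exact ⟨_, hins hv hg, by rw [← insert_erase hvσ]; exact insert_subset_insert _ hs⟩
  have hchain : ∀ v, K.IsVertex v → ∀ σ g h, IsFacet (d + 1) K g → IsFacet (d + 1) K h →
      v ∈ g → v ∈ h → σ ⊆ g → σ ⊆ h → Relation.ReflTransGen (Adjacent (d + 1) K σ) g h := by
    intro v hv σ g h hg hh hvg hvh hσg hσh
    have := (hK v hv).chain (σ.erase v) _ _ ((hlk hv hvg).mp hg) ((hlk hv hvh).mp hh)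
      (erase_subset_erase _ hσg) (erase_subset_erase _ hσh)
    rw [← insert_erase hvg, ← insert_erase hvh]
    refine Relation.ReflTransGen.lift (fun k : Finset ℕ => insert v k) ?_ _ _ this
    rintro k l ⟨h1, h2, h3, h4, h5⟩
    refine ⟨hins hv h1, hins hv h2, ?_, ?_, ?_⟩
    · exact (insert_erase_subset v σ).trans (insert_subset_insert _ h3)
    · exact (insert_erase_subset v σ).trans (insert_subset_insert _ h4)
    · rw [← insert_inter_distrib, card_insert_of_notMem]
      · omega
      · exact fun h => ((mem_link_singleton hv).mp h1.1).1 (mem_inter.mp h).1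
  obtain ⟨x₀, hx₀⟩ := hc.toNonempty
  -- The empty simplex is always a face, so purity at `∅` needs an actual vertex; it comes from a
  -- point of the realization.
  have hex : ∃ v, K.IsVertex v := by
    obtain ⟨-, σ, hσ, -, hs⟩ := hx₀
    have : σ.Nonempty := by
      by_contra h
      rw [not_nonempty_iff_eq_empty.mp h] at hs
      simp at hs
    obtain ⟨v, hv⟩ := this
    exact ⟨v, isVertex_of_mem hσ hv⟩
  refine ⟨fun σ hσ => ?_, fun σ hσ => ?_, ?_, ?_⟩
  · rcases σ.eq_empty_or_nonempty with rfl | hne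
    · simp
    · obtain ⟨g, hg, hs⟩ := hpure σ hσ hne
      exact hg.2 ▸ card_le_card hs
  · rcases σ.eq_empty_or_nonempty with rfl | hne
    · obtain ⟨v, hv⟩ := hex
      obtain ⟨g, hg, -⟩ := hpure _ hv (singleton_nonempty v)
      exact ⟨g, hg, empty_subset _⟩
    · exact hpure σ hσ hne
  · intro f hf g₁ g₂ g₃ h₁ h₂ h₃ hf₁ hf₂ hf₃
    obtain ⟨v, hvf⟩ := card_pos.mp (show 0 < f.card by omega)
    have hv := isVertex_of_mem h₁.1 (hf₁ hvf)
    have := (hK v hv).at_most_two (f.erase v) (by rw [card_erase_of_mem hvf]; omega) _ _ _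
      ((hlk hv (hf₁ hvf)).mp h₁) ((hlk hv (hf₂ hvf)).mp h₂) ((hlk hv (hf₃ hvf)).mp h₃)
      (erase_subset_erase _ hf₁) (erase_subset_erase _ hf₂) (erase_subset_erase _ hf₃)
    have hinj : ∀ {g h : Finset ℕ}, v ∈ g → v ∈ h → g.erase v = h.erase v → g = h := by
      intro g h hg hh e
      rw [← insert_erase hg, ← insert_erase hh, e]
    rcases this with h | h | h
    · exact Or.inl (hinj (hf₁ hvf) (hf₂ hvf) h)
    · exact Or.inr (Or.inl (hinj (hf₁ hvf) (hf₃ hvf) h))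
    · exact Or.inr (Or.inr (hinj (hf₂ hvf) (hf₃ hvf) h))
  · intro σ g h hg hh hσg hσh
    rcases σ.eq_empty_or_nonempty with rfl | ⟨v, hv⟩
    swap
    · exact hchain v (isVertex_of_mem hg.1 (hσg hv)) σ g h hg hh (hσg hv) (hσh hv) hσg hσh
    classical
    -- The vertices of the facets reachable from `g`. Chains around a vertex show that a facet
    -- meeting `V` is itself reachable.
    let V : Finset ℕ := (K.faces.biUnion id).filter fun v =>
      ∃ k, IsFacet (d + 1) K k ∧ v ∈ k ∧ Relation.ReflTransGen (Adjacent (d + 1) K ∅) g k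
    have hV : ∀ {v}, v ∈ V ↔ ∃ k, IsFacet (d + 1) K k ∧ v ∈ k ∧
        Relation.ReflTransGen (Adjacent (d + 1) K ∅) g k := by
      intro v
      simp only [V, mem_filter, mem_biUnion, id]
      exact ⟨fun h => h.2, fun h => ⟨⟨_, h.choose_spec.1.1, h.choose_spec.2.1⟩, h⟩⟩
    have hfull : ∀ k, IsFacet (d + 1) K k → ∀ v ∈ k, v ∈ V →
        Relation.ReflTransGen (Adjacent (d + 1) K ∅) g k := by
      intro k hk v hvk hvV
      obtain ⟨l, hl, hvl, hgl⟩ := hV.mp hvV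
      exact hgl.trans (hchain v (isVertex_of_mem hk.1 hvk) ∅ l k hl hk hvl hvk (empty_subset _)
        (empty_subset _))
    -- Each facet lies inside `V` or misses it, so this continuous function takes only the values
    -- `0` and `1`; an unreachable vertex would force the value `1 / 2` as well.
    let F : K.realization → ℝ := fun x => ∑ v ∈ V, (x : ℕ → ℝ) v
    have hFc : Continuous F := by fun_prop
    have hval : ∀ (x : K.realization) k, IsFacet (d + 1) K k → (∀ i, i ∉ k → (x : ℕ → ℝ) i = 0) →
        ∑ i ∈ k, (x : ℕ → ℝ) i = 1 → ((∃ v ∈ k, v ∈ V) → F x = 1) ∧ ((¬ ∃ v ∈ k, v ∈ V) → F x = 0) := by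
      intro x k hk hx hs
      constructor
      · rintro ⟨v, hvk, hvV⟩
        have hkV : k ⊆ V := fun w hw => hV.mpr ⟨k, hk, hw, hfull k hk v hvk hvV⟩
        rw [← hs]
        exact (sum_subset hkV fun i _ hi => hx i hi).symm
      · intro hno
        exact sum_eq_zero fun i hi => hx i fun hik => hno ⟨i, hik, hi⟩
    have hvert : ∀ v, K.IsVertex v → (Pi.single v (1 : ℝ) : ℕ → ℝ) ∈ K.realization := by
      intro v hv
      refine ⟨fun i => ?_, {v}, hv, fun i hi => ?_, by simp⟩
      · by_cases h : i = v
        · subst h; simp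
        · simp [h]
      · simp at hi; simp [hi]
    have hFv : ∀ v (hv : K.IsVertex v), F ⟨_, hvert v hv⟩ = if v ∈ V then 1 else 0 := by
      intro v hv
      simp only [F, Pi.single_apply, sum_ite_eq']
    obtain ⟨u, hu⟩ := card_pos.mp (show 0 < g.card by rw [hg.2]; omega)
    obtain ⟨w, hw⟩ := card_pos.mp (show 0 < h.card by rw [hh.2]; omega)
    have huv := isVertex_of_mem hg.1 hu
    have hwv := isVertex_of_mem hh.1 hw
    have huV : u ∈ V := hV.mpr ⟨g, hg, hu, .refl⟩
    by_cases hwV : w ∈ V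
    · exact hfull h hh w hw hwV
    · exfalso
      have hcl := isPreconnected_univ.intermediate_value (s := Set.univ) (f := F)
        (Set.mem_univ ⟨_, hvert w hwv⟩) (Set.mem_univ ⟨_, hvert u huv⟩) hFc.continuousOn
      rw [hFv u huv, hFv w hwv, if_pos huV, if_neg hwV] at hcl
      obtain ⟨x, -, hx⟩ := hcl (show (1 / 2 : ℝ) ∈ Set.Icc 0 1 by norm_num)
      obtain ⟨-, σ, hσ, h1, h2⟩ := x.2
      have hσne : σ.Nonempty := by
        by_contra h
        rw [not_nonempty_iff_eq_empty.mp h] at h2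
        simp at h2
      obtain ⟨k, hk, hσk⟩ := hpure σ hσ hσne
      have h3 : ∑ i ∈ k, (x : ℕ → ℝ) i = 1 := by
        rw [← h2]; exact (sum_subset hσk fun i _ hi => h1 i hi).symm
      obtain ⟨h4, h5⟩ := hval x k hk (fun i hi => h1 i fun h => hi (hσk h)) h3
      by_cases hex : ∃ v ∈ k, v ∈ V
      · rw [h4 hex] at hx; norm_num at hx
      · rw [h5 hex] at hx; norm_num at hx

theorem IsStellarManifold.isNormalPseudomanifold {n : ℕ} (hn : 0 < n) {M : StellarComplex}
    (hM : IsStellarManifold n M) (hc : ConnectedSpace M.realization) :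
    IsNormalPseudomanifold n M := by
  obtain ⟨d, rfl⟩ : ∃ d, n = d + 1 := ⟨n - 1, by omega⟩
  refine isNormalPseudomanifold_of_link (fun v hv => ?_) hc
  rcases hM v hv with h | h
  · exact h.isNormalPseudomanifold
  · exact h.isNormalPseudomanifold

end StellarComplex

namespace StellarComplex

/-! ### Geometric realizations and exchange maps -/

open Finset

theorem sum_eq_one_of_subset {x : ℕ → ℝ} {σ τ : Finset ℕ} (h : σ ⊆ τ) (h0 : ∀ i, i ∉ σ → x i = 0)
    (h1 : ∑ i ∈ σ, x i = 1) : ∑ i ∈ τ, x i = 1 :=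
  h1 ▸ (sum_subset h fun i _ hi => h0 i hi).symm

/-- A point of the realization determines its carrier. -/
theorem exists_carrier {K : StellarComplex} {x : ℕ → ℝ} (hx : x ∈ K.realization) :
    ∃ σ ∈ K.faces, (∀ i, i ∈ σ ↔ 0 < x i) ∧ ∑ i ∈ σ, x i = 1 := by
  obtain ⟨h0, σ, hσ, h1, h2⟩ := hx
  have hmem : ∀ i, i ∈ σ.filter (fun i => 0 < x i) ↔ 0 < x i := by
    intro i
    rw [mem_filter]
    refine ⟨fun h => h.2, fun h => ⟨?_, h⟩⟩
    by_contra hi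
    exact h.ne' (h1 i hi)
  refine ⟨_, K.down_closed σ hσ _ (filter_subset (fun i => 0 < x i) σ), hmem, ?_⟩
  rw [← h2]
  refine sum_subset (filter_subset _ _) fun i _ hi => ?_
  rw [hmem] at hi
  exact le_antisymm (not_lt.mp hi) (h0 i)

theorem realization_apply_eq_zero {K : StellarComplex} {x : ℕ → ℝ} (hx : x ∈ K.realization)
    {a : ℕ} (ha : ¬ K.IsVertex a) : x a = 0 := by
  obtain ⟨-, σ, hσ, h1, -⟩ := hx
  exact h1 a fun h => ha (isVertex_of_mem hσ h)

theorem realization_apply_le_one {K : StellarComplex} {x : ℕ → ℝ} (hx : x ∈ K.realization)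
    (a : ℕ) : x a ≤ 1 := by
  obtain ⟨h0, σ, hσ, h1, h2⟩ := hx
  by_cases h : a ∈ σ
  · exact h2 ▸ single_le_sum (fun i _ => h0 i) h
  · rw [h1 a h]; exact zero_le_one

theorem isCompact_realization (K : StellarComplex) : IsCompact K.realization := by
  have heq : K.realization = ⋃ σ ∈ K.faces,
      {x : ℕ → ℝ | (∀ i, 0 ≤ x i) ∧ (∀ i, i ∉ σ → x i = 0) ∧ ∑ i ∈ σ, x i = 1} := by
    ext x
    simp only [realization, Set.mem_ofPred_eq, Set.mem_iUnion, exists_prop]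
    exact ⟨fun ⟨h0, σ, hσ, h⟩ => ⟨σ, hσ, h0, h⟩, fun ⟨σ, hσ, h0, h⟩ => ⟨h0, σ, hσ, h⟩⟩
  have hclosed : IsClosed K.realization := by
    rw [heq]
    refine K.faces.finite_toSet.isClosed_biUnion fun σ _ => ?_
    refine IsClosed.inter (s₁ := {x : ℕ → ℝ | ∀ i, 0 ≤ x i}) ?_
      (IsClosed.inter (s₁ := {x : ℕ → ℝ | ∀ i, i ∉ σ → x i = 0}) ?_ ?_)
    · simp only [Set.ofPred_forall]
      exact isClosed_iInter fun i => isClosed_le continuous_const (continuous_apply i)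
    · simp only [Set.ofPred_forall]
      exact isClosed_iInter fun i => isClosed_iInter fun _ =>
        isClosed_eq (continuous_apply i) continuous_const
    · exact isClosed_eq (by fun_prop) continuous_const
  refine (isCompact_univ_pi fun _ : ℕ => isCompact_Icc (a := (0 : ℝ)) (b := 1)).of_isClosed_subset
    hclosed fun x hx i _ => ⟨hx.1 i, realization_apply_le_one hx i⟩

instance (K : StellarComplex) : CompactSpace K.realization :=
  isCompact_iff_compactSpace.mp (isCompact_realization K)

/-- The direction in which the barycentre of `C` moves to the barycentre of `A`. -/
noncomputable def exchangeVector (C A : Finset ℕ) (i : ℕ) : ℝ :=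
  (if i ∈ A then (C.card : ℝ) / A.card else 0) - if i ∈ C then 1 else 0

/-- The piecewise linear map that carries the barycentre of `C` to the barycentre of `A` and is
linear on the simplexes of the starring in `C`. -/
noncomputable def exchange (C A : Finset ℕ) (hC : C.Nonempty) (x : ℕ → ℝ) (i : ℕ) : ℝ :=
  x i + C.inf' hC x * exchangeVector C A i

section Exchange

variable {C A : Finset ℕ} {hC : C.Nonempty} {hA : A.Nonempty}

theorem continuous_exchange : Continuous (exchange C A hC) := by
  refine continuous_pi fun i => ?_
  have : Continuous fun x : ℕ → ℝ => C.inf' hC x := by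
    have := Continuous.finset_inf'_apply (X := ℕ → ℝ) (f := fun (j : ℕ) (x : ℕ → ℝ) => x j) hC
      (fun j _ => continuous_apply j)
    exact this
  unfold exchange
  fun_prop

/-- When the least coordinate on `A` is zero, the amount `t * |C| / |A|` added there becomes the new
minimum. The reverse exchange reads this amount off, and `|C| / |A|` times `exchangeVector A C` is
the negative of `exchangeVector C A`. -/
theorem exchange_exchange (hCA : Disjoint C A) {x : ℕ → ℝ} (hx : A.inf' hA x = 0) :
    exchange A C hA (exchange C A hC x) = x := by
  set t := C.inf' hC x with ht
  have hAp : (0 : ℝ) < A.card := by exact_mod_cast card_pos.mpr hA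
  have hCp : (0 : ℝ) < C.card := by exact_mod_cast card_pos.mpr hC
  have hval : ∀ i ∈ A, exchange C A hC x i = x i + t * (C.card / A.card) := by
    intro i hi
    have : i ∉ C := fun h => disjoint_left.mp hCA h hi
    simp [exchange, exchangeVector, hi, this, ht]
  have hinf : A.inf' hA (exchange C A hC x) = t * (C.card / A.card) := by
    obtain ⟨u, hu, hux⟩ := exists_mem_eq_inf' hA x
    apply le_antisymm
    · refine (inf'_le _ hu).trans ?_
      rw [hval u hu, ← hux, hx, zero_add]
    · refine le_inf' _ _ fun i hi => ?_
      rw [hval i hi]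
      have : A.inf' hA x ≤ x i := inf'_le _ hi
      linarith
  funext i
  rw [exchange, hinf, exchange, ← ht]
  by_cases hiA : i ∈ A
  · have : i ∉ C := fun h => disjoint_left.mp hCA h hiA
    simp [exchangeVector, hiA, this]
  · by_cases hiC : i ∈ C
    · simp only [exchangeVector, hiA, hiC, if_true, if_false]
      field_simp
      ring
    · simp [exchangeVector, hiA, hiC]

theorem exchange_of_inf'_eq_zero {x : ℕ → ℝ} (hx : C.inf' hC x = 0) : exchange C A hC x = x := by
  funext i
  simp [exchange, hx]

theorem inf'_eq_zero_of_mem_realization {K : StellarComplex} (hK : ∀ σ ∈ K.faces, ¬ C ⊆ σ)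
    {x : ℕ → ℝ} (hx : x ∈ K.realization) : C.inf' hC x = 0 := by
  obtain ⟨σ, hσ, h1, -⟩ := exists_carrier hx
  obtain ⟨u, huC, huσ⟩ := not_subset.mp (hK σ hσ)
  apply le_antisymm
  · refine (inf'_le _ huC).trans ?_
    rw [h1] at huσ
    exact not_lt.mp huσ
  · exact le_inf' _ _ fun i _ => hx.1 i

/-- Subtracting the minimum over `C` kills the coordinate of a vertex `u` where it is attained, and
the mass removed is spread over `A`. The image thus lies in `σ.erase u ∪ A`, and the total stays `1`
because `exchangeVector` sums to zero. -/
theorem exchange_mapsTo (hA : A.Nonempty) (hCA : Disjoint C A) {K L : StellarComplex}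
    (h₁ : ∀ σ ∈ K.faces, ¬ C ⊆ σ → σ ∈ L.faces)
    (h₂ : ∀ σ ∈ K.faces, C ⊆ σ → ∀ u ∈ C, σ.erase u ∪ A ∈ L.faces) :
    Set.MapsTo (exchange C A hC) K.realization L.realization := by
  intro x hx
  have hAp : (0 : ℝ) < A.card := by exact_mod_cast card_pos.mpr hA
  obtain ⟨σ, hσ, hpos, hsum⟩ := exists_carrier hx
  by_cases hCσ : C ⊆ σ
  · obtain ⟨u, hu, hux⟩ := exists_mem_eq_inf' hC x
    have hle : ∀ i ∈ C, x u ≤ x i := fun i hi => hux ▸ inf'_le _ hi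
    have h0 : 0 ≤ x u := hx.1 u
    refine ⟨fun i => ?_, _, h₂ σ hσ hCσ u hu, fun i hi => ?_, ?_⟩
    · rw [exchange, hux, exchangeVector]
      have := hx.1 i
      by_cases hiA : i ∈ A
      · have hiC : i ∉ C := fun h => disjoint_left.mp hCA h hiA
        simp only [hiA, hiC, if_true, if_false, sub_zero]
        positivity
      · by_cases hiC : i ∈ C
        · have := hle i hiC
          simp only [hiA, hiC, if_true, if_false]
          linarith
        · simpa [hiA, hiC] using this
    · simp only [mem_union, mem_erase, not_or, not_and] at hi
      rw [exchange, hux, exchangeVector, if_neg hi.2]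
      by_cases hiu : i = u
      · subst hiu; simp [hu]
      · have hiσ := hi.1 hiu
        have hiC : i ∉ C := fun h => hiσ (hCσ h)
        have : x i = 0 := le_antisymm (not_lt.mp fun h => hiσ ((hpos i).mpr h)) (hx.1 i)
        simp [hiC, this]
    · have hsub : σ.erase u ∪ A ⊆ σ ∪ A := union_subset_union_left (erase_subset _ _)
      rw [sum_subset hsub]
      · simp only [exchange, sum_add_distrib, ← mul_sum]
        have h3 : ∑ i ∈ σ ∪ A, x i = 1 := sum_eq_one_of_subset subset_union_left
          (fun i hi => le_antisymm (not_lt.mp fun h => hi ((hpos i).mpr h)) (hx.1 i)) hsum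
        have h4 : ∑ i ∈ σ ∪ A, exchangeVector C A i = 0 := by
          simp only [exchangeVector, sum_sub_distrib, sum_ite_mem]
          rw [inter_eq_right.mpr (subset_union_right : A ⊆ σ ∪ A),
            inter_eq_right.mpr (hCσ.trans (subset_union_left : σ ⊆ σ ∪ A))]
          simp only [sum_const, nsmul_eq_mul]
          field_simp
          ring
        rw [h3, h4]; ring
      · intro i _ hi
        simp only [mem_union, mem_erase, not_or, not_and] at hi
        rw [exchange, hux, exchangeVector, if_neg hi.2]
        by_cases hiu : i = u
        · subst hiu; simp [hu]
        · have hiσ := hi.1 hiu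
          have hiC : i ∉ C := fun h => hiσ (hCσ h)
          have : x i = 0 := le_antisymm (not_lt.mp fun h => hiσ ((hpos i).mpr h)) (hx.1 i)
          simp [hiC, this]
  · obtain ⟨u, huC, huσ⟩ := not_subset.mp hCσ
    have hinf : C.inf' hC x = 0 := by
      apply le_antisymm
      · refine (inf'_le _ huC).trans ?_
        rw [hpos] at huσ
        exact not_lt.mp huσ
      · exact le_inf' _ _ fun i _ => hx.1 i
    rw [exchange_of_inf'_eq_zero hinf]
    exact ⟨hx.1, σ, h₁ σ hσ hCσ,
      fun i hi => le_antisymm (not_lt.mp fun h => hi ((hpos i).mpr h)) (hx.1 i), hsum⟩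

/-- One pattern for two uses: starrings, where `C` is a new vertex, and bistellar moves, where `C`
is an edge. As `A` is not a face of `K` and `C` is not a face of `L`, the two exchanges are mutually
inverse. -/
theorem exchange_bijOn (hA : A.Nonempty) (hCA : Disjoint C A) {K L : StellarComplex}
    (h₁ : ∀ σ ∈ K.faces, ¬ C ⊆ σ → σ ∈ L.faces)
    (h₂ : ∀ σ ∈ K.faces, C ⊆ σ → ∀ u ∈ C, σ.erase u ∪ A ∈ L.faces)
    (h₁' : ∀ σ ∈ L.faces, ¬ A ⊆ σ → σ ∈ K.faces)
    (h₂' : ∀ σ ∈ L.faces, A ⊆ σ → ∀ u ∈ A, σ.erase u ∪ C ∈ K.faces)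
    (hK : ∀ σ ∈ K.faces, ¬ A ⊆ σ) (hL : ∀ σ ∈ L.faces, ¬ C ⊆ σ) :
    Set.BijOn (exchange C A hC) K.realization L.realization :=
  Set.InvOn.bijOn (f' := exchange A C hA)
    ⟨fun _ hx => exchange_exchange hCA (inf'_eq_zero_of_mem_realization hK hx),
      fun _ hx => exchange_exchange hCA.symm (inf'_eq_zero_of_mem_realization hL hx)⟩
    (exchange_mapsTo hA hCA h₁ h₂) (exchange_mapsTo hC hCA.symm h₁' h₂')

end Exchange

theorem starring_bijOn {K : StellarComplex} {A : Finset ℕ} {a : ℕ} (hA : A ∈ K.faces)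
    (hne : A.Nonempty) (ha : ¬ K.IsVertex a) :
    Set.BijOn (exchange {a} A (singleton_nonempty a)) (K.starring A a).realization
      K.realization := by
  have haK : ∀ σ ∈ K.faces, a ∉ σ := fun σ hσ h => ha (isVertex_of_mem hσ h)
  refine exchange_bijOn hne (by simpa using haK A hA) ?_ ?_ ?_ ?_ ?_ ?_
  · intro σ hσ haσ
    rw [singleton_subset_iff] at haσ
    have := ((mem_starring hA hne ha).mp hσ).2
    tauto
  · intro σ hσ haσ u hu
    rw [singleton_subset_iff] at haσ
    rw [mem_singleton] at hu
    subst hu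
    obtain ⟨-, h | h⟩ := (mem_starring hA hne ha).mp hσ
    · exact absurd haσ (haK σ h)
    · rw [union_comm]; exact h.2
  · exact fun σ hσ h => (mem_starring hA hne ha).mpr ⟨h, Or.inl hσ⟩
  · intro σ hσ h u hu
    have := replaceVertex_mem_starring hA hne ha hσ h hu
    rwa [replaceVertex, insert_eq, union_comm] at this
  · exact fun σ hσ => ((mem_starring hA hne ha).mp hσ).1
  · exact fun σ hσ h => haK σ hσ (singleton_subset_iff.mp h)

/-- A continuous bijection from a compact set of points to another set. -/
theorem nonempty_homeomorph_of_bijOn {X Y : Type*} [TopologicalSpace X] [TopologicalSpace Y]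
    [T2Space Y] {s : Set X} {t : Set Y} (hs : IsCompact s) {f : X → Y} (hf : ContinuousOn f s)
    (hb : Set.BijOn f s t) : Nonempty (s ≃ₜ t) := by
  have : CompactSpace s := isCompact_iff_compactSpace.mp hs
  have hc : Continuous (hb.equiv f) :=
    Continuous.subtype_mk (continuousOn_iff_continuous_domRestrict.mp hf) _
  exact ⟨Continuous.homeoOfEquivCompactToT2 hc⟩

theorem relabel_bijOn (K : StellarComplex) (e : Equiv.Perm ℕ) :
    Set.BijOn (fun (x : ℕ → ℝ) i => x (e.symm i)) K.realization (K.relabel e).realization := by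
  have key : ∀ (K : StellarComplex) (e : Equiv.Perm ℕ),
      Set.MapsTo (fun (x : ℕ → ℝ) i => x (e.symm i)) K.realization (K.relabel e).realization := by
    rintro K e x ⟨h0, σ, hσ, h1, h2⟩
    refine ⟨fun i => h0 _, σ.map e.toEmbedding, mem_image.mpr ⟨σ, hσ, rfl⟩, fun i hi => h1 _ ?_, ?_⟩
    · intro h
      exact hi (mem_map.mpr ⟨_, h, by simp⟩)
    · simpa [sum_map] using h2
  refine Set.InvOn.bijOn (f' := fun (x : ℕ → ℝ) i => x (e i)) ⟨?_, ?_⟩ (key K e) ?_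
  · intro x _; simp
  · intro x _; simp
  · have := key (K.relabel e) e.symm
    rwa [relabel_relabel_symm] at this

theorem StellarEquiv.nonempty_homeomorph {K L : StellarComplex} (h : StellarEquiv K L) :
    Nonempty (K.realization ≃ₜ L.realization) := by
  induction h with
  | rel K L h =>
    cases h with
    | subdivision A a hA hne ha =>
      exact (nonempty_homeomorph_of_bijOn (isCompact_realization _)
        continuous_exchange.continuousOn (starring_bijOn hA hne ha)).map Homeomorph.symm
    | relabel e =>
      exact nonempty_homeomorph_of_bijOn (isCompact_realization _)
        (continuous_pi fun i => continuous_apply _).continuousOn (relabel_bijOn K e)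
  | refl => exact ⟨Homeomorph.refl _⟩
  | symm _ _ _ ih => exact ih.map Homeomorph.symm
  | trans _ _ _ _ _ ih₁ ih₂ => exact ⟨ih₁.some.trans ih₂.some⟩

end StellarComplex

namespace StellarComplex

/-! ### Piecewise linear maps and unfoldings -/

open Finset

/-- Continuous maps on a set that are given at each point by one of finitely many affine maps. -/
def IsPLOn (f : (ℕ → ℝ) → (ℕ → ℝ)) (X : Set (ℕ → ℝ)) : Prop :=
  ContinuousOn f X ∧ ∃ F : Set ((ℕ → ℝ) →ᵃ[ℝ] (ℕ → ℝ)), F.Finite ∧ ∀ x ∈ X, ∃ A ∈ F, f x = A x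

theorem IsPLOn.comp {f g : (ℕ → ℝ) → (ℕ → ℝ)} {X Y : Set (ℕ → ℝ)} (hg : IsPLOn g Y)
    (hf : IsPLOn f X) (h : Set.MapsTo f X Y) : IsPLOn (g ∘ f) X := by
  obtain ⟨hgc, G, hG, hgG⟩ := hg
  obtain ⟨hfc, F, hF, hfF⟩ := hf
  refine ⟨hgc.comp hfc h, Set.image2 AffineMap.comp G F, hG.image2 _ hF, fun x hx => ?_⟩
  obtain ⟨A, hA, hAx⟩ := hfF x hx
  obtain ⟨B, hB, hBx⟩ := hgG (f x) (h hx)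
  exact ⟨B.comp A, ⟨B, hB, A, hA, rfl⟩, by simp [hBx, ← hAx]⟩

/-- The minimum over `C` is always one of finitely many coordinates, and each choice gives a linear
map. -/
theorem isPLOn_exchange {C A : Finset ℕ} (hC : C.Nonempty) (X : Set (ℕ → ℝ)) :
    IsPLOn (exchange C A hC) X := by
  refine ⟨continuous_exchange.continuousOn,
    (fun u : ℕ => (LinearMap.id + (LinearMap.proj (R := ℝ) (φ := fun _ : ℕ => ℝ) u).smulRight
      (exchangeVector C A)).toAffineMap) '' (C : Set ℕ), C.finite_toSet.image _, fun x _ => ?_⟩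
  obtain ⟨u, hu, hux⟩ := exists_mem_eq_inf' hC x
  refine ⟨_, ⟨u, hu, rfl⟩, ?_⟩
  funext i
  simp [exchange, hux]

theorem isPLOn_linearMap (f : (ℕ → ℝ) →ₗ[ℝ] (ℕ → ℝ)) (hf : Continuous f) (X : Set (ℕ → ℝ)) :
    IsPLOn f X :=
  ⟨hf.continuousOn, {f.toAffineMap}, Set.finite_singleton _, fun _ _ => ⟨_, rfl, rfl⟩⟩

theorem mem_cone {S : StellarComplex} {a : ℕ} {σ : Finset ℕ} :
    σ ∈ (cone a S).faces ↔ σ.erase a ∈ S.faces := by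
  simp only [cone, join, simplex, mem_image₂, mem_powerset]
  constructor
  · rintro ⟨α, hα, β, hβ, rfl⟩
    refine S.down_closed β hβ _ fun x hx => ?_
    have := @hα x
    simp only [mem_erase, mem_union, mem_singleton] at *
    tauto
  · intro h
    by_cases haσ : a ∈ σ
    · exact ⟨{a}, Subset.rfl, _, h, by rw [← insert_eq, insert_erase haσ]⟩
    · exact ⟨∅, empty_subset _, _, h, by rw [empty_union, erase_eq_of_notMem haσ]⟩

theorem realization_mono {K L : StellarComplex} (h : K.faces ⊆ L.faces) :
    K.realization ⊆ L.realization :=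
  fun _ ⟨h0, σ, hσ, h1⟩ => ⟨h0, σ, h hσ, h1⟩

theorem faces_subset_cone {S : StellarComplex} {a : ℕ} :
    S.faces ⊆ (cone a S).faces :=
  fun σ hσ => mem_cone.mpr (S.down_closed σ hσ _ (erase_subset _ _))

theorem mem_realization_of_carrier {K : StellarComplex} {x : ℕ → ℝ} (h0 : ∀ i, 0 ≤ x i)
    {σ : Finset ℕ} (hσ : σ ∈ K.faces) (hpos : ∀ i, i ∈ σ ↔ 0 < x i) (hs : ∑ i ∈ σ, x i = 1) :
    x ∈ K.realization :=
  ⟨h0, σ, hσ, fun i hi => le_antisymm (not_lt.mp fun h => hi ((hpos i).mpr h)) (h0 i), hs⟩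

theorem realization_union (K L : StellarComplex) :
    (K.union L).realization = K.realization ∪ L.realization := by
  ext x
  simp only [realization, union, mem_union, Set.mem_ofPred_eq, Set.mem_union]
  constructor
  · rintro ⟨h0, σ, hσ | hσ, h⟩
    · exact Or.inl ⟨h0, σ, hσ, h⟩
    · exact Or.inr ⟨h0, σ, hσ, h⟩
  · rintro (⟨h0, σ, hσ, h⟩ | ⟨h0, σ, hσ, h⟩)
    · exact ⟨h0, σ, Or.inl hσ, h⟩
    · exact ⟨h0, σ, Or.inr hσ, h⟩

/-- Complements of finite sets in `ℕ` are countably infinite, so a bijection of the finite sets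
extends. -/
theorem exists_perm_map_eq {A B : Finset ℕ} (h : A.card = B.card) :
    ∃ e : Equiv.Perm ℕ, A.map e.toEmbedding = B := by
  have hA : (A : Set ℕ)ᶜ.Infinite := A.finite_toSet.infinite_compl
  have hB : (B : Set ℕ)ᶜ.Infinite := B.finite_toSet.infinite_compl
  have : Infinite {x // ¬ x ∈ A} := hA.to_subtype
  have : Infinite {x // ¬ x ∈ B} := hB.to_subtype
  obtain ⟨f⟩ : Nonempty ({x // ¬ x ∈ A} ≃ {x // ¬ x ∈ B}) := nonempty_equiv_of_countable
  let e : Equiv.Perm ℕ := (Finset.equivOfCardEq h).subtypeCongr f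
  refine ⟨e, eq_of_subset_of_card_le (fun y hy => ?_) (by rw [card_map, h])⟩
  obtain ⟨x, hx, rfl⟩ := mem_map.mp hy
  have : e x = (Finset.equivOfCardEq h ⟨x, hx⟩ : ℕ) := by
    simp [e, Equiv.subtypeCongr, hx]
  simp [this]

theorem isStellarSphere_boundary {d : ℕ} {A : Finset ℕ} (hA : A.card = d + 2) :
    IsStellarSphere d (boundary A) := by
  obtain ⟨e, he⟩ := exists_perm_map_eq (A := A) (B := range (d + 2)) (by simpa)
  have h1 : A.Nonempty := card_pos.mp (by omega)
  have h2 : (range (d + 2)).Nonempty := ⟨0, by simp⟩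
  have : (boundary A).relabel e = boundary (range (d + 2)) := by
    ext σ
    rw [mem_relabel, mem_boundary h1, mem_boundary h2, ← he]
    have h3 : σ = (σ.map e.symm.toEmbedding).map e.toEmbedding := by simp [map_map]
    constructor
    · rintro ⟨h4, h5⟩
      rw [h3]
      exact ⟨map_subset_map.mpr h4, fun h => h5 (map_injective _ h)⟩
    · rintro ⟨h4, h5⟩
      rw [h3] at h4 h5
      exact ⟨map_subset_map.mp h4, fun h => h5 (by rw [h])⟩
  exact .rel _ _ (this ▸ StellarMove.relabel (boundary A) e)

/-- A ball `B` made of copies of `(d + 1)`-simplexes of `M`, glued to each other along some of their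
faces, with boundary `S`; `φ` takes the vertices of `B` to those of `M`, and `H` maps the cone
over `S` to `B`. -/
structure IsUnfolding (d : ℕ) (M : StellarComplex) (a : ℕ) (B S : StellarComplex) (φ : ℕ → ℕ)
    (H : (ℕ → ℝ) → (ℕ → ℝ)) : Prop where
  sphere : IsStellarSphere d S
  faces_subset : S.faces ⊆ B.faces
  apex : ¬ B.IsVertex a
  exists_facet : ∀ σ ∈ B.faces, ∃ b, IsFacet (d + 1) B b ∧ σ ⊆ b
  image_facet : ∀ b, IsFacet (d + 1) B b → IsFacet (d + 1) M (b.image φ)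
  image_inj : ∀ b b', IsFacet (d + 1) B b → IsFacet (d + 1) B b' → b.image φ = b'.image φ → b = b'
  interior : ∀ f ∈ B.faces, f.card = d + 1 → f ∉ S.faces →
    ∃ b b', IsFacet (d + 1) B b ∧ IsFacet (d + 1) B b' ∧ b ≠ b' ∧ f ⊆ b ∧ f ⊆ b'
  bijOn : Set.BijOn H (cone a S).realization B.realization
  isPLOn : IsPLOn H (cone a S).realization
  eq_self : ∀ x ∈ S.realization, H x = x

/-- The start of the construction: the cone over `∂g` is the starring of the full simplex in `g`, so
an exchange parametrizes it. -/
theorem exists_isUnfolding_simplex {d : ℕ} {M : StellarComplex} {g : Finset ℕ} {a : ℕ}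
    (hg : IsFacet (d + 1) M g) (ha : a ∉ g) :
    ∃ H, IsUnfolding d M a (simplex g) (boundary g) id H := by
  have hne : g.Nonempty := card_pos.mp (by rw [hg.2]; omega)
  have hF : ∀ {b}, IsFacet (d + 1) (simplex g) b → b = g := by
    rintro b ⟨h1, h2⟩
    exact eq_of_subset_of_card_le (mem_powerset.mp h1) (by rw [hg.2, h2])
  have hgF : IsFacet (d + 1) (simplex g) g := ⟨mem_powerset.mpr Subset.rfl, hg.2⟩
  have haB : ¬ (simplex g).IsVertex a := fun h =>
    ha (singleton_subset_iff.mp (mem_powerset.mp h))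
  have haS : ¬ (boundary g).IsVertex a := fun h =>
    ha (singleton_subset_iff.mp ((mem_boundary hne).mp h).1)
  have hcone : cone a (boundary g) = (simplex g).starring g a := by
    ext σ
    rw [mem_cone, mem_starring hgF.1 hne haB, mem_boundary hne]
    simp only [simplex, mem_powerset]
    constructor
    · rintro ⟨h1, h2⟩
      refine ⟨fun h => h2 (Subset.antisymm h1 fun x hx => mem_erase.mpr
        ⟨fun e => ha (e ▸ hx), h hx⟩), ?_⟩
      by_cases haσ : a ∈ σ
      · exact Or.inr ⟨haσ, union_subset Subset.rfl h1⟩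
      · rw [erase_eq_of_notMem haσ] at h1
        exact Or.inl h1
    · rintro ⟨h1, h2⟩
      refine ⟨?_, fun h => h1 (h ▸ erase_subset _ _)⟩
      rcases h2 with h2 | h2
      · exact (erase_subset _ _).trans h2
      · exact subset_union_right.trans h2.2
  refine ⟨exchange {a} g (singleton_nonempty a), isStellarSphere_boundary hg.2, ?_, haB,
    fun σ hσ => ⟨g, hgF, mem_powerset.mp hσ⟩, fun b hb => by rw [hF hb, image_id]; exact hg,
    fun b b' hb hb' _ => (hF hb).trans (hF hb').symm, ?_, ?_, isPLOn_exchange _ _, ?_⟩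
  · exact fun σ hσ => mem_powerset.mpr ((mem_boundary hne).mp hσ).1
  · intro f hf hfc hfS
    exfalso
    refine hfS ((mem_boundary hne).mpr ⟨mem_powerset.mp hf, fun h => ?_⟩)
    rw [h, hg.2] at hfc
    omega
  · rw [hcone]
    exact starring_bijOn hgF.1 hne haB
  · intro x hx
    exact exchange_of_inf'_eq_zero (by simp [realization_apply_eq_zero hx haS])

theorem mem_starring_of_maximal {S : StellarComplex} {F : Finset ℕ} {v : ℕ} (hF : F ∈ S.faces)
    (hFne : F.Nonempty) (hmax : ∀ σ ∈ S.faces, F ⊆ σ → σ = F) (hv : ¬ S.IsVertex v)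
    {σ : Finset ℕ} : σ ∈ (S.starring F v).faces ↔
      ¬ F ⊆ σ ∧ (σ ∈ S.faces ∨ v ∈ σ ∧ σ.erase v ⊆ F) := by
  rw [mem_starring hF hFne hv]
  refine and_congr_right fun _ => or_congr_right (and_congr_right fun _ =>
    ⟨fun h => ?_, fun h => ?_⟩)
  · rw [← hmax _ h subset_union_left]; exact subset_union_right
  · rw [union_eq_left.mpr h]; exact hF

/-- The cone over the starring of `S` in a generator `F` at `v` and the union of the cone over `S`
with the simplex `v ⋆ F` differ by a bistellar move. -/
theorem flip_bijOn {S : StellarComplex} {F : Finset ℕ} {a v : ℕ} (hF : F ∈ S.faces)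
    (hFne : F.Nonempty) (hmax : ∀ σ ∈ S.faces, F ⊆ σ → σ = F) (ha : ¬ S.IsVertex a)
    (hv : ¬ S.IsVertex v) (hva : v ≠ a) (hCne : ({a, v} : Finset ℕ).Nonempty) :
    Set.BijOn (exchange {a, v} F hCne) (cone a (S.starring F v)).realization
      ((cone a S).union (simplex (insert v F))).realization := by
  have haF : a ∉ F := fun h => ha (isVertex_of_mem hF h)
  have hvS : ∀ {σ}, σ ∈ S.faces → v ∉ σ := fun hσ h => hv (isVertex_of_mem hσ h)
  have hvF : v ∉ F := hvS hF
  have hcmem : ∀ {σ}, σ ∈ (cone a (S.starring F v)).faces ↔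
      ¬ F ⊆ σ ∧ (σ.erase a ∈ S.faces ∨ v ∈ σ ∧ (σ.erase a).erase v ⊆ F) := by
    intro σ
    rw [mem_cone, mem_starring_of_maximal hF hFne hmax hv]
    have h1 : F ⊆ σ.erase a ↔ F ⊆ σ := by
      rw [subset_erase]; exact ⟨fun h => h.1, fun h => ⟨h, haF⟩⟩
    have h2 : v ∈ σ.erase a ↔ v ∈ σ := by simp [hva]
    rw [h1, h2]
  have hLmem : ∀ {σ}, σ ∈ ((cone a S).union (simplex (insert v F))).faces ↔
      σ.erase a ∈ S.faces ∨ σ ⊆ insert v F := by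
    intro σ
    simp only [union, mem_union, mem_cone]
    simp [simplex]
  have hpair : ∀ {σ : Finset ℕ}, {a, v} ⊆ σ ↔ a ∈ σ ∧ v ∈ σ := by
    intro σ; simp [insert_subset_iff]
  -- The ball `a ⋆ v ⋆ ∂F` on the left is traded for `∂{a, v} ⋆ F` on the right: the edge `{a, v}`
  -- is present only on the left and `F` only on the right.
  refine exchange_bijOn hFne (by simp [haF, hvF]) ?_ ?_ ?_ ?_ ?_ ?_
  · intro σ hσ hav
    rw [hpair] at hav
    obtain ⟨-, h | ⟨h, h'⟩⟩ := hcmem.mp hσ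
    · exact hLmem.mpr (Or.inl h)
    · rw [erase_eq_of_notMem fun ha => hav ⟨ha, h⟩] at h'
      exact hLmem.mpr (Or.inr (subset_insert_iff.mpr h'))
  · intro σ hσ hav u hu
    rw [hpair] at hav
    obtain ⟨-, h | ⟨-, h⟩⟩ := hcmem.mp hσ
    · exact absurd (mem_erase.mpr ⟨hva, hav.2⟩) (hvS h)
    · rw [mem_insert, mem_singleton] at hu
      rw [hLmem]
      rcases hu with rfl | rfl
      · exact Or.inr (union_subset (subset_insert_iff.mpr h) (subset_insert _ _))
      · refine Or.inl (S.down_closed _ hF _ ?_)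
        rw [erase_union_distrib, erase_right_comm]
        exact union_subset h (erase_subset _ _)
  · intro σ hσ hFσ
    refine hcmem.mpr ⟨hFσ, ?_⟩
    rcases hLmem.mp hσ with h | h
    · exact Or.inl h
    · by_cases hvσ : v ∈ σ
      · refine Or.inr ⟨hvσ, ?_⟩
        rw [erase_right_comm]
        exact (erase_subset _ _).trans (subset_insert_iff.mp h)
      · exact Or.inl (S.down_closed _ hF _ ((erase_subset _ _).trans
          ((subset_insert_iff_of_notMem hvσ).mp h)))
  · intro σ hσ hFσ u hu
    have hua : u ≠ a := fun e => haF (e ▸ hu)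
    have huv : u ≠ v := fun e => hvF (e ▸ hu)
    refine hcmem.mpr ⟨fun h => ?_, Or.inr ⟨by simp, fun x hx => ?_⟩⟩
    · have := h hu
      simp [hua, huv] at this
    · simp only [mem_union, mem_erase, mem_insert, mem_singleton] at hx
      have hxσ : x ∈ σ := by tauto
      rcases hLmem.mp hσ with h | h
      · rw [← hmax _ h (subset_erase.mpr ⟨hFσ, haF⟩)]
        exact mem_erase.mpr ⟨hx.2.1, hxσ⟩
      · exact (mem_insert.mp (h hxσ)).resolve_left hx.1
  · exact fun σ hσ => (hcmem.mp hσ).1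
  · intro σ hσ hav
    rw [hpair] at hav
    rcases hLmem.mp hσ with h | h
    · exact hvS h (mem_erase.mpr ⟨hva, hav.2⟩)
    · rcases mem_insert.mp (h hav.1) with h | h
      · exact hva h.symm
      · exact haF h

/-- Attaching the simplex `v ⋆ F` stars the boundary sphere in `F`. The flip carries the new cone to
the old cone with `v ⋆ F` attached, and on the latter the old parametrization is extended by the
identity. -/
theorem IsUnfolding.glue {d : ℕ} {M : StellarComplex} {a : ℕ} {B S : StellarComplex} {φ : ℕ → ℕ}
    {H : (ℕ → ℝ) → (ℕ → ℝ)} (hU : IsUnfolding d M a B S φ H) {F : Finset ℕ} (hF : IsFacet d S F)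
    {v w : ℕ} (hva : v ≠ a) (hv : ¬ B.IsVertex v)
    (hw : IsFacet (d + 1) M (insert w (F.image φ)))
    (hnew : ∀ b, IsFacet (d + 1) B b → b.image φ ≠ insert w (F.image φ)) :
    ∃ H', IsUnfolding d M a (B.union (simplex (insert v F))) (S.starring F v)
      (Function.update φ v w) H' := by
  have hFne : F.Nonempty := card_pos.mp (by rw [hF.2]; omega)
  have hvS : ¬ S.IsVertex v := fun h => hv (hU.faces_subset h)
  have haS : ¬ S.IsVertex a := fun h => hU.apex (hU.faces_subset h)
  have hvB : ∀ {σ}, σ ∈ B.faces → v ∉ σ := fun hσ h => hv (isVertex_of_mem hσ h)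
  have hFB := hU.faces_subset hF.1
  have haF : a ∉ F := fun h => haS (isVertex_of_mem hF.1 h)
  have hvF : v ∉ F := hvB hFB
  have hmax : ∀ {σ}, σ ∈ S.faces → F ⊆ σ → σ = F := fun hσ h =>
    (eq_of_subset_of_card_le h (by
      rw [hF.2]; exact hU.sphere.isNormalPseudomanifold.card_le _ hσ)).symm
  have hmem : ∀ {σ}, σ ∈ (S.starring F v).faces ↔
      ¬ F ⊆ σ ∧ (σ ∈ S.faces ∨ v ∈ σ ∧ σ.erase v ⊆ F) := by
    exact mem_starring_of_maximal hF.1 hFne (fun _ h => hmax h) hvS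
  have haS' : ¬ (S.starring F v).IsVertex a := by
    intro h
    obtain ⟨-, h | ⟨h, -⟩⟩ := hmem.mp h
    · exact haS h
    · exact hva (by simpa using h)
  have hFc : (insert v F).card = d + 2 := by rw [card_insert_of_notMem hvF, hF.2]
  have hB'F : ∀ {b}, IsFacet (d + 1) (B.union (simplex (insert v F))) b ↔
      IsFacet (d + 1) B b ∨ b = insert v F := by
    intro b
    simp only [IsFacet, union, simplex, mem_union, mem_powerset]
    constructor
    · rintro ⟨h1 | h1, h2⟩
      · exact Or.inl ⟨h1, h2⟩
      · exact Or.inr (eq_of_subset_of_card_le h1 (by omega))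
    · rintro (h | rfl)
      · exact ⟨Or.inl h.1, h.2⟩
      · exact ⟨Or.inr Subset.rfl, hFc⟩
  have himB : ∀ {b}, b ∈ B.faces → b.image (Function.update φ v w) = b.image φ := fun hb =>
    image_congr fun x hx => Function.update_of_ne
      (show x ≠ v from fun e => hvB hb (e ▸ mem_coe.mp hx)) _ _
  have himF : (insert v F).image (Function.update φ v w) = insert w (F.image φ) := by
    rw [image_insert, Function.update_self, himB hFB]
  have hCne : ({a, v} : Finset ℕ).Nonempty := ⟨a, by simp⟩
  let L : StellarComplex := (cone a S).union (simplex (insert v F))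
  have hflip : Set.BijOn (exchange {a, v} F hCne) (cone a (S.starring F v)).realization
      L.realization := flip_bijOn hF.1 hFne (fun _ h => hmax h) haS hvS hva hCne
  classical
  -- The old cone lies in `x v = 0`. A point of `v ⋆ F` with `x v = 0` lies in `F`, hence in `S`,
  -- where `H` is the identity; so `G` is the identity on all of `v ⋆ F`.
  let G : (ℕ → ℝ) → (ℕ → ℝ) := fun x => if x v = 0 then H x else x
  have hvcone : ∀ {x}, x ∈ (cone a S).realization → x v = 0 := fun hx =>
    realization_apply_eq_zero hx fun h => by
      have h := mem_cone.mp h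
      rw [erase_eq_of_notMem (by simpa using hva.symm)] at h
      exact hvS h
  have hGcone : ∀ {x}, x ∈ (cone a S).realization → G x = H x := fun hx => if_pos (hvcone hx)
  have hFS : ∀ {x}, x ∈ (simplex (insert v F)).realization → x v = 0 → x ∈ S.realization := by
    intro x hx hxv
    obtain ⟨σ, hσ, hpos, hs⟩ := exists_carrier hx
    refine mem_realization_of_carrier hx.1 (S.down_closed _ hF.1 _ fun y hy => ?_) hpos hs
    have h1 := mem_powerset.mp hσ hy
    rw [mem_insert] at h1
    rcases h1 with rfl | h1
    · exact absurd hxv ((hpos _).mp hy).ne'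
    · exact h1
  have hGF : ∀ {x}, x ∈ (simplex (insert v F)).realization → G x = x := by
    intro x hx
    by_cases hxv : x v = 0
    · simp only [G, hxv, if_true]
      exact hU.eq_self x (hFS hx hxv)
    · simp only [G, hxv, if_false]
  have hvBr : ∀ {x}, x ∈ B.realization → x v = 0 := fun hx => realization_apply_eq_zero hx hv
  have hGbij : Set.BijOn G L.realization (B.union (simplex (insert v F))).realization := by
    simp only [L, realization_union]
    refine ⟨?_, ?_, ?_⟩
    · rintro x (hx | hx)
      · rw [hGcone hx]; exact Or.inl (hU.bijOn.mapsTo hx)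
      · rw [hGF hx]; exact Or.inr hx
    · have hSc : ∀ {x}, x ∈ (simplex (insert v F)).realization → x v = 0 →
          x ∈ (cone a S).realization := fun hx h =>
        realization_mono faces_subset_cone (hFS hx h)
      have hmix : ∀ {x y}, x ∈ (cone a S).realization → y ∈ (simplex (insert v F)).realization →
          G x = G y → x = y := by
        intro x y hx hy h
        have h1 := h
        rw [hGcone hx, hGF hy] at h1
        have h2 : y v = 0 := h1 ▸ hvBr (hU.bijOn.mapsTo hx)
        rw [hGcone hx, hGcone (hSc hy h2)] at h
        exact hU.bijOn.injOn hx (hSc hy h2) h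
      rintro x (hx | hx) y (hy | hy) h
      · rw [hGcone hx, hGcone hy] at h
        exact hU.bijOn.injOn hx hy h
      · exact hmix hx hy h
      · exact (hmix hy hx h.symm).symm
      · rwa [hGF hx, hGF hy] at h
    · rintro y (hy | hy)
      · obtain ⟨x, hx, rfl⟩ := hU.bijOn.surjOn hy
        exact ⟨x, Or.inl hx, hGcone hx⟩
      · exact ⟨y, Or.inr hy, hGF hy⟩
  have hGpl : IsPLOn G L.realization := by
    obtain ⟨hc, T, hT, hHT⟩ := hU.isPLOn
    refine ⟨?_, insert (AffineMap.id ℝ (ℕ → ℝ)) T, hT.insert _, ?_⟩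
    · simp only [L, realization_union]
      exact ContinuousOn.union_of_isClosed (hc.congr fun x hx => hGcone hx)
        (continuousOn_id.congr fun x hx => hGF hx) (isCompact_realization _).isClosed
        (isCompact_realization _).isClosed
    · simp only [L, realization_union]
      rintro x (hx | hx)
      · obtain ⟨A, hA, hAx⟩ := hHT x hx
        exact ⟨A, Set.mem_insert_of_mem _ hA, by rw [hGcone hx, hAx]⟩
      · exact ⟨_, Set.mem_insert _ _, by rw [hGF hx]; rfl⟩
  refine ⟨G ∘ exchange {a, v} F hCne, ?_, ?_, ?_, ?_, ?_, ?_, ?_, hGbij.comp hflip,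
    hGpl.comp (isPLOn_exchange _ _) hflip.mapsTo, ?_⟩
  · exact .trans _ _ _ (.symm _ _ (.rel _ _ (.subdivision S F v hF.1 hFne hvS))) hU.sphere
  · intro σ hσ
    simp only [union, simplex, mem_union, mem_powerset]
    obtain ⟨-, h | ⟨h, h'⟩⟩ := hmem.mp hσ
    · exact Or.inl (hU.faces_subset h)
    · refine Or.inr fun x hx => ?_
      exact subset_insert_iff.mpr h' hx
  · intro h
    simp only [IsVertex, union, simplex, mem_union, mem_powerset, singleton_subset_iff,
      mem_insert] at h
    rcases h with h | h | h
    · exact hU.apex h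
    · exact hva h.symm
    · exact haF h
  · intro σ hσ
    simp only [union, simplex, mem_union, mem_powerset] at hσ
    rcases hσ with h | h
    · obtain ⟨b, hb, hs⟩ := hU.exists_facet σ h
      exact ⟨b, hB'F.mpr (Or.inl hb), hs⟩
    · exact ⟨_, hB'F.mpr (Or.inr rfl), h⟩
  · intro b hb
    rcases hB'F.mp hb with h | rfl
    · rw [himB h.1]; exact hU.image_facet b h
    · rw [himF]; exact hw
  · intro b b' hb hb' he
    rcases hB'F.mp hb with h | rfl <;> rcases hB'F.mp hb' with h' | rfl
    · rw [himB h.1, himB h'.1] at he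
      exact hU.image_inj b b' h h' he
    · rw [himB h.1, himF] at he
      exact absurd he (hnew b h)
    · rw [himB h'.1, himF] at he
      exact absurd he.symm (hnew b' h')
    · rfl
  · intro f hf hfc hfS
    by_cases hfB : f ∈ B.faces
    · by_cases hfS' : f ∈ S.faces
      -- The only `d`-simplex of the old sphere that leaves the boundary is `F`, now shared by an
      -- old facet and the new one.
      · have : F ⊆ f := by
          by_contra h
          exact hfS (hmem.mpr ⟨h, Or.inl hfS'⟩)
        have hfF := hmax hfS' this
        obtain ⟨b, hb, hs⟩ := hU.exists_facet f hfB
        refine ⟨b, _, hB'F.mpr (Or.inl hb), hB'F.mpr (Or.inr rfl), fun e => ?_, hs, ?_⟩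
        · exact hvB hb.1 (e ▸ mem_insert_self v F)
        · rw [hfF]; exact subset_insert _ _
      · obtain ⟨b, b', hb, hb', h⟩ := hU.interior f hfB hfc hfS'
        exact ⟨b, b', hB'F.mpr (Or.inl hb), hB'F.mpr (Or.inl hb'), h⟩
    · exfalso
      have hfs : f ⊆ insert v F := by
        simp only [union, simplex, mem_union, mem_powerset] at hf
        tauto
      have hvf : v ∈ f := by
        by_contra h
        exact hfB (B.down_closed _ hFB _ ((subset_insert_iff_of_notMem h).mp hfs))
      refine hfS (hmem.mpr ⟨fun h => ?_, Or.inr ⟨hvf, subset_insert_iff.mp hfs⟩⟩)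
      have := card_le_card (insert_subset hvf h)
      omega
  · intro x hx
    have hxa : x a = 0 := realization_apply_eq_zero hx haS'
    -- On the new sphere the coordinate at `a` vanishes, so the flip does not move the point.
    have hinf : ({a, v} : Finset ℕ).inf' hCne x = 0 := by
      apply le_antisymm
      · exact hxa ▸ inf'_le _ (by simp)
      · exact le_inf' _ _ fun i _ => hx.1 i
    rw [Function.comp_apply, exchange_of_inf'_eq_zero hinf]
    by_cases hxv : x v = 0
    · simp only [G, hxv, if_true]
      refine hU.eq_self x ?_
      obtain ⟨σ, hσ, hpos, hs⟩ := exists_carrier hx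
      obtain ⟨-, h | ⟨h, -⟩⟩ := hmem.mp hσ
      · exact mem_realization_of_carrier hx.1 h hpos hs
      · exact absurd hxv ((hpos v).mp h).ne'
    · simp only [G, hxv, if_false]

end StellarComplex

namespace StellarComplex

/-! ### Complete unfoldings and the identification of `M` with a glued cone -/

open Finset

theorem IsFacet.isGenerator {d : ℕ} {K : StellarComplex} (hK : IsNormalPseudomanifold d K)
    {g : Finset ℕ} (hg : IsFacet d K g) : K.IsGenerator g :=
  ⟨hg.1, fun σ hσ h => (eq_of_subset_of_card_le h (by rw [hg.2]; exact hK.card_le σ hσ)).symm⟩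

theorem IsGenerator.isFacet {d : ℕ} {K : StellarComplex} (hK : IsNormalPseudomanifold d K)
    {g : Finset ℕ} (hg : K.IsGenerator g) : IsFacet d K g := by
  obtain ⟨h, hh, hgh⟩ := hK.exists_facet g hg.1
  rwa [← hg.2 h hh.1 hgh]

theorem IsUnfolding.injOn {d : ℕ} {M : StellarComplex} {a : ℕ} {B S : StellarComplex} {φ : ℕ → ℕ}
    {H : (ℕ → ℝ) → (ℕ → ℝ)} (hU : IsUnfolding d M a B S φ H) {σ : Finset ℕ} (hσ : σ ∈ B.faces) :
    Set.InjOn φ σ := by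
  obtain ⟨b, hb, hσb⟩ := hU.exists_facet σ hσ
  have : Set.InjOn φ b := card_image_iff.mp (by rw [(hU.image_facet b hb).2, hb.2])
  exact this.mono (coe_subset.mpr hσb)

/-- By strong connectedness some facet `h` without a copy is adjacent to the image of a facet `b` of
`B`. The face of `b` over the common face must lie on the boundary sphere, since an interior one
would give three facets of `M` through a face of codimension one. -/
theorem IsUnfolding.exists_glue {d : ℕ} {M : StellarComplex}
    (hM : IsNormalPseudomanifold (d + 1) M) {a : ℕ} {B S : StellarComplex} {φ : ℕ → ℕ}
    {H : (ℕ → ℝ) → (ℕ → ℝ)} (hU : IsUnfolding d M a B S φ H)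
    (hinc : ¬ ∀ g, IsFacet (d + 1) M g → ∃ b, IsFacet (d + 1) B b ∧ b.image φ = g) :
    ∃ B' S' φ' H', IsUnfolding d M a B' S' φ' H' ∧
      (B.faces.filter fun b => b.card = d + 2).card <
        (B'.faces.filter fun b => b.card = d + 2).card := by
  have hstep : ∃ b h, IsFacet (d + 1) B b ∧ IsFacet (d + 1) M h ∧
      (∀ c, IsFacet (d + 1) B c → c.image φ ≠ h) ∧ d + 1 ≤ (b.image φ ∩ h).card := by
    by_contra hno
    push Not at hno
    refine hinc fun g hg => ?_
    obtain ⟨b₀, hb₀, -⟩ := hU.exists_facet ∅ B.empty_mem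
    -- If no missing facet were adjacent to a covered one, being covered would propagate along
    -- chains to every facet.
    have := hM.chain ∅ _ g (hU.image_facet b₀ hb₀) hg (empty_subset _) (empty_subset _)
    induction this with
    | refl => exact ⟨b₀, hb₀, rfl⟩
    | tail _ hst ih =>
      obtain ⟨b, hb, rfl⟩ := ih hst.1
      by_contra hnot
      push Not at hnot
      exact absurd hst.2.2.2.2 (not_le.mpr (hno b _ hb hst.2.1 hnot))
  obtain ⟨b, h, hb, hh, hnot, hc⟩ := hstep
  have hg := hU.image_facet b hb
  have hce : (b.image φ ∩ h).card = d + 1 := by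
    refine le_antisymm (Nat.lt_succ_iff.mp ?_) hc
    by_contra hlt
    have h1 : b.image φ ∩ h = b.image φ :=
      eq_of_subset_of_card_le inter_subset_left (by rw [hg.2]; omega)
    have h2 : b.image φ ∩ h = h :=
      eq_of_subset_of_card_le inter_subset_right (by rw [hh.2]; omega)
    exact hnot b hb (h1.symm.trans h2)
  set F := b.filter fun u => φ u ∈ h with hFdef
  have hFim : F.image φ = b.image φ ∩ h := by
    ext j
    simp only [hFdef, mem_image, mem_filter, mem_inter]
    constructor
    · rintro ⟨u, ⟨hu, hu'⟩, rfl⟩; exact ⟨⟨u, hu, rfl⟩, hu'⟩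
    · rintro ⟨⟨u, hu, rfl⟩, hu'⟩; exact ⟨u, ⟨hu, hu'⟩, rfl⟩
  have hFb : F ⊆ b := filter_subset _ _
  have hFc : F.card = d + 1 := by
    rw [← hce, ← hFim, card_image_iff.mpr ((hU.injOn hb.1).mono (coe_subset.mpr hFb))]
  have hFS : F ∈ S.faces := by
    by_contra hFS
    obtain ⟨b₁, b₂, hb₁, hb₂, hne, hF₁, hF₂⟩ :=
      hU.interior F (B.down_closed _ hb.1 _ hFb) hFc hFS
    rcases hM.at_most_two (F.image φ) (by rw [hFim, hce]) _ _ h (hU.image_facet b₁ hb₁)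
      (hU.image_facet b₂ hb₂) hh (image_subset_image hF₁) (image_subset_image hF₂)
      (by rw [hFim]; exact inter_subset_right) with h1 | h1 | h1
    · exact hne (hU.image_inj _ _ hb₁ hb₂ h1)
    · exact hnot b₁ hb₁ h1
    · exact hnot b₂ hb₂ h1
  obtain ⟨w, hw⟩ : ∃ w, insert w (F.image φ) = h := by
    have h1 : (h \ (b.image φ ∩ h)).card = 1 := by
      rw [card_sdiff_of_subset inter_subset_right, hh.2, hce]; omega
    obtain ⟨w, hw⟩ := card_eq_one.mp h1
    exact ⟨w, by rw [hFim, insert_eq, ← hw, sdiff_union_of_subset inter_subset_right]⟩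
  obtain ⟨v, hv⟩ := Infinite.exists_notMem_finset (insert a (B.faces.biUnion id))
  simp only [mem_insert, mem_biUnion, id, not_or, not_exists, not_and] at hv
  have hvB : ¬ B.IsVertex v := fun hvB => hv.2 _ hvB (mem_singleton_self v)
  obtain ⟨H', hH'⟩ := hU.glue ⟨hFS, hFc⟩ hv.1 hvB (hw ▸ hh) (by rw [hw]; exact hnot)
  refine ⟨_, _, _, H', hH', card_lt_card ?_⟩
  refine (Finset.ssubset_iff_of_subset fun c hc => ?_).mpr ⟨insert v F, ?_, fun hc => ?_⟩
  · rw [mem_filter] at hc ⊢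
    exact ⟨mem_union_left _ hc.1, hc.2⟩
  · rw [mem_filter]
    refine ⟨mem_union_right _ (mem_powerset.mpr Subset.rfl), ?_⟩
    rw [card_insert_of_notMem fun h => hvB (isVertex_of_mem hb.1 (hFb h)), hFc]
  · exact hvB (isVertex_of_mem (mem_filter.mp hc).1 (mem_insert_self v F))

/-- Facets of `B` inject into those of `M`, so an unfolding cannot grow beyond the number of facets
of `M`. -/
theorem exists_complete_unfolding {d : ℕ} {M : StellarComplex}
    (hM : IsNormalPseudomanifold (d + 1) M) :
    ∃ a B S φ H, IsUnfolding d M a B S φ H ∧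
      ∀ g, IsFacet (d + 1) M g → ∃ b, IsFacet (d + 1) B b ∧ b.image φ = g := by
  obtain ⟨g, hg, -⟩ := hM.exists_facet ∅ M.empty_mem
  obtain ⟨a, ha⟩ := Infinite.exists_notMem_finset g
  by_contra hno
  push Not at hno
  have hall : ∀ k : ℕ, ∃ B S φ H, IsUnfolding d M a B S φ H ∧
      k ≤ (B.faces.filter fun b => b.card = d + 2).card := by
    intro k
    induction k with
    | zero =>
      obtain ⟨H, hH⟩ := exists_isUnfolding_simplex hg ha
      exact ⟨_, _, _, H, hH, Nat.zero_le _⟩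
    | succ k ih =>
      obtain ⟨B, S, φ, H, hU, hk⟩ := ih
      obtain ⟨B', S', φ', H', hU', hlt⟩ := hU.exists_glue hM (by
        push Not
        exact hno a B S φ H hU)
      exact ⟨B', S', φ', H', hU', by omega⟩
  obtain ⟨B, S, φ, H, hU, hk⟩ := hall ((M.faces.filter fun b => b.card = d + 2).card + 1)
  have := card_le_card_of_injOn (s := B.faces.filter fun b => b.card = d + 2)
    (t := M.faces.filter fun b => b.card = d + 2) (fun b => b.image φ)
    (fun b hb => by
      have hb := mem_filter.mp (mem_coe.mp hb)
      exact mem_coe.mpr (mem_filter.mpr (hU.image_facet b hb)))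
    (fun b hb b' hb' h => by
      have hb := mem_filter.mp (mem_coe.mp hb)
      have hb' := mem_filter.mp (mem_coe.mp hb')
      exact hU.image_inj b b' hb hb' h)
  omega

/-- The linear map of barycentric coordinates induced by a map of vertices. -/
noncomputable def pushforward (V : Finset ℕ) (φ : ℕ → ℕ) : (ℕ → ℝ) →ₗ[ℝ] (ℕ → ℝ) :=
  ∑ i ∈ V, (LinearMap.proj (R := ℝ) (φ := fun _ : ℕ => ℝ) i).smulRight (Pi.single (φ i) (1 : ℝ))

section Pushforward

variable {V σ : Finset ℕ} {φ : ℕ → ℕ} {x : ℕ → ℝ}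

theorem pushforward_apply (j : ℕ) :
    pushforward V φ x j = ∑ i ∈ V, if φ i = j then x i else 0 := by
  simp only [pushforward, LinearMap.sum_apply, Finset.sum_apply, LinearMap.smulRight_apply,
    LinearMap.proj_apply, Pi.smul_apply, Pi.single_apply, smul_eq_mul, mul_ite, mul_one, mul_zero]
  exact sum_congr rfl fun i _ => by simp only [eq_comm]

theorem continuous_pushforward : Continuous (pushforward V φ) := by
  refine continuous_pi fun j => ?_
  simp only [pushforward_apply]
  refine continuous_finsetSum _ fun i _ => ?_
  split_ifs
  · exact continuous_apply i
  · exact continuous_const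

theorem pushforward_apply_of_mem (hσV : σ ⊆ V) (hx : ∀ i, i ∉ σ → x i = 0) (hφ : Set.InjOn φ σ)
    {u : ℕ} (hu : u ∈ σ) : pushforward V φ x (φ u) = x u := by
  rw [pushforward_apply, sum_eq_single u]
  · simp
  · intro i _ hiu
    by_cases hi : i ∈ σ
    · rw [if_neg fun e => hiu (hφ hi hu e)]
    · simp [hx i hi]
  · exact fun h => absurd (hσV hu) h

theorem pushforward_apply_of_notMem (hx : ∀ i, i ∉ σ → x i = 0) {j : ℕ} (hj : j ∉ σ.image φ) :
    pushforward V φ x j = 0 := by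
  rw [pushforward_apply]
  refine sum_eq_zero fun i _ => ?_
  split_ifs with h
  · exact hx i fun hi => hj (mem_image.mpr ⟨i, hi, h⟩)
  · rfl

theorem sum_image_pushforward (hσV : σ ⊆ V) (hx : ∀ i, i ∉ σ → x i = 0) (hφ : Set.InjOn φ σ) :
    ∑ j ∈ σ.image φ, pushforward V φ x j = ∑ u ∈ σ, x u := by
  rw [sum_image hφ]
  exact sum_congr rfl fun u hu => pushforward_apply_of_mem hσV hx hφ hu

theorem pushforward_nonneg (hx : ∀ i, 0 ≤ x i) (j : ℕ) : 0 ≤ pushforward V φ x j := by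
  rw [pushforward_apply]
  refine sum_nonneg fun i _ => ?_
  split_ifs
  · exact hx i
  · exact le_rfl

end Pushforward

theorem gluing_eq_or_mem {S : StellarComplex} {r : Setoid ℕ} {x y : ℕ → ℝ} (h : gluing S r x y) :
    x = y ∨ x ∈ S.realization ∧ y ∈ S.realization := by
  change Relation.EqvGen _ x y at h
  induction h with
  | rel _ _ h =>
    obtain ⟨g, p, -, -, h⟩ := h
    exact Or.inr ⟨h.1, h.2.1⟩
  | refl => exact Or.inl rfl
  | symm _ _ _ ih => exact ih.imp Eq.symm And.symm
  | trans _ _ _ _ _ ih₁ ih₂ =>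
    rcases ih₁ with rfl | h₁
    · exact ih₂
    · rcases ih₂ with rfl | h₂
      · exact Or.inr h₁
      · exact Or.inr ⟨h₁.1, h₂.2⟩

theorem nonempty_homeomorph_quotient {X Y : Type*} [TopologicalSpace X] [CompactSpace X]
    [TopologicalSpace Y] [T2Space Y] {s : Setoid X} {f : X → Y} (hf : Continuous f)
    (hs : Function.Surjective f) (h : ∀ x y, f x = f y ↔ s x y) :
    ∃ e : Quotient s ≃ₜ Y, ∀ x, e (Quotient.mk s x) = f x := by
  let g : Quotient s → Y := Quotient.lift f fun x y hxy => (h x y).mpr hxy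
  have hg : Function.Bijective g := by
    refine ⟨fun p q => ?_, fun y => ?_⟩
    · induction p using Quotient.inductionOn
      induction q using Quotient.inductionOn
      exact fun e => Quotient.sound ((h _ _).mp e)
    · obtain ⟨x, rfl⟩ := hs y
      exact ⟨Quotient.mk s x, rfl⟩
  have hc : Continuous (Equiv.ofBijective g hg) := hf.quotient_lift _
  exact ⟨Continuous.homeoOfEquivCompactToT2 hc, fun x => rfl⟩

section Unfolding

variable {d : ℕ} {M : StellarComplex} {a : ℕ} {B S : StellarComplex} {φ : ℕ → ℕ}
  {H : (ℕ → ℝ) → (ℕ → ℝ)}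

/-- Equivalent generators have the same image, a face of codimension one in `M`, hence in at most
two facets. A facet of `B` is determined by its image, and a generator inside it by its own image,
so three distinct equivalent generators cannot occur. -/
theorem IsUnfolding.isRegular (hM : IsNormalPseudomanifold (d + 1) M)
    (hU : IsUnfolding d M a B S φ H) : IsRegular S (Setoid.ker φ) := by
  have hS := hU.sphere.isNormalPseudomanifold
  refine ⟨fun g hg u hu v hv h => hU.injOn (hU.faces_subset hg.1) hu hv h, ?_⟩
  intro g hg p q hp hq hpg hqg hgp hgq
  have hcard : ∀ {p}, S.IsGenerator p → (p.image φ).card = d + 1 := fun hp => by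
    rw [card_image_iff.mpr (hU.injOn (hU.faces_subset hp.1)), (hp.isFacet hS).2]
  have him : ∀ {p}, S.IsGenerator p → Subordinate (Setoid.ker φ) g p →
      g.image φ = p.image φ := by
    intro p hp h
    refine eq_of_subset_of_card_le (fun j hj => ?_) (by rw [hcard hg, hcard hp])
    obtain ⟨u, hu, rfl⟩ := mem_image.mp hj
    obtain ⟨v, hv, huv⟩ := h u hu
    exact mem_image.mpr ⟨v, hv, (Setoid.ker_def.mp huv).symm⟩
  have heq : ∀ {b p q}, IsFacet (d + 1) B b → p ⊆ b → q ⊆ b → p.image φ = q.image φ → p = q := by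
    intro b p q hb hpb hqb h
    exact_mod_cast (hU.injOn hb.1).image_eq_image_iff (coe_subset.mpr hpb) (coe_subset.mpr hqb)
      |>.mp (by exact_mod_cast h)
  obtain ⟨b, hb, hgb⟩ := hU.exists_facet g (hU.faces_subset hg.1)
  obtain ⟨b₁, hb₁, hpb⟩ := hU.exists_facet p (hU.faces_subset hp.1)
  obtain ⟨b₂, hb₂, hqb⟩ := hU.exists_facet q (hU.faces_subset hq.1)
  rcases hM.at_most_two (g.image φ) (hcard hg) _ _ _ (hU.image_facet b hb)
    (hU.image_facet b₁ hb₁) (hU.image_facet b₂ hb₂) (image_subset_image hgb)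
    (by rw [him hp hgp]; exact image_subset_image hpb)
    (by rw [him hq hgq]; exact image_subset_image hqb) with h | h | h
  · have := hU.image_inj _ _ hb hb₁ h
    subst this
    exact absurd (heq hb hgb hpb (him hp hgp)).symm hpg
  · have := hU.image_inj _ _ hb hb₂ h
    subst this
    exact absurd (heq hb hgb hqb (him hq hgq)).symm hqg
  · have := hU.image_inj _ _ hb₁ hb₂ h
    subst this
    exact heq hb₁ hpb hqb ((him hp hgp).symm.trans (him hq hgq))

/-- The point of the simplex `b` over a point of its image. -/
def liftPoint (φ : ℕ → ℕ) (b : Finset ℕ) (z : ℕ → ℝ) (u : ℕ) : ℝ := if u ∈ b then z (φ u) else 0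

/-- The common face of the two facets of `M` has a lift in `b` and one in `b'`. If either is not in
`S`, the two lifts of the point coincide; if both are, they are equivalent generators and the
required identification is a generating one. -/
theorem IsUnfolding.gluing_liftPoint (hM : IsNormalPseudomanifold (d + 1) M)
    (hU : IsUnfolding d M a B S φ H) {b b' : Finset ℕ} (hb : IsFacet (d + 1) B b)
    (hb' : IsFacet (d + 1) B b') {z : ℕ → ℝ} (hz : ∀ j, 0 ≤ z j) {σ : Finset ℕ}
    (hzσ : ∀ j, j ∉ σ → z j = 0) (hs : ∑ j ∈ σ, z j = 1)
    (hadj : Adjacent (d + 1) M σ (b.image φ) (b'.image φ)) :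
    gluing S (Setoid.ker φ) (liftPoint φ b z) (liftPoint φ b' z) := by
  by_cases hbb' : b = b'
  · subst hbb'; exact Setoid.refl' _ _
  obtain ⟨hg, hg', hσg, hσg', hc⟩ := hadj
  have hce : (b.image φ ∩ b'.image φ).card = d + 1 := by
    refine le_antisymm (Nat.lt_succ_iff.mp ?_) hc
    by_contra hlt
    have h1 : b.image φ ∩ b'.image φ = b.image φ :=
      eq_of_subset_of_card_le inter_subset_left (by rw [hg.2]; omega)
    have h2 : b.image φ ∩ b'.image φ = b'.image φ :=
      eq_of_subset_of_card_le inter_subset_right (by rw [hg'.2]; omega)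
    exact hbb' (hU.image_inj _ _ hb hb' (h1.symm.trans h2))
  have hFim : ∀ b b' : Finset ℕ, (b.filter fun u => φ u ∈ b'.image φ).image φ =
      b.image φ ∩ b'.image φ := by
    intro b b'
    ext j
    simp only [mem_image, mem_filter, mem_inter]
    constructor
    · rintro ⟨u, ⟨hu, hu'⟩, rfl⟩; exact ⟨⟨u, hu, rfl⟩, hu'⟩
    · rintro ⟨⟨u, hu, rfl⟩, hu'⟩; exact ⟨u, ⟨hu, hu'⟩, rfl⟩
  have hFinj : ∀ {b b' : Finset ℕ}, IsFacet (d + 1) B b →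
      Set.InjOn φ (b.filter fun u => φ u ∈ b'.image φ) := fun hb =>
    (hU.injOn hb.1).mono (coe_subset.mpr (filter_subset _ _))
  have hFc : ∀ {b b' : Finset ℕ}, IsFacet (d + 1) B b → (b.image φ ∩ b'.image φ).card = d + 1 →
      (b.filter fun u => φ u ∈ b'.image φ).card = d + 1 := fun hb hc => by
    rw [← card_image_iff.mpr (hFinj hb), hFim, hc]
  -- A face outside `S` lies in two distinct facets of `B`. Their images already exhaust the facets
  -- of `M` through the common face, so `b'` is one of the two.
  have hinterior : ∀ {b b' : Finset ℕ}, IsFacet (d + 1) B b → IsFacet (d + 1) B b' →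
      (b.image φ ∩ b'.image φ).card = d + 1 → σ ⊆ b.image φ ∩ b'.image φ →
      (b.filter fun u => φ u ∈ b'.image φ) ∉ S.faces → liftPoint φ b z = liftPoint φ b' z := by
    intro b b' hb hb' hce hσ hnot
    obtain ⟨b₁, b₂, hb₁, hb₂, hne, hf₁, hf₂⟩ :=
      hU.interior _ (B.down_closed _ hb.1 _ (filter_subset _ _)) (hFc hb hce) hnot
    have hfb' : (b.filter fun u => φ u ∈ b'.image φ) ⊆ b' := by
      rcases hM.at_most_two (b.image φ ∩ b'.image φ) hce _ _ _ (hU.image_facet b₁ hb₁)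
        (hU.image_facet b₂ hb₂) (hU.image_facet b' hb')
        (by rw [← hFim]; exact image_subset_image hf₁)
        (by rw [← hFim]; exact image_subset_image hf₂) inter_subset_right with h | h | h
      · exact absurd (hU.image_inj _ _ hb₁ hb₂ h) hne
      · exact hf₁.trans (hU.image_inj _ _ hb₁ hb' h).subset
      · exact hf₂.trans (hU.image_inj _ _ hb₂ hb' h).subset
    funext u
    by_cases hu0 : z (φ u) = 0
    · simp [liftPoint, hu0]
    · have hφu : φ u ∈ b.image φ ∩ b'.image φ := by
        by_contra h
        exact hu0 (hzσ _ fun h' => h (hσ h'))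
      have : u ∈ b ↔ u ∈ b' := by
        constructor
        · exact fun hu => hfb' (mem_filter.mpr ⟨hu, (mem_inter.mp hφu).2⟩)
        · intro hu
          rw [← hFim] at hφu
          obtain ⟨w, hw, hwu⟩ := mem_image.mp hφu
          rw [← hU.injOn hb'.1 (hfb' hw) hu hwu]
          exact (mem_filter.mp hw).1
      simp only [liftPoint, this]
  by_cases hf : (b.filter fun u => φ u ∈ b'.image φ) ∈ S.faces
  swap
  · rw [hinterior hb hb' hce (subset_inter hσg hσg') hf]
  by_cases hf' : (b'.filter fun u => φ u ∈ b.image φ) ∈ S.faces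
  swap
  · rw [hinterior hb' hb (by rwa [inter_comm]) (subset_inter hσg' hσg) hf']
  have hS := hU.sphere.isNormalPseudomanifold
  have hsupp : ∀ {b b' : Finset ℕ}, σ ⊆ b'.image φ → ∀ i,
      i ∉ (b.filter fun u => φ u ∈ b'.image φ) → liftPoint φ b z i = 0 := by
    intro b b' hσ i hi
    by_cases hib : i ∈ b
    · have : φ i ∉ σ := fun h => hi (mem_filter.mpr ⟨hib, hσ h⟩)
      simp [liftPoint, hzσ _ this]
    · simp [liftPoint, hib]
  have hreal : ∀ {b b' : Finset ℕ}, IsFacet (d + 1) B b → σ ⊆ b.image φ → σ ⊆ b'.image φ →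
      (b.filter fun u => φ u ∈ b'.image φ) ∈ S.faces → liftPoint φ b z ∈ S.realization := by
    intro b b' hb hσ hσ' hmem
    refine ⟨fun i => ?_, _, hmem, hsupp hσ', ?_⟩
    · unfold liftPoint; split_ifs
      · exact hz _
      · exact le_rfl
    · have h1 : ∑ i ∈ b.filter (fun u => φ u ∈ b'.image φ), liftPoint φ b z i =
          ∑ i ∈ b.filter (fun u => φ u ∈ b'.image φ), z (φ i) :=
        sum_congr rfl fun i hi => by simp only [liftPoint, (mem_filter.mp hi).1, if_true]
      rw [h1, ← sum_image (f := z) (hFinj hb), hFim]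
      exact sum_eq_one_of_subset (subset_inter hσ hσ') hzσ hs
  refine .rel _ _ ⟨_, _, IsFacet.isGenerator hS ⟨hf, hFc hb hce⟩,
    IsFacet.isGenerator hS ⟨hf', hFc hb' (by rwa [inter_comm])⟩,
    hreal hb hσg hσg' hf, hreal hb' hσg' hσg hf', hsupp hσg', hsupp hσg, ?_, ?_⟩
  · intro u hu
    obtain ⟨hu1, hu2⟩ := mem_filter.mp hu
    obtain ⟨v, hv, hvu⟩ := mem_image.mp hu2
    exact ⟨v, mem_filter.mpr ⟨hv, hvu ▸ mem_image_of_mem φ hu1⟩, hvu.symm⟩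
  · intro u hu v hv huv
    simp only [liftPoint, (mem_filter.mp hu).1, (mem_filter.mp hv).1, if_true]
    rw [Setoid.ker_def.mp huv]

theorem subset_biUnion_faces {K : StellarComplex} {σ : Finset ℕ} (hσ : σ ∈ K.faces) :
    σ ⊆ K.faces.biUnion id :=
  fun _ hx => mem_biUnion.mpr ⟨σ, hσ, hx⟩

/-- Subordination is one-sided, so `τ` may have vertices with no partner in `σ`. The matched
coordinates of `y` already sum to `1`, and nonnegativity makes the remaining ones vanish. -/
theorem IsUnfolding.pushforward_eq_of_corresponding (hU : IsUnfolding d M a B S φ H)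
    {σ τ : Finset ℕ} (hσ : σ ∈ S.faces) (hτ : τ ∈ S.faces) {x y : ℕ → ℝ}
    (h : Corresponding S (Setoid.ker φ) σ τ x y) :
    pushforward (B.faces.biUnion id) φ x = pushforward (B.faces.biUnion id) φ y := by
  obtain ⟨hx, hy, hxσ, hyτ, hsub, hval⟩ := h
  have hsum : ∀ {x σ}, x ∈ S.realization → (∀ i, i ∉ σ → x i = 0) → ∑ i ∈ σ, x i = 1 := by
    intro x σ hx hxσ
    obtain ⟨ρ, -, hρ, hs⟩ := exists_carrier hx
    refine sum_eq_one_of_subset (fun i hi => ?_)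
      (fun i hi => le_antisymm (not_lt.mp fun h => hi ((hρ i).mpr h)) (hx.1 i)) hs
    by_contra h
    exact ((hρ i).mp hi).ne' (hxσ i h)
  have hσB := hU.faces_subset hσ
  have hτB := hU.faces_subset hτ
  have hin : ∀ j ∈ σ.image φ, pushforward (B.faces.biUnion id) φ x j =
      pushforward (B.faces.biUnion id) φ y j := by
    intro j hj
    obtain ⟨u, hu, rfl⟩ := mem_image.mp hj
    obtain ⟨v, hv, huv⟩ := hsub u hu
    rw [pushforward_apply_of_mem (subset_biUnion_faces hσB) hxσ (hU.injOn hσB) hu, hval u hu v hv huv,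
      Setoid.ker_def.mp huv,
      pushforward_apply_of_mem (subset_biUnion_faces hτB) hyτ (hU.injOn hτB) hv]
  have himage : σ.image φ ⊆ τ.image φ := by
    intro j hj
    obtain ⟨u, hu, rfl⟩ := mem_image.mp hj
    obtain ⟨v, hv, huv⟩ := hsub u hu
    exact mem_image.mpr ⟨v, hv, (Setoid.ker_def.mp huv).symm⟩
  have h1 : ∑ j ∈ σ.image φ, pushforward (B.faces.biUnion id) φ y j = 1 := by
    rw [← sum_congr rfl hin,
      sum_image_pushforward (subset_biUnion_faces hσB) hxσ (hU.injOn hσB), hsum hx hxσ]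
  have h2 : ∑ j ∈ τ.image φ, pushforward (B.faces.biUnion id) φ y j = 1 := by
    rw [sum_image_pushforward (subset_biUnion_faces hτB) hyτ (hU.injOn hτB), hsum hy hyτ]
  have h3 : ∑ j ∈ τ.image φ \ σ.image φ, pushforward (B.faces.biUnion id) φ y j = 0 := by
    have := sum_sdiff (f := fun j => pushforward (B.faces.biUnion id) φ y j) himage
    linarith
  funext j
  by_cases hj : j ∈ σ.image φ
  · exact hin j hj
  · rw [pushforward_apply_of_notMem hxσ hj]
    by_cases hj' : j ∈ τ.image φ
    · exact ((sum_eq_zero_iff_of_nonneg fun i _ => pushforward_nonneg hy.1 i).mp h3 j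
        (mem_sdiff.mpr ⟨hj', hj⟩)).symm
    · rw [pushforward_apply_of_notMem hyτ hj']

/-- `P ∘ H` is a continuous surjection from a compact space to a Hausdorff one, so only its fibres
have to be matched with the gluing. The second claim holds since corresponding points of simplexes
of any dimension have the same image under `P`. -/
theorem IsUnfolding.isTriangulatedBy (hM : IsNormalPseudomanifold (d + 1) M)
    (hU : IsUnfolding d M a B S φ H)
    (hcov : ∀ g, IsFacet (d + 1) M g → ∃ b, IsFacet (d + 1) B b ∧ b.image φ = g) :
    IsTriangulatedBy M a S (Setoid.ker φ) ∧
      ∀ σ ∈ S.faces, ∀ τ ∈ S.faces, ∀ x y, Corresponding S (Setoid.ker φ) σ τ x y →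
        gluing S (Setoid.ker φ) x y := by
  have haS : ¬ S.IsVertex a := fun h => hU.apex (hU.faces_subset h)
  set P := pushforward (B.faces.biUnion id) φ with hP
  have hcarry : ∀ {x}, x ∈ B.realization → ∃ b, IsFacet (d + 1) B b ∧ (∀ i, i ∉ b → x i = 0) ∧
      ∑ i ∈ b, x i = 1 := by
    rintro x ⟨h0, σ, hσ, h1, h2⟩
    obtain ⟨b, hb, hσb⟩ := hU.exists_facet σ hσ
    exact ⟨b, hb, fun i hi => h1 i fun h => hi (hσb h), sum_eq_one_of_subset hσb h1 h2⟩
  have hmaps : Set.MapsTo P B.realization M.realization := by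
    intro x hx
    obtain ⟨b, hb, h1, h2⟩ := hcarry hx
    exact ⟨pushforward_nonneg hx.1, _, (hU.image_facet b hb).1,
      fun j hj => pushforward_apply_of_notMem h1 hj,
      by rw [sum_image_pushforward (subset_biUnion_faces hb.1) h1 (hU.injOn hb.1), h2]⟩
  have hlift : ∀ {x b}, IsFacet (d + 1) B b → (∀ i, i ∉ b → x i = 0) →
      liftPoint φ b (P x) = x := by
    intro x b hb hx
    funext u
    by_cases hu : u ∈ b
    · simp only [liftPoint, hu, if_true]
      exact pushforward_apply_of_mem (subset_biUnion_faces hb.1) hx (hU.injOn hb.1) hu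
    · simp [liftPoint, hu, hx u hu]
  have hsurj : Set.SurjOn P B.realization M.realization := by
    rintro z ⟨h0, σ, hσ, h1, h2⟩
    obtain ⟨g, hg, hσg⟩ := hM.exists_facet σ hσ
    obtain ⟨b, hb, rfl⟩ := hcov g hg
    have hsupp : ∀ i, i ∉ b → liftPoint φ b z i = 0 := fun i hi => by simp [liftPoint, hi]
    refine ⟨liftPoint φ b z, ⟨fun i => ?_, b, hb.1, hsupp, ?_⟩, ?_⟩
    · unfold liftPoint; split_ifs
      · exact h0 _
      · exact le_rfl
    · rw [sum_congr rfl fun i hi => show liftPoint φ b z i = z (φ i) by simp [liftPoint, hi],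
        ← sum_image (f := z) (hU.injOn hb.1)]
      exact sum_eq_one_of_subset hσg h1 h2
    · funext j
      by_cases hj : j ∈ b.image φ
      · obtain ⟨u, hu, rfl⟩ := mem_image.mp hj
        rw [hP, pushforward_apply_of_mem (subset_biUnion_faces hb.1) hsupp (hU.injOn hb.1) hu]
        simp [liftPoint, hu]
      · rw [hP, pushforward_apply_of_notMem hsupp hj, h1 j fun h => hj (hσg h)]
  have hglue : ∀ {x y}, x ∈ B.realization → y ∈ B.realization → P x = P y →
      gluing S (Setoid.ker φ) x y := by
    intro x y hx hy hxy
    obtain ⟨b, hb, hxb, -⟩ := hcarry hx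
    obtain ⟨b', hb', hyb, -⟩ := hcarry hy
    have hz := hmaps hx
    obtain ⟨σ, hσ, hpos, hs⟩ := exists_carrier hz
    have hσb : ∀ {w : ℕ → ℝ} {b : Finset ℕ}, (∀ i, i ∉ b → w i = 0) → P w = P x → σ ⊆ b.image φ := by
      intro w b hw hwx j hj
      by_contra hj'
      have h1 := (hpos j).mp hj
      rw [← hwx, hP, pushforward_apply_of_notMem hw hj'] at h1
      exact lt_irrefl _ h1
    have hzσ : ∀ j, j ∉ σ → P x j = 0 := fun j hj =>
      le_antisymm (not_lt.mp fun h => hj ((hpos j).mpr h)) (hz.1 j)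
    -- All facets of this chain contain the carrier of the image point, so the point lifts to each
    -- of their copies.
    have hchain := hM.chain σ _ _ (hU.image_facet b hb) (hU.image_facet b' hb') (hσb hxb rfl)
      (hσb hyb hxy.symm)
    have hall : ∀ g, Relation.ReflTransGen (Adjacent (d + 1) M σ) (b.image φ) g →
        ∀ c, IsFacet (d + 1) B c → c.image φ = g →
          gluing S (Setoid.ker φ) (liftPoint φ b (P x)) (liftPoint φ c (P x)) := by
      intro g hg
      induction hg with
      | refl =>
        intro c hc h
        rw [hU.image_inj _ _ hc hb h]
      | tail _ hst ih =>
        rintro c hc rfl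
        obtain ⟨e, he, rfl⟩ := hcov _ hst.1
        exact Setoid.trans' _ (ih e he rfl) (hU.gluing_liftPoint hM he hc hz.1 hzσ hs hst)
    have := hall _ hchain b' hb' rfl
    rw [hlift hb hxb, hxy, hlift hb' hyb] at this
    exact this
  have hPglue : ∀ {x y}, gluing S (Setoid.ker φ) x y → P x = P y := by
    intro x y h
    change Relation.EqvGen _ x y at h
    induction h with
    | rel _ _ h =>
      obtain ⟨g, p, hg, hp, h⟩ := h
      exact hU.pushforward_eq_of_corresponding hg.1 hp.1 h
    | refl => rfl
    | symm _ _ _ ih => exact ih.symm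
    | trans _ _ _ _ _ ih₁ ih₂ => exact ih₁.trans ih₂
  have hSB : S.realization ⊆ B.realization := realization_mono hU.faces_subset
  refine ⟨?_, fun σ hσ τ hτ x y h => hglue (hSB h.1) (hSB h.2.1)
    (hU.pushforward_eq_of_corresponding hσ hτ h)⟩
  have hPL : IsPLOn (P ∘ H) (cone a S).realization :=
    (isPLOn_linearMap P continuous_pushforward B.realization).comp hU.isPLOn hU.bijOn.mapsTo
  let f : (cone a S).realization → M.realization := fun x =>
    ⟨P (H x), hmaps (hU.bijOn.mapsTo x.2)⟩
  have hfc : Continuous f :=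
    Continuous.subtype_mk (continuousOn_iff_continuous_domRestrict.mp hPL.1) _
  have hfs : Function.Surjective f := by
    rintro ⟨z, hz⟩
    obtain ⟨y, hy, rfl⟩ := hsurj hz
    obtain ⟨x, hx, rfl⟩ := hU.bijOn.surjOn hy
    exact ⟨⟨x, hx⟩, rfl⟩
  have hSc : S.realization ⊆ (cone a S).realization := realization_mono faces_subset_cone
  have hfr : ∀ x y, f x = f y ↔
      ((gluing S (Setoid.ker φ)).comap (Subtype.val : (cone a S).realization → (ℕ → ℝ))) x y := by
    intro x y
    rw [Setoid.comap_rel]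
    constructor
    · intro h
      have h1 := hglue (hU.bijOn.mapsTo x.2) (hU.bijOn.mapsTo y.2) (congrArg Subtype.val h)
      -- The gluing was obtained between `H x` and `H y`. Distinct glued points lie in `S`, which
      -- `H` fixes, so injectivity of `H` carries the relation back to `x` and `y`.
      rcases gluing_eq_or_mem h1 with h2 | ⟨hx, hy⟩
      · rw [hU.bijOn.injOn x.2 y.2 h2]
      · rwa [hU.bijOn.injOn (hSc hx) x.2 (hU.eq_self _ hx),
          hU.bijOn.injOn (hSc hy) y.2 (hU.eq_self _ hy)] at h1
    · intro h
      apply Subtype.ext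
      change P (H x) = P (H y)
      rcases gluing_eq_or_mem h with h2 | ⟨hx, hy⟩
      · rw [h2]
      · rw [hU.eq_self _ hx, hU.eq_self _ hy, hPglue h]
  obtain ⟨e, he⟩ := nonempty_homeomorph_quotient hfc hfs hfr
  refine ⟨e, ?_⟩
  simp only [he]
  obtain ⟨hc, T, hT, hHT⟩ := hPL
  exact ⟨continuous_subtype_val.comp hfc, T, hT, fun x => hHT x x.2⟩

end Unfolding

theorem IsStellarManifold.exists_isTriangulatedBy {n : ℕ} (hn : 0 < n) {M : StellarComplex}
    (hM : IsStellarManifold n M) (hc : ConnectedSpace M.realization) :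
    ∃ (a : ℕ) (S : StellarComplex) (r : Setoid ℕ),
      IsStellarSphere (n - 1) S ∧ ¬ S.IsVertex a ∧ IsRegular S r ∧ IsTriangulatedBy M a S r ∧
      ∀ σ ∈ S.faces, ∀ τ ∈ S.faces, ∀ x y, Corresponding S r σ τ x y → gluing S r x y := by
  have hN := hM.isNormalPseudomanifold hn hc
  obtain ⟨d, rfl⟩ : ∃ d, n = d + 1 := ⟨n - 1, by omega⟩
  obtain ⟨a, B, S, φ, H, hU, hcov⟩ := exists_complete_unfolding hN
  exact ⟨a, S, Setoid.ker φ, hU.sphere, fun h => hU.apex (hU.faces_subset h), hU.isRegular hN,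
    hU.isTriangulatedBy hN hcov⟩

end StellarComplex

section

/-! ### Pushing squares off the centre of a cell -/

open Metric unitInterval

theorem continuous_of_continuousOn_closed_cover {X Y : Type*} [TopologicalSpace X]
    [TopologicalSpace Y] {f : X → Y} {s t : Set X} (hs : IsClosed s) (ht : IsClosed t)
    (hst : ∀ x, x ∈ s ∨ x ∈ t) (hfs : ContinuousOn f s) (hft : ContinuousOn f t) :
    Continuous f := by
  rw [← continuousOn_univ, ← Set.eq_univ_of_forall (s := s ∪ t) hst]
  exact hfs.union_of_isClosed hft hs ht

section PushOff

variable {E : Type*} [NormedAddCommGroup E] [NormedSpace ℝ E] [FiniteDimensional ℝ E]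

/-- The range of a smooth map from the plane to a space of larger dimension has dense complement, so
a smooth approximation can be translated by a small vector outside its range. -/
theorem exists_approx_ne_zero (hE : 2 < Module.finrank ℝ E) {w : I × I → E} (hw : Continuous w)
    {ε : ℝ} (hε : 0 < ε) :
    ∃ F : I × I → E, Continuous F ∧ ∀ z, ‖F z - w z‖ < ε ∧ F z ≠ 0 := by
  -- Clamping extends `w` to a uniformly continuous map of the whole plane, which can be smoothed.
  -- Smoothing and translation each use `ε / 2`.
  let π : ℝ × ℝ → I × I := Prod.map (Set.projIcc 0 1 zero_le_one) (Set.projIcc 0 1 zero_le_one)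
  have hπ : UniformContinuous π :=
    (LipschitzWith.projIcc zero_le_one).uniformContinuous.prodMap
      (LipschitzWith.projIcc zero_le_one).uniformContinuous
  have hwu : UniformContinuous w := CompactSpace.uniformContinuous_of_continuous hw
  obtain ⟨g, hg, hgw⟩ := (hwu.comp hπ).exists_contDiff_dist_le (half_pos hε)
  have hdense := ContDiff.dense_compl_range_of_finrank_lt_finrank (f := g)
    (hg.of_le (by simp)) (by simpa using hE)
  obtain ⟨c, hc, hcε⟩ := hdense.exists_mem_open isOpen_ball
    ⟨0, mem_ball_self (x := (0 : E)) (half_pos hε)⟩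
  refine ⟨fun z => g (z.1, z.2) - c, ?_, fun z => ⟨?_, ?_⟩⟩
  · have := hg.continuous
    fun_prop
  · have h1 := hgw (z.1, z.2)
    have h2 : π ((z.1 : ℝ), (z.2 : ℝ)) = z := by simp [π, Set.projIcc_val]
    rw [Function.comp_apply, h2, dist_eq_norm, norm_sub_rev] at h1
    rw [mem_ball_zero_iff] at hcε
    calc ‖g (z.1, z.2) - c - w z‖ = ‖(g (z.1, z.2) - w z) - c‖ := by congr 1; abel
      _ ≤ ‖g (z.1, z.2) - w z‖ + ‖c‖ := norm_sub_le _ _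
      _ < ε := by rw [norm_sub_rev] at h1; linarith [hgw (z.1, z.2)]
  · exact sub_ne_zero.mpr fun h => hc ⟨_, h⟩

theorem continuousOn_invFunOn {X Y : Type*} [TopologicalSpace X] [TopologicalSpace Y] [T2Space Y]
    [Nonempty X] {j : X → Y} {s : Set X} (hs : IsCompact s) (hj : ContinuousOn j s)
    (hinj : Set.InjOn j s) : ContinuousOn (Function.invFunOn j s) (j '' s) := by
  rw [continuousOn_iff_isClosed]
  intro t ht
  refine ⟨j '' (t ∩ s), ((hs.inter_left ht).image_of_continuousOn
    (hj.mono Set.inter_subset_right)).isClosed, ?_⟩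
  ext y
  constructor
  · rintro ⟨hy, x, hx, rfl⟩
    rw [Set.mem_preimage, hinj.leftInvOn_invFunOn hx] at hy
    exact ⟨⟨x, ⟨hy, hx⟩, rfl⟩, x, hx, rfl⟩
  · rintro ⟨⟨x, ⟨hxt, hx⟩, rfl⟩, -⟩
    exact ⟨by rwa [Set.mem_preimage, hinj.leftInvOn_invFunOn hx], x, hx, rfl⟩

/-- A square in a space can be pushed off the centre of a cell of dimension greater than two. -/
theorem exists_pushOff {X : Type*} [TopologicalSpace X] [T2Space X]
    (hE : 2 < Module.finrank ℝ E) {j : E → X} (hj : ContinuousOn j (closedBall 0 1))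
    (hinj : Set.InjOn j (closedBall 0 1)) (hopen : IsOpen (j '' ball 0 1)) {f : I × I → X}
    (hf : Continuous f) :
    ∃ G : I × (I × I) → X, Continuous G ∧ (∀ z, G (0, z) = f z) ∧ (∀ z, G (1, z) ≠ j 0) ∧
      ∀ s z, f z ∉ j '' ball 0 1 → G (s, z) = f z := by
  classical
  let C : Set X := j '' closedBall 0 1
  let k : X → E := Function.invFunOn j (closedBall 0 1)
  have hkj : ∀ {e}, e ∈ closedBall (0 : E) 1 → k (j e) = e := fun he =>
    hinj.leftInvOn_invFunOn he
  have hk : ContinuousOn k C := continuousOn_invFunOn (isCompact_closedBall _ _) hj hinj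
  have hC : IsClosed C := ((isCompact_closedBall _ _).image_of_continuousOn hj).isClosed
  have hcover : ∀ p, p ∈ C ∨ p ∈ (j '' ball (0 : E) 1)ᶜ := fun p => by
    by_cases h : p ∈ j '' ball (0 : E) 1
    · exact Or.inl (Set.image_mono ball_subset_closedBall h)
    · exact Or.inr h
  -- The radius in the cell, extended by `1` outside it.
  let ν : X → ℝ := fun p => if p ∈ C then ‖k p‖ else 1
  have hν1 : ∀ p, p ∉ j '' ball (0 : E) 1 → ν p = 1 := by
    intro p hp
    by_cases hpC : p ∈ C
    · obtain ⟨e, he, rfl⟩ := hpC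
      have h1 : e ∉ ball (0 : E) 1 := fun h => hp ⟨e, h, rfl⟩
      simp only [ν, show j e ∈ C from ⟨e, he, rfl⟩, if_true, hkj he]
      rw [mem_ball_zero_iff, not_lt] at h1
      rw [mem_closedBall_zero_iff] at he
      exact le_antisymm he h1
    · simp only [ν, hpC, if_false]
  have hνc : Continuous ν := by
    refine continuous_of_continuousOn_closed_cover hC hopen.isClosed_compl hcover ?_ ?_
    · exact hk.norm.congr fun p hp => if_pos hp
    · exact continuousOn_const.congr fun p hp => hν1 p hp
  -- The factor is `1` for `ν ≤ 1 / 2` and `0` for `ν = 1`: the cell coordinate is kept on the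
  -- half-size cell and damped to extend by zero over all of `X`.
  let μ : X → E := fun p => if p ∈ C then min 1 (2 - 2 * ν p) • k p else 0
  have hμc : Continuous μ := by
    refine continuous_of_continuousOn_closed_cover hC hopen.isClosed_compl hcover ?_ ?_
    · refine ContinuousOn.congr (f := fun p => min 1 (2 - 2 * ν p) • k p) ?_ fun p hp => if_pos hp
      have : Continuous fun p => min 1 (2 - 2 * ν p) := by fun_prop
      exact this.continuousOn.smul hk
    · refine continuousOn_const (c := (0 : E)).congr fun p hp => ?_
      simp [μ, hν1 p hp]
  have hνC : ∀ {p}, ν p ≤ 1 / 2 → p ∈ C := by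
    intro p hp
    by_contra h
    simp only [ν, h, if_false] at hp
    norm_num at hp
  have hμ : ∀ {p}, ν p ≤ 1 / 2 → μ p = k p ∧ ‖μ p‖ = ν p ∧ j (μ p) = p := by
    intro p hp
    have hpC := hνC hp
    have h1 : μ p = k p := by
      simp only [μ, hpC, if_true]
      rw [min_eq_left (by linarith), one_smul]
    refine ⟨h1, ?_, ?_⟩
    · rw [h1]; simp only [ν, hpC, if_true]
    · rw [h1]
      obtain ⟨e, he, rfl⟩ := hpC
      rw [hkj he]
  -- The tolerance `1 / 8` keeps points of radius at most `1 / 2` inside the cell and cannot bring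
  -- points of radius above `1 / 4` to the centre.
  obtain ⟨F, hFc, hF⟩ := exists_approx_ne_zero hE (hμc.comp hf) (show (0 : ℝ) < 1 / 8 by norm_num)
  -- Equal to `1` for `ν ≤ 1 / 4` and to `0` for `ν ≥ 1 / 2`: near the centre the homotopy ends at
  -- `F`, and at radius `1 / 2` it is constant.
  let χ : X → ℝ := fun p => max 0 (min 1 (2 - 4 * ν p))
  have hχc : Continuous χ := by fun_prop
  have hχ0 : ∀ p, 0 ≤ χ p := fun p => le_max_left _ _
  have hχ1 : ∀ p, χ p ≤ 1 := fun p => max_le zero_le_one (min_le_left _ _)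
  let h : I × (I × I) → E := fun q =>
    μ (f q.2) + ((q.1 : ℝ) * χ (f q.2)) • (F q.2 - μ (f q.2))
  have hhc : Continuous h := by fun_prop
  have hsmall : ∀ q : I × (I × I), ‖((q.1 : ℝ) * χ (f q.2)) • (F q.2 - μ (f q.2))‖ < 1 / 8 := by
    intro q
    rw [norm_smul, Real.norm_of_nonneg (mul_nonneg q.1.2.1 (hχ0 _))]
    have h1 : (q.1 : ℝ) * χ (f q.2) ≤ 1 := mul_le_one₀ q.1.2.2 (hχ0 _) (hχ1 _)
    have h2 := (hF q.2).1
    calc _ ≤ 1 * ‖F q.2 - μ (f q.2)‖ := by gcongr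
      _ < 1 / 8 := by rw [one_mul]; exact h2
  have hball : ∀ q : I × (I × I), ν (f q.2) ≤ 1 / 2 → h q ∈ closedBall (0 : E) 1 := by
    intro q hq
    rw [mem_closedBall_zero_iff]
    have h1 := norm_add_le (μ (f q.2)) (((q.1 : ℝ) * χ (f q.2)) • (F q.2 - μ (f q.2)))
    have h2 := hsmall q
    have h3 := (hμ hq).2.1
    change ‖μ (f q.2) + _‖ ≤ 1
    linarith
  have hedge : ∀ q : I × (I × I), ν (f q.2) = 1 / 2 → j (h q) = f q.2 := by
    intro q hq
    have h1 : χ (f q.2) = 0 := by simp only [χ, hq]; norm_num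
    simp only [h, h1, mul_zero, zero_smul, add_zero]
    exact (hμ hq.le).2.2
  let G : I × (I × I) → X := fun q => if 1 / 2 ≤ ν (f q.2) then f q.2 else j (h q)
  refine ⟨G, ?_, fun z => ?_, fun z => ?_, fun s z hz => ?_⟩
  · refine continuous_of_continuousOn_closed_cover
      (s := {q | 1 / 2 ≤ ν (f q.2)}) (t := {q | ν (f q.2) ≤ 1 / 2})
      (isClosed_le continuous_const (by fun_prop)) (isClosed_le (by fun_prop) continuous_const)
      (fun q => le_total (1 / 2) (ν (f q.2))) ?_ ?_
    · refine ContinuousOn.congr (f := fun q : I × (I × I) => f q.2) (by fun_prop) fun q hq => ?_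
      have hq' : 1 / 2 ≤ ν (f q.2) := hq
      simp only [G, hq', if_true]
    · refine (hj.comp hhc.continuousOn fun q hq => hball q hq).congr fun q hq => ?_
      by_cases hq' : 1 / 2 ≤ ν (f q.2)
      · simp only [G, hq', if_true, Function.comp_apply]
        exact (hedge q (le_antisymm hq hq')).symm
      · simp only [G, hq', if_false, Function.comp_apply]
  · by_cases hz : 1 / 2 ≤ ν (f z)
    · simp only [G, hz, if_true]
    · simp only [G, hz, if_false, h]
      simpa using (hμ (not_le.mp hz).le).2.2
  · by_cases hz : 1 / 2 ≤ ν (f z)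
    · simp only [G, hz, if_true]
      intro h0
      have h1 : j 0 ∈ C := ⟨0, by simp, rfl⟩
      rw [h0] at hz
      simp only [ν, h1, if_true, hkj (e := 0) (by simp)] at hz
      norm_num at hz
    · simp only [G, hz, if_false]
      have hz' := (not_le.mp hz).le
      intro h0
      have h1 := hinj (hball (1, z) hz') (by simp) h0
      by_cases hz4 : ν (f z) ≤ 1 / 4
      · have h2 : χ (f z) = 1 := by
          simp only [χ]
          rw [min_eq_left (by linarith), max_eq_right zero_le_one]
        simp only [h, h2] at h1
        apply (hF z).2
        simpa using h1
      · have h2 := hsmall (1, z)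
        have h3 := (hμ hz').2.1
        have h4 : μ (f z) = -((((1 : I) : ℝ) * χ (f z)) • (F z - μ (f z))) :=
          eq_neg_of_add_eq_zero_left h1
        rw [h4, norm_neg] at h3
        push Not at hz4
        simp only at h2
        linarith
  · have := hν1 _ hz
    simp only [G, this]
    norm_num

end PushOff

end

section

/-! ### Fundamental groups of complements and homeomorphic spaces -/

open unitInterval

/-- If `X` retracts by deformation onto `Y` away from a point that squares can be pushed off,
then the inclusion of `Y` induces an isomorphism of fundamental groups. -/
theorem FundamentalGroup.map_bijective_of_pushOff {X Y : Type*} [TopologicalSpace X]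
    [TopologicalSpace Y] (i : C(Y, X)) (c : X) (hic : ∀ y, i y ≠ c) {ρ : {p : X // p ≠ c} → Y}
    (hρ : Continuous ρ) (hρi : ∀ y, ρ ⟨i y, hic y⟩ = y) {K : {p : X // p ≠ c} × I → X}
    (hK : Continuous K) (hK0 : ∀ p, K (p, 0) = p) (hK1 : ∀ p, K (p, 1) = i (ρ p))
    (hKi : ∀ y s, K (⟨i y, hic y⟩, s) = i y)
    (hpush : ∀ f : I × I → X, Continuous f → ∃ G : I × (I × I) → X, Continuous G ∧
      (∀ z, G (0, z) = f z) ∧ (∀ z, G (1, z) ≠ c) ∧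
      ∀ s z, f z ∈ Set.range i → G (s, z) = f z) (y : Y) :
    Function.Bijective (FundamentalGroup.map i y) := by
  constructor
  · intro p q h
    obtain ⟨γ₁, rfl⟩ := Path.Homotopic.Quotient.mk_surjective p
    obtain ⟨γ₂, rfl⟩ := Path.Homotopic.Quotient.mk_surjective q
    have h' : Path.Homotopic.Quotient.mk (γ₁.map i.continuous) =
        Path.Homotopic.Quotient.mk (γ₂.map i.continuous) := h
    obtain ⟨F⟩ := Path.Homotopic.Quotient.eq.mp h'
    -- All four sides of the homotopy lie in the range of `i`, so the push fixes them; applying `ρ`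
    -- then gives a homotopy in `Y`.
    obtain ⟨G, hG, -, hG1, hGi⟩ := hpush F F.continuous
    have hval : ∀ z y', F z = i y' → ρ ⟨G (1, z), hG1 z⟩ = y' := by
      intro z y' hz
      have : (⟨G (1, z), hG1 z⟩ : {p : X // p ≠ c}) = ⟨i y', hic y'⟩ :=
        Subtype.ext ((hGi 1 z ⟨y', hz.symm⟩).trans hz)
      rw [this, hρi]
    refine Path.Homotopic.Quotient.eq.mpr ⟨⟨⟨⟨fun z => ρ ⟨G (1, z), hG1 z⟩, ?_⟩, ?_, ?_⟩, ?_⟩⟩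
    · exact hρ.comp (Continuous.subtype_mk (by fun_prop) _)
    · intro t
      exact hval _ _ (by simp)
    · intro t
      exact hval _ _ (by simp)
    · intro s t ht
      rcases ht with rfl | rfl
      · exact (hval _ y (by simp)).trans γ₁.source.symm
      · exact (hval _ y (by simp)).trans γ₁.target.symm
  · intro p
    obtain ⟨γ, rfl⟩ := Path.Homotopic.Quotient.mk_surjective p
    -- The loop is treated as a square constant in the second variable, and only the slice at `0` is
    -- used. Once it avoids `c`, the deformation `K` carries it into `Y`.
    obtain ⟨G, hG, hG0, hG1, hGi⟩ := hpush (fun z => γ z.1) (by fun_prop)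
    have hend : ∀ t, γ t = i y → ∀ s, G (s, (t, 0)) = i y := by
      intro t ht s
      exact (hGi s (t, 0) ⟨y, ht.symm⟩).trans ht
    let γU : I → {p : X // p ≠ c} := fun t => ⟨G (1, (t, 0)), hG1 _⟩
    have hγU : Continuous γU := Continuous.subtype_mk (by fun_prop) _
    have hγUe : ∀ t, γ t = i y → γU t = ⟨i y, hic y⟩ := fun t ht => Subtype.ext (hend t ht 1)
    let γ' : Path (i y) (i y) := ⟨⟨fun t => γU t, by fun_prop⟩,
      by simp [hγUe 0 γ.source], by simp [hγUe 1 γ.target]⟩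
    let δ : Path y y := ⟨⟨fun t => ρ (γU t), hρ.comp hγU⟩,
      by simp [hγUe 0 γ.source, hρi], by simp [hγUe 1 γ.target, hρi]⟩
    have h1 : γ.Homotopic γ' := by
      refine ⟨⟨⟨⟨fun z => G (z.1, (z.2, 0)), by fun_prop⟩, ?_, ?_⟩, ?_⟩⟩
      · intro t; exact hG0 _
      · intro t; rfl
      · intro s t ht
        rcases ht with rfl | rfl
        · exact (hend 0 γ.source s).trans γ.source.symm
        · exact (hend 1 γ.target s).trans γ.target.symm
    have h2 : γ'.Homotopic (δ.map i.continuous) := by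
      refine ⟨⟨⟨⟨fun z => K (γU z.2, z.1), by fun_prop⟩, ?_, ?_⟩, ?_⟩⟩
      · intro t; exact hK0 _
      · intro t; exact hK1 _
      · intro s t ht
        have hboth : ∀ t, γ t = i y → K (γU t, s) = γU t := fun t h => by
          rw [hγUe t h, hKi]
        rcases ht with rfl | rfl
        · exact hboth 0 γ.source
        · exact hboth 1 γ.target
    refine ⟨(Path.Homotopic.Quotient.mk δ : Path.Homotopic.Quotient y y), ?_⟩
    exact Path.Homotopic.Quotient.eq.mpr (h1.trans h2).symm

/-- Homeomorphic spaces have isomorphic fundamental groups. -/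
theorem FundamentalGroup.map_bijective_of_homeomorph {X Y : Type*} [TopologicalSpace X]
    [TopologicalSpace Y] (e : X ≃ₜ Y) (x : X) :
    Function.Bijective (FundamentalGroup.map (e : C(X, Y)) x) := by
  constructor
  · intro p q h
    obtain ⟨γ₁, rfl⟩ := Path.Homotopic.Quotient.mk_surjective p
    obtain ⟨γ₂, rfl⟩ := Path.Homotopic.Quotient.mk_surjective q
    have h' : Path.Homotopic.Quotient.mk (γ₁.map e.continuous) =
        Path.Homotopic.Quotient.mk (γ₂.map e.continuous) := h
    obtain ⟨F⟩ := Path.Homotopic.Quotient.eq.mp h'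
    refine Path.Homotopic.Quotient.eq.mpr
      ⟨⟨⟨⟨fun z => e.symm (F z), by fun_prop⟩, ?_, ?_⟩, ?_⟩⟩
    · intro t; simp
    · intro t; simp
    · intro s t ht
      rcases ht with rfl | rfl <;> simp
  · intro p
    obtain ⟨γ, rfl⟩ := Path.Homotopic.Quotient.mk_surjective p
    let δ : Path x x := ⟨⟨fun t => e.symm (γ t), by fun_prop⟩, by simp, by simp⟩
    refine ⟨(Path.Homotopic.Quotient.mk δ : Path.Homotopic.Quotient x x), ?_⟩
    have : δ.map e.continuous = γ := by
      ext t; simp [δ]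
    exact congrArg Path.Homotopic.Quotient.mk this

end

namespace StellarComplex

/-! ### Stellar spheres as topological spheres, and cone coordinates -/

open Finset Metric unitInterval

/-- The direction of a point of the boundary of a simplex as seen from the barycentre. -/
def sphereDirection (n : ℕ) (x : ℕ → ℝ) (i : Fin n) : ℝ := x (i + 1) - x 0

theorem exists_eq_zero_of_mem_boundary {A : Finset ℕ} (hA : A.Nonempty) {x : ℕ → ℝ}
    (hx : x ∈ (boundary A).realization) :
    (∃ k ∈ A, x k = 0) ∧ (∀ i, i ∉ A → x i = 0) ∧ ∑ i ∈ A, x i = 1 := by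
  obtain ⟨-, τ, hτ, h1, h2⟩ := hx
  rw [mem_boundary hA] at hτ
  refine ⟨?_, fun i hi => h1 i fun h => hi (hτ.1 h), sum_eq_one_of_subset hτ.1 h1 h2⟩
  have : ¬ A ⊆ τ := fun h => hτ.2 (Subset.antisymm hτ.1 h)
  obtain ⟨k, hk, hkτ⟩ := not_subset.mp this
  exact ⟨k, hk, h1 k hkτ⟩

/-- Radial projection from the barycentre. The differences `x (i + 1) - x 0` determine `x` up to an
additive constant, which on the boundary is fixed by the requirement that the least coordinate be
zero. -/
theorem boundary_range_homeomorph_sphere (n : ℕ) :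
    Nonempty ((boundary (range (n + 1))).realization ≃ₜ sphere (0 : Fin n → ℝ) 1) := by
  have hne : (range (n + 1)).Nonempty := ⟨0, by simp⟩
  have hcoord : ∀ {x : ℕ → ℝ} {w : Fin n → ℝ}, sphereDirection n x = w →
      ∀ k (hk : k + 1 ∈ range (n + 1)), x (k + 1) - x 0 = w ⟨k, by simpa using hk⟩ := by
    rintro x w rfl k hk
    rfl
  have hne0 : ∀ {x}, x ∈ (boundary (range (n + 1))).realization → sphereDirection n x ≠ 0 := by
    intro x hx h0
    obtain ⟨⟨k, hk, hk0⟩, -, hs⟩ := exists_eq_zero_of_mem_boundary hne hx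
    have hconst : ∀ i ∈ range (n + 1), x i = x 0 := by
      intro i hi
      cases i with
      | zero => rfl
      | succ i => have := hcoord h0 i hi; simp only [Pi.zero_apply] at this; linarith
    have hx0 : x 0 = 0 := by rw [← hconst k hk, hk0]
    rw [sum_eq_zero fun i hi => by rw [hconst i hi, hx0]] at hs
    exact zero_ne_one hs
  refine nonempty_homeomorph_of_bijOn (isCompact_realization _)
    (f := fun x => ‖sphereDirection n x‖⁻¹ • sphereDirection n x) ?_ ⟨?_, ?_, ?_⟩
  · have hc : Continuous (sphereDirection n) := by
      unfold sphereDirection; fun_prop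
    exact (hc.norm.continuousOn.inv₀ fun x hx => norm_ne_zero_iff.mpr (hne0 hx)).smul
      hc.continuousOn
  · intro x hx
    rw [mem_sphere_zero_iff_norm, norm_smul, norm_inv, norm_norm,
      inv_mul_cancel₀ (norm_ne_zero_iff.mpr (hne0 hx))]
  · intro x hx y hy hxy
    simp only at hxy
    have hxn : 0 < ‖sphereDirection n x‖ := norm_pos_iff.mpr (hne0 hx)
    have hyn : 0 < ‖sphereDirection n y‖ := norm_pos_iff.mpr (hne0 hy)
    set t := ‖sphereDirection n x‖ * ‖sphereDirection n y‖⁻¹ with ht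
    have htpos : 0 < t := by positivity
    have hW : sphereDirection n x = t • sphereDirection n y := by
      rw [ht, mul_smul, ← hxy, smul_smul, mul_inv_cancel₀ hxn.ne', one_smul]
    obtain ⟨⟨k, hk, hk0⟩, hxout, hxs⟩ := exists_eq_zero_of_mem_boundary hne hx
    obtain ⟨⟨l, hl, hl0⟩, hyout, hys⟩ := exists_eq_zero_of_mem_boundary hne hy
    -- This constant is at most `0` at a zero of `x` and at least `0` at a zero of `y`, so it
    -- vanishes. Then `x = t y` on the simplex, and equal coordinate sums give `x = y`.
    have hconst : ∀ i ∈ range (n + 1), x i - t * y i = x 0 - t * y 0 := by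
      intro i hi
      cases i with
      | zero => rfl
      | succ i =>
        have := hcoord hW i hi
        simp only [Pi.smul_apply, sphereDirection, smul_eq_mul] at this
        linarith
    have h1 := hconst k hk
    have h2 := hconst l hl
    rw [hk0] at h1
    rw [hl0] at h2
    have h3 := mul_nonneg htpos.le (hy.1 k)
    have h4 := hx.1 l
    have h5 : x 0 - t * y 0 = 0 := by linarith
    have h6 : ∀ i ∈ range (n + 1), x i = t * y i := fun i hi => by linarith [hconst i hi]
    rw [sum_congr rfl h6, ← mul_sum, hys, mul_one] at hxs
    funext i
    by_cases hi : i ∈ range (n + 1)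
    · rw [h6 i hi, hxs, one_mul]
    · rw [hxout i hi, hyout i hi]
  · intro e he
    rw [mem_sphere_zero_iff_norm] at he
    -- The vector `e` with a zeroth coordinate `0` prefixed. Subtracting the least coordinate and
    -- dividing by the sum moves it to the boundary of the simplex.
    let y : ℕ → ℝ := fun k => if h : 0 < k ∧ k < n + 1 then e ⟨k - 1, by omega⟩ else 0
    obtain ⟨m, hm, hmin⟩ := exists_mem_eq_inf' hne y
    have hle : ∀ k ∈ range (n + 1), y m ≤ y k := fun k hk => hmin ▸ inf'_le _ hk
    let z : ℕ → ℝ := fun k => if k ∈ range (n + 1) then y k - y m else 0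
    have hz0 : ∀ k, 0 ≤ z k := by
      intro k
      by_cases hk : k ∈ range (n + 1)
      · simp only [z, hk, if_true]
        linarith [hle k hk]
      · simp only [z, hk, if_false, le_refl]
    have hzW : sphereDirection n z = e := by
      funext i
      have h1 : (i : ℕ) + 1 ∈ range (n + 1) := by simp
      have h2 : 0 ∈ range (n + 1) := by simp
      simp only [sphereDirection, z, h1, h2, if_true]
      simp [y]
    set s := ∑ k ∈ range (n + 1), z k with hs
    have hspos : 0 < s := by
      refine lt_of_le_of_ne (sum_nonneg fun k _ => hz0 k) fun h => ?_
      have hall := (sum_eq_zero_iff_of_nonneg fun k _ => hz0 k).mp h.symm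
      have : e = 0 := by
        rw [← hzW]
        funext i
        simp only [sphereDirection, Pi.zero_apply]
        rw [hall _ (by simp), hall 0 (by simp), sub_zero]
      rw [this, norm_zero] at he
      exact zero_ne_one he
    refine ⟨fun k => s⁻¹ * z k, ⟨fun k => mul_nonneg (inv_nonneg.mpr hspos.le) (hz0 k),
      (range (n + 1)).erase m, (mem_boundary hne).mpr ⟨erase_subset _ _, fun h => ?_⟩, ?_, ?_⟩, ?_⟩
    · rw [← h] at hm
      simp at hm
    · intro i hi
      by_cases hir : i ∈ range (n + 1)
      · have : i = m := by
          by_contra him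
          exact hi (mem_erase.mpr ⟨him, hir⟩)
        subst this
        simp [z]
      · simp only [z, hir, if_false, mul_zero]
    · have : z m = 0 := by simp [z]
      rw [← mul_sum, sum_erase _ this, ← hs, inv_mul_cancel₀ hspos.ne']
    · have h1 : sphereDirection n (fun k => s⁻¹ * z k) = s⁻¹ • e := by
        rw [← hzW]
        funext i
        simp only [sphereDirection, Pi.smul_apply, smul_eq_mul]
        ring
      simp only [h1]
      rw [norm_smul, he, mul_one, norm_inv, Real.norm_of_nonneg hspos.le, inv_inv, smul_smul,
        mul_inv_cancel₀ hspos.ne', one_smul]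

theorem IsStellarSphere.nonempty_homeomorph_sphere {d : ℕ} {S : StellarComplex}
    (hS : IsStellarSphere d S) :
    Nonempty (sphere (0 : Fin (d + 1) → ℝ) 1 ≃ₜ S.realization) := by
  obtain ⟨e⟩ := StellarEquiv.nonempty_homeomorph hS
  obtain ⟨f⟩ := boundary_range_homeomorph_sphere (d + 1)
  exact ⟨(e.trans f).symm⟩

/-- The point of the cone with apex `a` that divides the segment from `a` to `y`. -/
def conePoint (a : ℕ) (t : ℝ) (y : ℕ → ℝ) (i : ℕ) : ℝ := if i = a then 1 - t else t * y i

section Cone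

variable {a : ℕ} {S : StellarComplex}

theorem conePoint_mem {t : ℝ} (ht0 : 0 ≤ t) (ht1 : t ≤ 1) {y : ℕ → ℝ} (ha : ¬ S.IsVertex a)
    (hy : y ∈ S.realization) : conePoint a t y ∈ (cone a S).realization := by
  obtain ⟨h0, τ, hτ, h1, h2⟩ := hy
  have haτ : a ∉ τ := fun h => ha (isVertex_of_mem hτ h)
  refine ⟨fun i => ?_, insert a τ, ?_, fun i hi => ?_, ?_⟩
  · unfold conePoint; split_ifs
    · linarith
    · exact mul_nonneg ht0 (h0 i)
  · rw [mem_cone, erase_insert haτ]; exact hτ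
  · rw [mem_insert, not_or] at hi
    simp [conePoint, hi.1, h1 i hi.2]
  · rw [sum_insert haτ, sum_congr rfl fun i hi => show conePoint a t y i = t * y i from
      if_neg (show i ≠ a from fun e => haτ (e ▸ hi)), ← mul_sum, h2]
    simp [conePoint]

theorem coneBase_mem {x : ℕ → ℝ} (hx : x ∈ (cone a S).realization)
    (hxa : x a ≠ 1) : (fun i => if i = a then 0 else x i / (1 - x a)) ∈ S.realization := by
  have hlt : 0 < 1 - x a := by
    have := realization_apply_le_one hx a
    exact sub_pos.mpr (lt_of_le_of_ne this hxa)
  obtain ⟨h0, τ, hτ, h1, h2⟩ := hx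
  rw [mem_cone] at hτ
  refine ⟨fun i => ?_, _, hτ, fun i hi => ?_, ?_⟩
  · dsimp only; split_ifs
    · exact le_rfl
    · exact div_nonneg (h0 i) hlt.le
  · by_cases hia : i = a
    · simp [hia]
    · simp [hia, h1 i fun h => hi (mem_erase.mpr ⟨hia, h⟩)]
  · rw [sum_congr rfl fun i hi => if_neg (ne_of_mem_erase hi), ← sum_div, div_eq_one_iff_eq hlt.ne']
    by_cases haτ : a ∈ τ
    · rw [← h2, ← add_sum_erase τ x haτ]; ring
    · rw [erase_eq_of_notMem haτ, h2, h1 a haτ, sub_zero]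

open Classical in
/-- The projection of the cone from its apex to its base; the apex goes to `y₀`. -/
noncomputable def coneBase (y₀ : S.realization) (x : (cone a S).realization) : S.realization :=
  if h : (x : ℕ → ℝ) a ≠ 1 then ⟨_, coneBase_mem x.2 h⟩ else y₀

variable (y₀ : S.realization)

theorem coneBase_apply {x : (cone a S).realization} (hx : (x : ℕ → ℝ) a ≠ 1) (i : ℕ) :
    (coneBase y₀ x : ℕ → ℝ) i = if i = a then 0 else (x : ℕ → ℝ) i / (1 - (x : ℕ → ℝ) a) := by
  rw [coneBase, dif_pos hx]

theorem conePoint_coneBase (x : (cone a S).realization) :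
    conePoint a (1 - (x : ℕ → ℝ) a) (coneBase y₀ x) = x := by
  funext i
  by_cases hia : i = a
  · simp [conePoint, hia]
  · rw [conePoint, if_neg hia]
    by_cases hx : (x : ℕ → ℝ) a = 1
    · rw [hx, sub_self, zero_mul]
      obtain ⟨h0, τ, hτ, h1, h2⟩ := x.2
      have haτ : a ∈ τ := by
        by_contra h
        rw [h1 a h] at hx
        exact zero_ne_one hx
      by_cases hi : i ∈ τ
      · rw [← add_sum_erase τ _ haτ, hx] at h2
        exact ((sum_eq_zero_iff_of_nonneg fun i _ => h0 i).mp (by linarith) i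
          (mem_erase.mpr ⟨hia, hi⟩)).symm
      · exact (h1 i hi).symm
    · rw [coneBase_apply y₀ hx, if_neg hia, mul_div_cancel₀]
      exact sub_ne_zero.mpr (Ne.symm hx)

theorem coneBase_of_mem (ha : ¬ S.IsVertex a) {x : (cone a S).realization}
    (hx : (x : ℕ → ℝ) ∈ S.realization) :
    (coneBase y₀ x : ℕ → ℝ) = x := by
  have hxa := realization_apply_eq_zero hx ha
  funext i
  rw [coneBase_apply y₀ (by rw [hxa]; exact zero_ne_one)]
  by_cases hia : i = a
  · rw [if_pos hia, hia, hxa]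
  · rw [if_neg hia, hxa, sub_zero, div_one]

theorem conePoint_one (ha : ¬ S.IsVertex a) {y : ℕ → ℝ} (hy : y ∈ S.realization) : conePoint a 1 y = y := by
  funext i
  by_cases hia : i = a
  · rw [hia, realization_apply_eq_zero hy ha]; simp [conePoint]
  · simp [conePoint, hia]

end Cone

/-- Handles the apex of the cone, where the direction `u` need not be continuous but is multiplied
by a factor tending to zero. -/
theorem continuous_mul_of_bounded {E : Type*} [TopologicalSpace E] [Zero E] {t u : E → ℝ}
    (ht : Continuous t) (ht0 : t 0 = 0) (hu : ∀ e, |u e| ≤ 1) (huc : ∀ e ≠ 0, ContinuousAt u e) :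
    Continuous fun e => t e * u e := by
  rw [continuous_iff_continuousAt]
  intro e
  by_cases he : e = 0
  · subst he
    rw [ContinuousAt, ht0, zero_mul]
    refine squeeze_zero_norm (a := fun e => |t e|) (fun e => ?_) ?_
    · rw [Real.norm_eq_abs, abs_mul]
      exact mul_le_of_le_one_right (abs_nonneg _) (hu e)
    · have := (continuous_abs.comp ht).tendsto 0
      simpa [Function.comp_def, ht0] using this
  · exact ht.continuousAt.mul (huc e he)

/-! ### The glued cone and its fundamental group -/

section GluedCone

variable {d : ℕ} {a : ℕ} {S : StellarComplex} {r : Setoid ℕ}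

theorem gluedCone_mk_eq {x y : (cone a S).realization} :
    (Quotient.mk _ x : GluedCone a S r) = Quotient.mk _ y ↔ gluing S r x y :=
  Quotient.eq

theorem eq_of_gluing (ha : ¬ S.IsVertex a) {x y : ℕ → ℝ} (hx : x a ≠ 0) (h : gluing S r x y) :
    x = y := by
  rcases gluing_eq_or_mem h with h | h
  · exact h
  · exact absurd (realization_apply_eq_zero h.1 ha) hx

/-- A parametrization of the cone over a sphere by a Euclidean space. -/
theorem exists_cone_parametrization (ha : ¬ S.IsVertex a) {E : Type*} [NormedAddCommGroup E]
    [NormedSpace ℝ E] [Nontrivial E] (θ : sphere (0 : E) 1 ≃ₜ S.realization) :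
    ∃ J : E → (cone a S).realization, Continuous J ∧ Function.Surjective J ∧
      Set.InjOn J (closedBall 0 1) ∧ ∀ e, (J e : ℕ → ℝ) a = 1 - min 1 (‖e‖ / 2) := by
  classical
  obtain ⟨e₀, he₀⟩ := NormedSpace.sphere_nonempty (x := (0 : E)) (r := 1) |>.mpr zero_le_one
  let g : E → S.realization := fun e => θ (if h : e ∈ sphere (0 : E) 1 then ⟨e, h⟩ else ⟨e₀, he₀⟩)
  have hg : ∀ {e} (h : e ∈ sphere (0 : E) 1), g e = θ ⟨e, h⟩ := fun h => by simp only [g, h, dif_pos]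
  have hgc : ContinuousOn g (sphere 0 1) := by
    rw [continuousOn_iff_continuous_domRestrict]
    refine θ.continuous.congr fun x => (hg x.2).symm
  let N : E → E := fun e => ‖e‖⁻¹ • e
  have hN : ∀ e ≠ 0, N e ∈ sphere (0 : E) 1 := by
    intro e he
    rw [mem_sphere_zero_iff_norm, norm_smul, norm_inv, norm_norm,
      inv_mul_cancel₀ (norm_ne_zero_iff.mpr he)]
  have hgN : ContinuousOn (g ∘ N) {0}ᶜ := by
    refine hgc.comp ?_ fun e he => hN e he
    exact (continuous_norm.continuousOn.inv₀ fun e he => norm_ne_zero_iff.mpr he).smul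
      continuousOn_id
  -- The ball of radius `2` covers the cone and its boundary goes to the base. The closed unit ball
  -- thus covers only the half next to the apex, away from the gluing.
  let t : E → ℝ := fun e => min 1 (‖e‖ / 2)
  have htc : Continuous t := by fun_prop
  have ht0 : ∀ e, 0 ≤ t e := fun e => le_min zero_le_one (by positivity)
  have ht1 : ∀ e, t e ≤ 1 := fun e => min_le_left _ _
  let J : E → (cone a S).realization := fun e =>
    ⟨conePoint a (t e) (g (N e)), conePoint_mem (ht0 e) (ht1 e) ha (g (N e)).2⟩
  have hJa : ∀ e, (J e : ℕ → ℝ) a = 1 - t e := fun e => by simp [J, conePoint]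
  refine ⟨J, ?_, ?_, ?_, hJa⟩
  · refine Continuous.subtype_mk (continuous_pi fun i => ?_) _
    by_cases hia : i = a
    · simp only [conePoint, hia, if_true]
      fun_prop
    · simp only [conePoint, hia, if_false]
      refine continuous_mul_of_bounded htc (by simp [t]) (fun e => ?_) fun e he => ?_
      · rw [abs_of_nonneg ((g (N e)).2.1 i)]
        exact realization_apply_le_one (g (N e)).2 i
      · have h1 : ContinuousAt (g ∘ N) e := hgN.continuousAt (isOpen_compl_singleton.mem_nhds he)
        exact (continuous_apply i).continuousAt.comp
          (continuous_subtype_val.continuousAt.comp h1)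
  · intro x
    let y₀ : S.realization := θ ⟨e₀, he₀⟩
    have hxa := realization_apply_le_one x.2 a
    have hxa0 := x.2.1 a
    set c := 2 * (1 - (x : ℕ → ℝ) a) with hc
    have hc0 : 0 ≤ c := by linarith
    set e₁ := θ.symm (coneBase y₀ x) with he₁
    have hn : ‖(e₁ : E)‖ = 1 := mem_sphere_zero_iff_norm.mp e₁.2
    have hnorm : ‖c • (e₁ : E)‖ = c := by
      rw [norm_smul, hn, mul_one, Real.norm_of_nonneg hc0]
    have ht : t (c • (e₁ : E)) = 1 - (x : ℕ → ℝ) a := by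
      simp only [t, hnorm]
      rw [hc, mul_div_cancel_left₀ _ (two_ne_zero), min_eq_right (by linarith)]
    refine ⟨c • (e₁ : E), Subtype.ext ?_⟩
    rw [← conePoint_coneBase y₀ x]
    change conePoint a (t _) _ = _
    rw [ht]
    by_cases hx1 : (x : ℕ → ℝ) a = 1
    · funext i
      simp [conePoint, hx1]
    · have hcpos : 0 < c := by
        have : (x : ℕ → ℝ) a < 1 := lt_of_le_of_ne hxa hx1
        linarith
      have hNe : N (c • (e₁ : E)) = e₁ := by
        simp only [N, hnorm, smul_smul, inv_mul_cancel₀ hcpos.ne', one_smul]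
      rw [hNe, hg e₁.2]
      simp [he₁]
  · intro e he e' he' h
    rw [mem_closedBall_zero_iff] at he he'
    have hte : ∀ {e : E}, ‖e‖ ≤ 1 → t e = ‖e‖ / 2 := fun h => min_eq_right (by linarith)
    have h1 : ‖e‖ = ‖e'‖ := by
      have := hJa e
      rw [h, hJa e', hte he, hte he'] at this
      linarith
    by_cases he0 : e = 0
    · rw [he0, norm_zero] at h1
      rw [he0, norm_eq_zero.mp h1.symm]
    · have he0' : e' ≠ 0 := fun h => he0 (norm_eq_zero.mp (by rw [h1, h, norm_zero]))
      have hpos : 0 < ‖e‖ := norm_pos_iff.mpr he0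
      have h2 : g (N e) = g (N e') := by
        apply Subtype.ext
        funext i
        by_cases hia : i = a
        · rw [hia, realization_apply_eq_zero (g (N e)).2 ha,
            realization_apply_eq_zero (g (N e')).2 ha]
        · have h3 := congrFun (congrArg Subtype.val h) i
          simp only [J, conePoint, hia, if_false, hte he, hte he', ← h1] at h3
          exact mul_left_cancel₀ (by positivity) h3
      rw [hg (hN e he0), hg (hN e' he0')] at h2
      have h4 : N e = N e' := congrArg Subtype.val (θ.injective h2)
      simp only [N, ← h1] at h4
      exact smul_right_injective E (inv_ne_zero hpos.ne') h4

theorem continuous_coneBase (y₀ : S.realization)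
    {Z : Type*} [TopologicalSpace Z] {f : Z → (cone a S).realization} (hf : Continuous f)
    (h : ∀ z, (f z : ℕ → ℝ) a ≠ 1) : Continuous fun z => coneBase y₀ (f z) := by
  rw [continuous_induced_rng]
  refine continuous_pi fun i => ?_
  have hfi : ∀ i, Continuous fun z => (f z : ℕ → ℝ) i := fun i =>
    (continuous_apply i).comp (continuous_subtype_val.comp hf)
  simp only [Function.comp_apply, coneBase_apply y₀ (h _)]
  split_ifs
  · exact continuous_const
  · exact (hfi i).div (continuous_const.sub (hfi a)) fun z => sub_ne_zero.mpr (h z).symm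

/-- The base of a glued cone. -/
def gluedInclusion (a : ℕ) (S : StellarComplex) (r : Setoid ℕ) :
    C(GluedSpace S r, GluedCone a S r) where
  toFun := Quotient.map (fun y => ⟨y, realization_mono faces_subset_cone y.2⟩) fun _ _ h => h
  continuous_toFun := by
    exact Continuous.quotient_lift (continuous_quotient_mk'.comp
      (Continuous.subtype_mk continuous_subtype_val _)) _

/-- The apex is the centre of a cell of dimension `d + 1 > 2`, embedded because points off `S` are
glued only to themselves. Away from the apex, `ρ` projects to the base and `K` slides points along
the segments of the cone. -/
theorem map_gluedInclusion_bijective (hd : 2 ≤ d) (hS : IsStellarSphere d S)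
    (ha : ¬ S.IsVertex a) [T2Space (GluedCone a S r)] (y : GluedSpace S r) :
    Function.Bijective (FundamentalGroup.map (gluedInclusion a S r) y) := by
  obtain ⟨θ⟩ := hS.nonempty_homeomorph_sphere
  have : Nontrivial (Fin (d + 1) → ℝ) := inferInstance
  obtain ⟨J, hJc, hJs, hJi, hJa⟩ := exists_cone_parametrization ha θ
  let q : (cone a S).realization → GluedCone a S r := Quotient.mk _
  have hq : Topology.IsQuotientMap q := isQuotientMap_quotient_mk'
  have hqc : Continuous q := hq.continuous
  have hqe : ∀ {x y}, q x = q y ↔ gluing S r x y := gluedCone_mk_eq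
  let c : GluedCone a S r := q (J 0)
  have hJ0 : (J 0 : ℕ → ℝ) a = 1 := by rw [hJa]; simp
  have hcoord : ∀ {e}, e ∈ closedBall (0 : Fin (d + 1) → ℝ) 1 → (J e : ℕ → ℝ) a = 1 - ‖e‖ / 2 := by
    intro e he
    rw [mem_closedBall_zero_iff] at he
    rw [hJa, min_eq_right (by linarith)]
  have hJpos : ∀ {e}, e ∈ closedBall (0 : Fin (d + 1) → ℝ) 1 → (J e : ℕ → ℝ) a ≠ 0 := by
    intro e he
    have h1 := hcoord he
    rw [mem_closedBall_zero_iff] at he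
    rw [h1]
    linarith
  have hapex : ∀ x : (cone a S).realization, (x : ℕ → ℝ) a = 1 → q x = c := by
    intro x hx
    obtain ⟨e, rfl⟩ := hJs x
    rw [hJa] at hx
    have h1 : min 1 (‖e‖ / 2) = 0 := by linarith
    have h2 : ‖e‖ = 0 := by
      rcases min_choice (1 : ℝ) (‖e‖ / 2) with h | h <;> linarith
    rw [norm_eq_zero.mp h2]
  have hne : ∀ {x}, q x ≠ c → (x : ℕ → ℝ) a ≠ 1 := fun h h' => h (hapex _ h')
  have hSc : ∀ {x : (cone a S).realization}, (x : ℕ → ℝ) ∈ S.realization → q x ≠ c := by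
    intro x hx h
    have := eq_of_gluing ha (by rw [hJ0]; exact one_ne_zero) (hqe.mp h.symm)
    rw [this, realization_apply_eq_zero hx ha] at hJ0
    exact zero_ne_one hJ0
  obtain ⟨e₀, he₀⟩ := NormedSpace.sphere_nonempty (x := (0 : Fin (d + 1) → ℝ)) (r := 1) |>.mpr
    zero_le_one
  let y₀ : S.realization := θ ⟨e₀, he₀⟩
  let base : (cone a S).realization → S.realization := coneBase y₀
  let incl : S.realization → (cone a S).realization :=
    fun y => ⟨y, realization_mono faces_subset_cone y.2⟩
  let qU : {x : (cone a S).realization // q x ≠ c} → {p : GluedCone a S r // p ≠ c} :=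
    fun x => ⟨q x, x.2⟩
  have hqU : Topology.IsQuotientMap qU :=
    hq.restrictPreimage_isOpen (s := {c}ᶜ) isOpen_compl_singleton
  have hout : ∀ x, gluing S r (Quotient.out (q x) : (cone a S).realization).1 x.1 := fun x => hqe.mp (Quotient.out_eq (q x))
  let ρ : {p : GluedCone a S r // p ≠ c} → GluedSpace S r := fun p =>
    Quotient.mk _ (base (Quotient.out p.1))
  -- Independence of the representative: two distinct glued points both lie in `S`, where `base` is
  -- the identity.
  have hρq : ∀ x, ρ (qU x) = Quotient.mk _ (base x.1) := by
    intro x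
    have h1 := hout x.1
    refine Quotient.sound ?_
    change gluing S r (base (Quotient.out (q x.1))) (base x.1)
    rcases gluing_eq_or_mem h1 with h | h
    · rw [Subtype.ext h]
    · rwa [coneBase_of_mem y₀ ha h.1, coneBase_of_mem y₀ ha h.2]
  have hxU : ∀ x : {x : (cone a S).realization // q x ≠ c}, (x.1 : ℕ → ℝ) a ≠ 1 :=
    fun x => hne x.2
  have hbase : Continuous fun x : {x : (cone a S).realization // q x ≠ c} => base x.1 :=
    continuous_coneBase y₀ continuous_subtype_val hxU
  have hρ : Continuous ρ := by
    rw [hqU.continuous_iff]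
    refine (continuous_quotient_mk'.comp hbase).congr fun x => (hρq x).symm
  -- The coordinate at `a` is scaled by `1 - s` along the segment through `x`, so `s = 0` gives `x`
  -- and `s = 1` its projection to the base.
  let mix : I → (cone a S).realization → (cone a S).realization := fun s x =>
    ⟨conePoint a (1 - (1 - (s : ℝ)) * (x : ℕ → ℝ) a) (base x), conePoint_mem
      (by
        have h1 := realization_apply_le_one x.2 a
        have h2 := x.2.1 a
        have h3 := s.2.1
        have h4 := s.2.2
        nlinarith)
      (by
        have := mul_nonneg (sub_nonneg.mpr s.2.2) (x.2.1 a)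
        linarith) ha (base x).2⟩
  have hmixS : ∀ s (x : (cone a S).realization), (x : ℕ → ℝ) ∈ S.realization → mix s x = x := by
    intro s x hx
    apply Subtype.ext
    change conePoint a _ (base x) = x
    rw [realization_apply_eq_zero hx ha, mul_zero, sub_zero, coneBase_of_mem y₀ ha hx,
      conePoint_one ha hx]
  let K : {p : GluedCone a S r // p ≠ c} × I → GluedCone a S r := fun z =>
    q (mix z.2 (Quotient.out z.1.1))
  have hKq : ∀ x s, K (qU x, s) = q (mix s x.1) := by
    intro x s
    have h1 := hout x.1
    refine hqe.mpr ?_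
    rcases gluing_eq_or_mem h1 with h | h
    · rw [Subtype.ext h]
    · rwa [hmixS s _ h.1, hmixS s _ h.2]
  have hK : Continuous K := by
    -- The product of a quotient map with the locally compact interval is again a quotient map, so
    -- continuity can be checked before gluing.
    refine hqU.continuous_lift_prod_left ?_
    simp only [hKq]
    refine hqc.comp (Continuous.subtype_mk (continuous_pi fun i => ?_) _)
    have hxi : Continuous fun z : {x : (cone a S).realization // q x ≠ c} × I =>
        (z.1.1 : ℕ → ℝ) a := (continuous_apply a).comp
      (continuous_subtype_val.comp (continuous_subtype_val.comp continuous_fst))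
    have hbi : Continuous fun z : {x : (cone a S).realization // q x ≠ c} × I =>
        (base z.1.1 : ℕ → ℝ) i := (continuous_apply i).comp
      (continuous_subtype_val.comp (hbase.comp continuous_fst))
    unfold conePoint
    have ht : Continuous fun z : {x : (cone a S).realization // q x ≠ c} × I =>
        1 - (1 - (z.2 : ℝ)) * (z.1.1 : ℕ → ℝ) a := by fun_prop
    split_ifs
    · exact continuous_const.sub ht
    · exact ht.mul hbi
  have hincl : ∀ y, gluedInclusion a S r (Quotient.mk _ y) = q (incl y) := fun _ => rfl
  have hic : ∀ y, gluedInclusion a S r y ≠ c := by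
    intro y
    induction y using Quotient.inductionOn with
    | h y => rw [hincl]; exact hSc y.2
  refine FundamentalGroup.map_bijective_of_pushOff (gluedInclusion a S r) c hic hρ ?_ hK ?_ ?_ ?_
    ?_ y
  · intro y
    induction y using Quotient.inductionOn with
    | h y =>
      refine (hρq ⟨incl y, hSc y.2⟩).trans (congrArg _ (Subtype.ext ?_))
      exact coneBase_of_mem y₀ ha y.2
  · intro p
    obtain ⟨x, rfl⟩ := hqU.surjective p
    rw [hKq]
    refine congrArg q (Subtype.ext ?_)
    change conePoint a (1 - (1 - ((0 : I) : ℝ)) * _) (base x.1) = _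
    rw [Set.Icc.coe_zero, sub_zero, one_mul]
    exact conePoint_coneBase y₀ x.1
  · intro p
    obtain ⟨x, rfl⟩ := hqU.surjective p
    rw [hKq, hρq, hincl]
    refine congrArg q (Subtype.ext ?_)
    change conePoint a (1 - (1 - ((1 : I) : ℝ)) * _) (base x.1) = base x.1
    rw [Set.Icc.coe_one, sub_self, zero_mul, sub_zero]
    exact conePoint_one ha (base x.1).2
  · intro y s
    induction y using Quotient.inductionOn with
    | h y => exact (hKq ⟨incl y, hSc y.2⟩ s).trans (congrArg q (hmixS s _ y.2))
  · intro f hf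
    have hinj : Set.InjOn (q ∘ J) (closedBall 0 1) := by
      intro e he e' he' h
      exact hJi he he' (Subtype.ext (eq_of_gluing ha (hJpos he) (hqe.mp h)))
    -- The open cell is the part of the cone where the coordinate at `a` exceeds `1 / 2`; this shows
    -- that it is open in the quotient.
    have hpre : q ⁻¹' ((q ∘ J) '' ball 0 1) =
        {x : (cone a S).realization | 1 / 2 < (x : ℕ → ℝ) a} := by
      ext x
      constructor
      · rintro ⟨e, he, h⟩
        have he' := ball_subset_closedBall he
        have h1 := eq_of_gluing ha (hJpos he') (hqe.mp h)
        change 1 / 2 < (x : ℕ → ℝ) a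
        rw [← h1, hcoord he']
        rw [mem_ball_zero_iff] at he
        linarith
      · intro hx
        have hx : 1 / 2 < (x : ℕ → ℝ) a := hx
        obtain ⟨e, rfl⟩ := hJs x
        refine ⟨e, ?_, rfl⟩
        rw [mem_ball_zero_iff]
        rw [hJa] at hx
        by_contra hle
        rw [not_lt] at hle
        have : 1 / 2 ≤ min 1 (‖e‖ / 2) := le_min (by norm_num) (by linarith)
        linarith
    have hopen : IsOpen ((q ∘ J) '' ball (0 : Fin (d + 1) → ℝ) 1) := by
      rw [← hq.isOpen_preimage, hpre]
      exact isOpen_lt continuous_const ((continuous_apply a).comp continuous_subtype_val)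
    obtain ⟨G, hG, hG0, hG1, hGf⟩ := exists_pushOff (by simp; omega)
      (hqc.comp hJc).continuousOn hinj hopen hf
    refine ⟨G, hG, hG0, hG1, fun s z hz => hGf s z fun hmem => ?_⟩
    obtain ⟨y, hy⟩ := hz
    obtain ⟨e, he, h⟩ := hmem
    induction y using Quotient.inductionOn with
    | h y =>
      rw [hincl, ← h] at hy
      have he' := ball_subset_closedBall he
      have h1 := eq_of_gluing ha (hJpos he') (hqe.mp hy.symm)
      refine hJpos he' ?_
      rw [h1]
      exact realization_apply_eq_zero y.2 ha

theorem pathConnectedSpace_gluedCone (hS : IsStellarSphere d S) (ha : ¬ S.IsVertex a) :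
    PathConnectedSpace (GluedCone a S r) := by
  obtain ⟨θ⟩ := hS.nonempty_homeomorph_sphere
  obtain ⟨J, hJc, hJs, -⟩ := exists_cone_parametrization ha θ
  have hs : Function.Surjective fun e => (Quotient.mk _ (J e) : GluedCone a S r) :=
    Quotient.mk_surjective.comp hJs
  exact hs.pathConnectedSpace (continuous_quotient_mk'.comp hJc)

/-- The glued cone is Hausdorff because it is homeomorphic to `|M|`, and path connected as a
continuous image of a Euclidean space; the latter makes the choice of base point in `|M|`
irrelevant. -/
theorem IsTriangulatedBy.nonempty_fundamentalGroup_mulEquiv (hd : 2 ≤ d) {M : StellarComplex}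
    (hS : IsStellarSphere d S) (ha : ¬ S.IsVertex a) (hM : IsTriangulatedBy M a S r)
    (x : M.realization) (y : GluedSpace S r) :
    Nonempty (FundamentalGroup M.realization x ≃* FundamentalGroup (GluedSpace S r) y) := by
  obtain ⟨h, -⟩ := hM
  have : T2Space (GluedCone a S r) := h.symm.t2Space
  have : PathConnectedSpace (GluedCone a S r) := pathConnectedSpace_gluedCone hS ha
  have : PathConnectedSpace M.realization := h.surjective.pathConnectedSpace h.continuous
  let e₁ := MulEquiv.ofBijective _ (map_gluedInclusion_bijective (r := r) hd hS ha y)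
  let e₂ := MulEquiv.ofBijective _
    (FundamentalGroup.map_bijective_of_homeomorph h (gluedInclusion a S r y))
  exact ⟨((e₁.trans e₂).trans
    (FundamentalGroup.fundamentalGroupMulEquivOfPathConnected _ x)).symm⟩

end GluedCone

end StellarComplex

open StellarComplex in
theorem theorem2 (n : ℕ) (hn : 2 < n) (M : StellarComplex) (hM : IsStellarManifold n M)
    (hc : ConnectedSpace M.realization) :
    (∃ (a : ℕ) (S : StellarComplex) (r : Setoid ℕ),
      IsStellarSphere (n - 1) S ∧ ¬ S.IsVertex a ∧ IsRegular S r ∧ IsTriangulatedBy M a S r ∧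
      ∀ σ ∈ S.faces, ∀ τ ∈ S.faces, ∀ x y, Corresponding S r σ τ x y → gluing S r x y) ∧
    ∀ (a : ℕ) (S : StellarComplex) (r : Setoid ℕ),
      IsStellarSphere (n - 1) S → ¬ S.IsVertex a → IsRegular S r → IsTriangulatedBy M a S r →
      ∀ (x : M.realization) (y : GluedSpace S r),
        Nonempty (FundamentalGroup M.realization x ≃* FundamentalGroup (GluedSpace S r) y) := by
  refine ⟨hM.exists_isTriangulatedBy (by omega) hc, fun a S r hS ha _ hT x y => ?_⟩
  exact hT.nonempty_fundamentalGroup_mulEquiv (by omega) hS ha x y
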